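/- Let $\mathbb{N}=\{1,2,\dots\}$ and, for $h>0$, $t\in\mathbb{R}$, let $\lfloor t\rfloor_h=\max(\{0,h,-h,2h,-2h,\dots\}\cap(-\infty,t])$. **Setting.** Let $(H,\langle\cdot,\cdot\rangle_H,\|\cdot\|_H)$ be a separable real Hilbert space with a non-empty orthonormal basis $\mathbb{H}\subseteq H$, let $T,c,\varphi\in(0,\infty)$, $\epsilon\in[0,1)$, $\rho\in[0,\frac12)$, $\gamma\in(\rho,\frac12]$, $\chi\in\big(0,\frac{\gamma-\rho}{1+\varphi/2}\big]\cap\big(0,\frac{1-\rho}{1+\varphi}\big]$, let $\mathcal{D}$ be a set of finite non-empty subsets of $\mathbb{H}$, and let $\mu\colon\mathbb{H}\to\mathbb{R}$ satisfy $\sup_{h\in\mathbb{H}}\mu_h<0$. Let $A\colon D(A)\subseteq H\to H$ be given by $D(A)=\{v\in H\colon\sum_{h\in\mathbb{H}}|\mu_h\langle h,v\rangle_H|^2<\infty\}$ and $Av=\sum_{h\in\mathbb{H}}\mu_h\langle h,v\rangle_H h$. For $r\ge0$ let $H_r=D((-A)^r)$ with $\langle v,w\rangle_{H_r}=\langle(-A)^rv,(-A)^rw\rangle_H$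 and $\|v\|_{H_r}=\|(-A)^rv\|_H$. Let $V$ be a real Banach space with $H_\rho\subseteq V\subseteq H$ continuously and densely. For finite $I\subseteq\mathbb{H}$ let $P_Iu=\sum_{h\in I}\langle h,u\rangle_H h$, $u\in H$. Let $\phi,\Phi\colon C([0,T],H_1)\to[0,\infty)$ be Borel measurable and let $F\colon V\to H$ be continuous such that for all finite $I\subseteq\mathbb{H}$, $v,w\in P_I(H)$, $x\in C([0,T],H_1)$, $t\in[0,T]$ $$\langle v-w,Av+F(v)-Aw-F(w)\rangle_H\le c\|v-w\|_H^2,$$ $$\langle v,P_IF(v+x_t)\rangle_{H_{1/2}}+\phi(x)\langle v,F(v+x_t)\rangle_H\le\epsilon\|v\|_{H_1}^2+(c+\phi(x))\|v\|_{H_{1/2}}^2+c\,\phi(x)\|v\|_H^2+\Phi(x),$$ $$\|F(v)-F(w)\|_H^2\le c\|v-w\|_V^2\,(1+\|v\|_V^\varphi+\|w\|_V^\varphi).$$ Let $(\Omega,\mathcal{F},\mathbb{P})$ be a probability space, let $X,O\colon[0,T]\times\Omega\to V$ and $\mathcal{O}^{M,I}\colon[0,T]\times\Omega\to H_1$, $M\in\mathbb{N}$,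 $I\in\mathcal{D}$, be stochastic processes with continuous sample paths and $\mathcal{O}^{M,I}([0,T]\times\Omega)\subseteq P_I(H)$, and let $Y^{M,I}\colon[0,T]\times\Omega\to H_\gamma$, $M\in\mathbb{N}$, $I\in\mathcal{D}$, be stochastic processes such that for all $t\in[0,T]$, $M\in\mathbb{N}$, $I\in\mathcal{D}$ it holds $\mathbb{P}$-almost surely that $$X_t=\int_0^te^{(t-s)A}F(X_s)\,ds+O_t,$$ $$Y^{M,I}_t=\int_0^tP_I\,e^{(t-s)A}\,\mathbf{1}_{\{\|Y^{M,I}_{\lfloor s\rfloor_{T/M}}\|_{H_\gamma}+\|\mathcal{O}^{M,I}_{\lfloor s\rfloor_{T/M}}\|_{H_\gamma}\le(M/T)^\chi\}}\,F(Y^{M,I}_{\lfloor s\rfloor_{T/M}})\,ds+\mathcal{O}^{M,I}_t.$$ **Assumptions.** Let $\theta\in[0,\infty)$, $\vartheta\in(0,\infty)$, $p\in[\max\{2,1/\varphi\},\infty)$, $\varrho\in[0,1-\rho)$, and assume that $$\sup_{t\in[0,T]}\mathbb{E}\big[\|X_t\|_V^{p(1+\varphi/2)\max\{2,\varphi\}}\big]<\infty,$$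 $$\sup_{M\in\mathbb{N},\,I\in\mathcal{D},\,t\in[0,T]}M^\theta\Big\{\big(\mathbb{E}\|P_I(O_t-O_{\lfloor t\rfloor_{T/M}})\|_V^{2p}\big)^{\frac1{2p}}+\big(\mathbb{E}\|P_IO_t-\mathcal{O}^{M,I}_t\|_V^{p\max\{2,\varphi\}}\big)^{\frac1{p\max\{2,\varphi\}}}\Big\}<\infty,$$ $$\sup_{M\in\mathbb{N},\,I\in\mathcal{D},\,t\in[0,T]}\mathbb{E}\Big[\big|\|\mathcal{O}^{M,I}_t\|_{H_\gamma}^2+\Phi(\mathcal{O}^{M,I})+\phi(\mathcal{O}^{M,I})\big|^{p\max\{2\vartheta,\,2+\varphi,\,(1+\varphi/2)\varphi/2\}}\Big]<\infty.$$ **Conclusion.** Then (i) $\displaystyle\sup_{M\in\mathbb{N}}\sup_{I\in\mathcal{D}}\sup_{t\in[0,T]}\mathbb{E}\big[\|Y^{M,I}_t\|_{H_\gamma}^{p\max\{4\vartheta,\,4+2\varphi,\,\varphi(1+\varphi/2)\}}\big]<\infty$, and (ii) there exists $C\in(0,\infty)$ such that for all $M\in\mathbb{N}$, $I\in\mathcal{D}$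 $$\sup_{t\in[0,T]}\big(\mathbb{E}\|X_t-Y^{M,I}_t\|_H^p\big)^{1/p}\le C\Big[M^{-\min\{\vartheta\chi,\varrho,\theta\}}+\|(-A)^{-\varrho}(\mathrm{Id}_H-P_I)\|_{L(H)}+\sup_{t\in[0,T]}\big(\mathbb{E}\|(\mathrm{Id}_H-P_I)O_t\|_V^{2p}\big)^{\frac1{2p}}\Big],$$ where the right-hand side may be infinite. -/

import Mathlib

open MeasureTheory Set
open scoped NNReal ENNReal

noncomputable section

/-- The data defining the diagonal operator `A`: an orthonormal basis `(b i)` of the Hilbert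
space `H` and real eigenvalues `μ i` with `sup μ < 0`. -/
structure DiagonalData (ι : Type*) (H : Type*) [NormedAddCommGroup H]
    [InnerProductSpace ℝ H] where
  basis : HilbertBasis ι ℝ H
  eig : ι → ℝ
  sup_eig_neg : ∃ δ : ℝ, 0 < δ ∧ ∀ i, eig i ≤ -δ

namespace DiagonalData

variable {ι : Type*} {H : Type*} [NormedAddCommGroup H] [InnerProductSpace ℝ H]

theorem memlp_of_summable {m : ι → ℝ} (h : Summable fun i => m i ^ 2) :
    Memℓp m 2 := by
  refine memℓp_gen ?_
  simpa using h

/-- The maximal domain `{v ∈ H | ∑ i, |m i * ⟪b i, v⟫|² < ∞}` of the diagonal operator with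
multipliers `m`. -/
def diagDomain (b : HilbertBasis ι ℝ H) (m : ι → ℝ) : Submodule ℝ H where
  carrier := {v | Summable fun i => (m i * inner ℝ (b i) v) ^ 2}
  zero_mem' := by simp [summable_zero]
  add_mem' := by
    intro v w hv hw
    have hv' : Summable fun i => (m i * inner ℝ (b i) v) ^ 2 := hv
    have hw' : Summable fun i => (m i * inner ℝ (b i) w) ^ 2 := hw
    refine Summable.of_nonneg_of_le (fun i => sq_nonneg _) (fun i => ?_)
      ((hv'.mul_left 2).add (hw'.mul_left 2))
    rw [inner_add_right]
    nlinarith [sq_nonneg (m i * inner ℝ (b i) v - m i * inner ℝ (b i) w)]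
  smul_mem' := by
    intro a v hv
    have hv' : Summable fun i => (m i * inner ℝ (b i) v) ^ 2 := hv
    refine (hv'.mul_left (a ^ 2)).congr (fun i => ?_)
    rw [inner_smul_right]
    ring

/-- The square-summable coefficients `(m i * ⟪b i, v⟫)` of `v` in the domain. -/
def diagCoeff (b : HilbertBasis ι ℝ H) (m : ι → ℝ) :
    diagDomain b m →ₗ[ℝ] lp (fun _ : ι => ℝ) 2 where
  toFun v := ⟨fun i => m i * inner ℝ (b i) (v : H), memlp_of_summable v.2⟩
  map_add' v w := by
    apply lp.ext
    funext i
    change m i * inner ℝ (b i) ((v : H) + w) = m i * inner ℝ (b i) (v : H) + m i * inner ℝ (b i) (w : H)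
    rw [inner_add_right, mul_add]
  map_smul' a v := by
    apply lp.ext
    funext i
    change m i * inner ℝ (b i) (a • (v : H)) = a * (m i * inner ℝ (b i) (v : H))
    rw [inner_smul_right]
    ring

/-- The (possibly unbounded) diagonal operator `v ↦ ∑ i, (m i * ⟪b i, v⟫) • b i` with its maximal
domain; see `hasSum_diagOp` for the series. -/
def diagOp (b : HilbertBasis ι ℝ H) (m : ι → ℝ) : H →ₗ.[ℝ] H where
  domain := diagDomain b m
  toFun := (b.repr.symm.toLinearEquiv : lp (fun _ : ι => ℝ) 2 →ₗ[ℝ] H) ∘ₗ diagCoeff b m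

theorem hasSum_diagOp (b : HilbertBasis ι ℝ H) (m : ι → ℝ) (v : (diagOp b m).domain) :
    HasSum (fun i => (m i * inner ℝ (b i) (v : H)) • b i) (diagOp b m v) :=
  b.hasSum_repr_symm (diagCoeff b m v)

theorem inner_diagOp (b : HilbertBasis ι ℝ H) (m : ι → ℝ) (v : (diagOp b m).domain) (i : ι) :
    inner ℝ (b i) (diagOp b m v) = m i * inner ℝ (b i) (v : H) := by
  rw [← b.repr_apply_apply]
  change b.repr (b.repr.symm (diagCoeff b m v)) i = _
  rw [LinearIsometryEquiv.apply_symm_apply]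
  rfl

theorem hasSum_sq (b : HilbertBasis ι ℝ H) (v : H) :
    HasSum (fun i => inner ℝ (b i) v ^ 2) (‖v‖ ^ 2) := by
  have h := b.hasSum_inner_mul_inner v v
  rw [real_inner_self_eq_norm_sq] at h
  refine h.congr_fun ?_
  intro i
  rw [real_inner_comm v (b i)]
  ring

theorem mem_diagOp_domain {b : HilbertBasis ι ℝ H} {m : ι → ℝ} {v : H} :
    v ∈ (diagOp b m).domain ↔ Summable fun i => (m i * inner ℝ (b i) v) ^ 2 := Iff.rfl

theorem mem_domain_of_le {b : HilbertBasis ι ℝ H} {m m' : ι → ℝ} {K : ℝ}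
    (hK : ∀ i, |m i| ≤ K * |m' i|) {v : H} (hv : v ∈ (diagOp b m').domain) :
    v ∈ (diagOp b m).domain := by
  rw [mem_diagOp_domain] at hv ⊢
  refine Summable.of_nonneg_of_le (fun i => sq_nonneg _) (fun i => ?_) (hv.mul_left (K ^ 2))
  have h1 : m i ^ 2 ≤ (K * |m' i|) ^ 2 := by
    rw [← sq_abs (m i)]
    exact pow_le_pow_left₀ (abs_nonneg _) (hK i) 2
  rw [mul_pow, sq_abs] at h1
  calc (m i * inner ℝ (b i) v) ^ 2 = m i ^ 2 * inner ℝ (b i) v ^ 2 := by ring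
    _ ≤ (K ^ 2 * m' i ^ 2) * inner ℝ (b i) v ^ 2 :=
        mul_le_mul_of_nonneg_right h1 (sq_nonneg _)
    _ = K ^ 2 * (m' i * inner ℝ (b i) v) ^ 2 := by ring

theorem mem_domain_of_bounded {b : HilbertBasis ι ℝ H} {m : ι → ℝ} {K : ℝ}
    (hK : ∀ i, |m i| ≤ K) (v : H) : v ∈ (diagOp b m).domain := by
  refine mem_domain_of_le (m' := fun _ => 1) (K := K) (fun i => by simpa using hK i) ?_
  rw [mem_diagOp_domain]
  simpa using (hasSum_sq b v).summable

/-- The diagonal operator with bounded multipliers, as an everywhere defined bounded operator. -/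
def diagCLM (b : HilbertBasis ι ℝ H) (m : ι → ℝ) (K : ℝ) (hK : ∀ i, |m i| ≤ K) : H →L[ℝ] H :=
  LinearMap.mkContinuous
    { toFun := fun v => diagOp b m ⟨v, mem_domain_of_bounded hK v⟩
      map_add' := fun v w => (diagOp b m).map_add
        ⟨v, mem_domain_of_bounded hK v⟩ ⟨w, mem_domain_of_bounded hK w⟩
      map_smul' := fun a v => (diagOp b m).map_smul a ⟨v, mem_domain_of_bounded hK v⟩ }
    |K| (by
      intro v
      refine (sq_le_sq₀ (norm_nonneg _) (by positivity)).1 ?_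
      rw [mul_pow, sq_abs]
      refine hasSum_le (fun i => ?_) (hasSum_sq b _) ((hasSum_sq b v).mul_left (K ^ 2))
      simp only [LinearMap.coe_mk, AddHom.coe_mk, inner_diagOp]
      rw [mul_pow]
      refine mul_le_mul_of_nonneg_right ?_ (sq_nonneg _)
      rw [← sq_abs (m i)]
      exact pow_le_pow_left₀ (abs_nonneg _) (hK i) 2)

theorem diagCLM_apply (b : HilbertBasis ι ℝ H) (m : ι → ℝ) (K : ℝ) (hK : ∀ i, |m i| ≤ K)
    (v : H) : HasSum (fun i => (m i * inner ℝ (b i) v) • b i) (diagCLM b m K hK v) :=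
  hasSum_diagOp b m ⟨v, mem_domain_of_bounded hK v⟩

variable (𝔄 : DiagonalData ι H)

theorem eig_neg (i : ι) : 0 < -𝔄.eig i := by
  obtain ⟨δ, h0, h⟩ := 𝔄.sup_eig_neg
  linarith [h i]

/-- The operator `A : D(A) ⊆ H → H`, `A v = ∑ i, μ i * ⟪b i, v⟫ • b i`. -/
def op : H →ₗ.[ℝ] H := diagOp 𝔄.basis 𝔄.eig

/-- The fractional power `(-A)^r`, `r ≥ 0`, with its domain. -/
def fracPow (r : ℝ) : H →ₗ.[ℝ] H := diagOp 𝔄.basis fun i => (-𝔄.eig i) ^ r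

theorem fracPow_injective (r : ℝ) : Function.Injective (𝔄.fracPow r).toFun := by
  intro v w h
  apply Subtype.ext
  apply 𝔄.basis.repr.injective
  apply lp.ext
  funext i
  rw [𝔄.basis.repr_apply_apply, 𝔄.basis.repr_apply_apply]
  have h1 := congrArg (fun u => inner ℝ (𝔄.basis i) u) h
  have h2 : (-𝔄.eig i) ^ r * inner ℝ (𝔄.basis i) (v : H)
      = (-𝔄.eig i) ^ r * inner ℝ (𝔄.basis i) (w : H) :=
    (inner_diagOp 𝔄.basis _ v i).symm.trans (h1.trans (inner_diagOp 𝔄.basis _ w i))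
  exact mul_left_cancel₀ (Real.rpow_pos_of_pos (𝔄.eig_neg i) r).ne' h2

/-- The interpolation space `H_r = D((-A)^r)`, `r ≥ 0`, associated to `-A`. It carries the inner
product `⟨v, w⟩_{H_r} = ⟨(-A)^r v, (-A)^r w⟩_H` and the norm `‖v‖_{H_r} = ‖(-A)^r v‖_H`.
(Only exponents `r ≥ 0` are meant.) -/
def Hsp (r : ℝ) : Type _ := (𝔄.fracPow r).domain

namespace Hsp

variable {𝔄} {r s : ℝ}

instance : AddCommGroup (𝔄.Hsp r) := inferInstanceAs (AddCommGroup (𝔄.fracPow r).domain)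

instance : Module ℝ (𝔄.Hsp r) := inferInstanceAs (Module ℝ (𝔄.fracPow r).domain)

/-- `(-A)^r` as a linear map `H_r → H`. -/
def pow : 𝔄.Hsp r →ₗ[ℝ] H := (𝔄.fracPow r).toFun

instance : NormedAddCommGroup (𝔄.Hsp r) :=
  NormedAddCommGroup.induced (𝔄.Hsp r) H (pow : 𝔄.Hsp r →ₗ[ℝ] H) (𝔄.fracPow_injective r)

instance : InnerProductSpace ℝ (𝔄.Hsp r) where
  inner v w := inner ℝ (pow v) (pow w)
  norm_smul_le a v := by
    change ‖pow (a • v)‖ ≤ ‖a‖ * ‖pow v‖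
    rw [map_smul, norm_smul]
  norm_sq_eq_re_inner v := by
    change ‖pow v‖ ^ 2 = _
    simp
  conj_inner_symm v w := by
    simpa using real_inner_comm (pow v) (pow w)
  add_left u v w := by
    rw [map_add, inner_add_left]
  smul_left v w a := by
    rw [map_smul, inner_smul_left]

theorem norm_def (v : 𝔄.Hsp r) : ‖v‖ = ‖pow v‖ := rfl

theorem inner_def (v w : 𝔄.Hsp r) : inner ℝ v w = inner ℝ (pow v) (pow w) := rfl

instance : MeasurableSpace (𝔄.Hsp r) := borel _

instance : BorelSpace (𝔄.Hsp r) := ⟨rfl⟩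

/-- The inclusion `H_r ⊆ H`. -/
def toH : 𝔄.Hsp r →ₗ[ℝ] H := (𝔄.fracPow r).domain.subtype

theorem mem_of_le (h : s ≤ r) {v : H} (hv : v ∈ (𝔄.fracPow r).domain) :
    v ∈ (𝔄.fracPow s).domain := by
  obtain ⟨δ, h0, hδ⟩ := 𝔄.sup_eig_neg
  refine mem_domain_of_le (K := δ ^ (s - r)) (fun i => ?_) hv
  have hi := 𝔄.eig_neg i
  rw [abs_of_pos (Real.rpow_pos_of_pos hi s), abs_of_pos (Real.rpow_pos_of_pos hi r)]
  have h1 : (-𝔄.eig i) ^ s = (-𝔄.eig i) ^ (s - r) * (-𝔄.eig i) ^ r := by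
    rw [← Real.rpow_add hi]
    ring_nf
  rw [h1]
  refine mul_le_mul_of_nonneg_right ?_ (Real.rpow_nonneg hi.le r)
  exact Real.rpow_le_rpow_of_nonpos h0 (by linarith [hδ i]) (by linarith)

/-- The inclusion `H_r ⊆ H_s` for `s ≤ r`. -/
def incl (h : s ≤ r) : 𝔄.Hsp r →ₗ[ℝ] 𝔄.Hsp s :=
  Submodule.inclusion fun _ hv => mem_of_le h hv

/-- The operator `A` on `H_1 = D(A)`. -/
def gen (v : 𝔄.Hsp 1) : H :=
  𝔄.op ⟨v.toH, mem_domain_of_le (K := 1) (m' := fun i => (-𝔄.eig i) ^ (1 : ℝ))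
    (fun i => by simp) v.2⟩

end Hsp

/-- The semigroup `e^{tA}`, `t ≥ 0` (by convention the identity for `t < 0`, never used). -/
def semigroup (t : ℝ) : H →L[ℝ] H :=
  diagCLM 𝔄.basis (fun i => Real.exp (max t 0 * 𝔄.eig i)) 1 fun i => by
    rw [abs_of_pos (Real.exp_pos _), Real.exp_le_one_iff]
    exact mul_nonpos_of_nonneg_of_nonpos (le_max_right _ _) (by linarith [𝔄.eig_neg i])

theorem negPow_bound (r : ℝ) (hr : 0 ≤ r) (i : ι) :
    |(-𝔄.eig i) ^ (-r)| ≤ 𝔄.sup_eig_neg.choose ^ (-r) := by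
  have h := 𝔄.sup_eig_neg.choose_spec
  rw [abs_of_pos (Real.rpow_pos_of_pos (𝔄.eig_neg i) _)]
  exact Real.rpow_le_rpow_of_nonpos h.1 (by linarith [h.2 i]) (by linarith)

/-- The bounded operator `(-A)^{-r}`, `r ≥ 0`. -/
def negPow (r : ℝ) (hr : 0 ≤ r) : H →L[ℝ] H :=
  diagCLM 𝔄.basis (fun i => (-𝔄.eig i) ^ (-r)) _ (𝔄.negPow_bound r hr)

/-- The projection `P_I u = ∑ i ∈ I, ⟪b i, u⟫ • b i` in `L(H)`. -/
def proj (I : Finset ι) : H →L[ℝ] H :=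
  ∑ i ∈ I, (innerSL ℝ (𝔄.basis i)).smulRight (𝔄.basis i)

theorem proj_apply (I : Finset ι) (u : H) :
    𝔄.proj I u = ∑ i ∈ I, inner ℝ (𝔄.basis i) u • 𝔄.basis i := by
  simp [proj]

theorem proj_mem (I : Finset ι) (r : ℝ) (u : H) : 𝔄.proj I u ∈ (𝔄.fracPow r).domain := by
  rw [proj_apply]
  refine Submodule.sum_mem _ fun i _ => Submodule.smul_mem _ _ ?_
  refine summable_of_ne_finset_zero (s := {i}) fun j hj => ?_
  have hji : j ≠ i := by simpa using hj
  rw [𝔄.basis.orthonormal.2 hji]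
  simp

/-- `P_I` regarded as a map from `H` into `H_r`. -/
def projTo (I : Finset ι) (r : ℝ) : H →ₗ[ℝ] 𝔄.Hsp r :=
  LinearMap.codRestrict (𝔄.fracPow r).domain (𝔄.proj I : H →ₗ[ℝ] H) (𝔄.proj_mem I r)

/-- The subspace `P_I(H)` of `H`. -/
def projRange (I : Finset ι) : Submodule ℝ H := LinearMap.range (𝔄.proj I : H →ₗ[ℝ] H)

/-- `H_ρ ⊆ V ⊆ H` continuously and densely: `toH` is the inclusion `V ⊆ H` and `ofHsp` is the
inclusion `H_ρ ⊆ V`. -/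
structure Between (ρ : ℝ) (V : Type*) [NormedAddCommGroup V] [NormedSpace ℝ V] where
  toH : V →L[ℝ] H
  toH_injective : Function.Injective toH
  denseRange_toH : DenseRange toH
  ofHsp : 𝔄.Hsp ρ →L[ℝ] V
  denseRange_ofHsp : DenseRange ofHsp
  toH_ofHsp : ∀ v : 𝔄.Hsp ρ, toH (ofHsp v) = v.toH

/-- The inclusion `H_r ⊆ H_ρ ⊆ V` for `r ≥ ρ`. -/
def Between.incl {𝔄 : DiagonalData ι H} {ρ : ℝ} {V : Type*} [NormedAddCommGroup V]
    [NormedSpace ℝ V] (j : 𝔄.Between ρ V) {r : ℝ} (h : ρ ≤ r) : 𝔄.Hsp r →ₗ[ℝ] V :=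
  (j.ofHsp : 𝔄.Hsp ρ →ₗ[ℝ] V) ∘ₗ Hsp.incl h

end DiagonalData

/-- `⌊t⌋_h = max ({0, h, -h, 2h, -2h, …} ∩ (-∞, t])` for `h > 0`. -/
def gridFloor (h t : ℝ) : ℝ := h * ⌊t / h⌋

theorem isGreatest_gridFloor {h : ℝ} (hh : 0 < h) (t : ℝ) :
    IsGreatest ({x | ∃ k : ℤ, x = h * k} ∩ Set.Iic t) (gridFloor h t) := by
  refine ⟨⟨⟨_, rfl⟩, ?_⟩, ?_⟩
  · have := Int.floor_le (t / h)
    rw [le_div_iff₀ hh] at this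
    simpa [gridFloor, mul_comm] using this
  · rintro x ⟨⟨k, rfl⟩, hk⟩
    have hk' : h * k ≤ t := hk
    have : k ≤ ⌊t / h⌋ := by
      rw [Int.le_floor, le_div_iff₀ hh]
      linarith
    exact mul_le_mul_of_nonneg_left (by exact_mod_cast this) hh.le

/-- The path `t ↦ f t` on `[0, T]` as an element of `C([0, T], E)`. -/
def pathOn {E : Type*} [TopologicalSpace E] {T : ℝ} {f : ℝ → E}
    (hf : ContinuousOn f (Icc (0 : ℝ) T)) : C(Icc (0 : ℝ) T, E) :=
  ⟨fun t => f t, hf.domRestrict⟩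

theorem le_one_of_lt_half {ρ : ℝ} (h : ρ < 1 / 2) : ρ ≤ 1 := by linarith

theorem half_le_one_real : (1 / 2 : ℝ) ≤ 1 := by norm_num

theorem le_one_of_le_half {γ : ℝ} (h : γ ≤ 1 / 2) : γ ≤ 1 := by linarith

end

/-! For a bounded driver `g` put `z_t = ∫₀ᵗ P_I e^{(t-s)A} g(s) ds`. Since `I` is finite, `z` has
finitely many coordinates, and each solves `z' = μ z + g` from the right wherever `g` is
right-continuous. The scheme is `z + 𝒪`, where `g` is the truncated drift frozen at grid points.
Both halves of the proof are energy estimates for such a `z`, followed by Gronwall's inequality. The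
noise enters only as a shift of the argument of `F` and is never differentiated.

A priori bound. Take the energy `‖z‖²_{H_{1/2}} + φ(𝒪) ‖z‖²_H`. Its derivative contains exactly the
two pairings that the coercivity condition controls, provided that `F` is evaluated at `z_t + 𝒪_a`,
where `a` is the grid point before `t`. The scheme uses `F(z_a + 𝒪_a)` instead. While the truncation
does not act, all quantities are at most of order `h^{-χ}` with `h = T/M`, and an increment of `z`
over one step is small in `H_ρ`. The two upper bounds on `χ` are what makes the difference of the
two drifts bounded uniformly in `h` and `I` (`Between.exists_norm_sub_le`). This bounded error is
absorbed by the remaining dissipation `(1-ε)‖z‖²_{H_1}`. Once the truncation acts, the drift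
vanishes and the linear part cannot increase the energy. The result is a pathwise bound by `1 + Φ(𝒪)
+ φ(𝒪)` (`exists_norm_projTo_half_conv_le`), and conclusion (i) follows by taking moments.

Strong error. The exact solution need not lie in `P_I(H)`, where monotonicity is assumed, and its
noise is not `𝒪`. It is therefore compared with `v_t = ∫₀ᵗ P_I e^{(t-s)A} F(X_s) ds + 𝒪_t`. Then `v`
and the scheme `w` share the same noise, and monotonicity gives `‖v - w‖² ≤ C ∫ ‖d‖²` with defect `d
= (F(X) - F(v)) + (F(w) - g)` (`norm_sq_conv_sub_le`). The first part of `d` is controlled by local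
Lipschitz continuity and by `X - v`, which consists of the Galerkin residual, estimated through
smoothing of the semigroup, and of noise errors (`lpN_sub_galerkin_le`). The second part is a time
increment of the scheme, of order `h^ϱ` plus noise errors, together with the contribution of the
truncation event, of order `h^{ϑχ}` by a Markov-type argument (`lpN_scheme_defect_le`). The moments
of (i) make all constants uniform, and `exists_strong_error_le` collects the estimates. -/

open Filter Topology

namespace DiagonalData

/-! ### Coordinates in the eigenbasis and the spaces `H_r`. -/

section Coordinates

variable {ι H : Type*} [NormedAddCommGroup H] [InnerProductSpace ℝ H] (𝔄 : DiagonalData ι H)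

theorem ext_inner {u v : H}
    (h : ∀ i, inner ℝ (𝔄.basis i) u = inner ℝ (𝔄.basis i) v) : u = v := by
  apply 𝔄.basis.repr.injective
  apply lp.ext
  funext i
  rw [𝔄.basis.repr_apply_apply, 𝔄.basis.repr_apply_apply, h]

open Classical in
theorem inner_basis_sum (I : Finset ι) (a : ι → ℝ) (i : ι) :
    inner ℝ (𝔄.basis i) (∑ k ∈ I, a k • 𝔄.basis k) = if i ∈ I then a i else 0 := by
  rw [inner_sum]
  simp_rw [inner_smul_right, orthonormal_iff_ite.1 𝔄.basis.orthonormal]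
  simp

open Classical in
theorem inner_proj (I : Finset ι) (u : H) (i : ι) :
    inner ℝ (𝔄.basis i) (𝔄.proj I u) = if i ∈ I then inner ℝ (𝔄.basis i) u else 0 := by
  rw [proj_apply, inner_basis_sum]

theorem inner_proj_of_mem {I : Finset ι} {i : ι} (hi : i ∈ I) (u : H) :
    inner ℝ (𝔄.basis i) (𝔄.proj I u) = inner ℝ (𝔄.basis i) u := by
  classical
  simp [inner_proj, hi]

theorem proj_sum (I : Finset ι) (a : ι → ℝ) :
    𝔄.proj I (∑ k ∈ I, a k • 𝔄.basis k) = ∑ k ∈ I, a k • 𝔄.basis k := by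
  classical
  refine 𝔄.ext_inner fun i => ?_
  rw [inner_proj, inner_basis_sum]
  split_ifs <;> rfl

theorem proj_proj_of_subset {I J : Finset ι} (h : I ⊆ J) (u : H) :
    𝔄.proj J (𝔄.proj I u) = 𝔄.proj I u := by
  classical
  refine 𝔄.ext_inner fun i => ?_
  rw [inner_proj, inner_proj]
  by_cases hi : i ∈ I
  · simp [hi, h hi]
  · simp [hi]

theorem mem_projRange {I : Finset ι} {u : H} : u ∈ 𝔄.projRange I ↔ 𝔄.proj I u = u := by
  constructor
  · rintro ⟨w, rfl⟩
    exact 𝔄.proj_proj_of_subset subset_rfl w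
  · intro h
    exact ⟨u, h⟩

theorem proj_mem_projRange {I J : Finset ι} (h : I ⊆ J) (u : H) :
    𝔄.proj I u ∈ 𝔄.projRange J := 𝔄.mem_projRange.2 (𝔄.proj_proj_of_subset h u)

theorem inner_eq_sum_of_mem {I : Finset ι} {u : H} (hu : u ∈ 𝔄.projRange I) (v : H) :
    inner ℝ u v = ∑ i ∈ I, inner ℝ (𝔄.basis i) u * inner ℝ (𝔄.basis i) v := by
  have h := 𝔄.mem_projRange.1 hu
  rw [proj_apply] at h
  conv_lhs => rw [← h]
  rw [sum_inner]
  simp_rw [inner_smul_left]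
  simp

theorem norm_sq_eq_sum_of_mem {I : Finset ι} {u : H} (hu : u ∈ 𝔄.projRange I) :
    ‖u‖ ^ 2 = ∑ i ∈ I, inner ℝ (𝔄.basis i) u ^ 2 := by
  rw [← real_inner_self_eq_norm_sq, 𝔄.inner_eq_sum_of_mem hu]
  simp_rw [sq]

theorem tendsto_proj (u : H) : Tendsto (fun J => 𝔄.proj J u) atTop (𝓝 u) := by
  have h := 𝔄.basis.hasSum_repr u
  simp_rw [𝔄.basis.repr_apply_apply] at h
  refine Tendsto.congr (fun J => ?_) h
  rw [proj_apply]

theorem Hsp.inner_pow {r : ℝ} (v : 𝔄.Hsp r) (i : ι) :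
    inner ℝ (𝔄.basis i) (Hsp.pow v) = (-𝔄.eig i) ^ r * inner ℝ (𝔄.basis i) v.toH :=
  inner_diagOp 𝔄.basis _ v i

theorem Hsp.inner_gen (v : 𝔄.Hsp 1) (i : ι) :
    inner ℝ (𝔄.basis i) v.gen = 𝔄.eig i * inner ℝ (𝔄.basis i) v.toH :=
  inner_diagOp 𝔄.basis _ _ i

theorem Hsp.hasSum_norm_sq {r : ℝ} (v : 𝔄.Hsp r) :
    HasSum (fun i => ((-𝔄.eig i) ^ r * inner ℝ (𝔄.basis i) v.toH) ^ 2) (‖v‖ ^ 2) := by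
  have h := hasSum_sq 𝔄.basis (Hsp.pow v)
  simp_rw [Hsp.inner_pow] at h
  exact h

theorem Hsp.toH_injective {r : ℝ} : Function.Injective (Hsp.toH : 𝔄.Hsp r →ₗ[ℝ] H) :=
  Subtype.val_injective

@[simp] theorem toH_projTo (I : Finset ι) (r : ℝ) (u : H) :
    (𝔄.projTo I r u).toH = 𝔄.proj I u := rfl

@[simp] theorem Hsp.toH_incl {r s : ℝ} (h : s ≤ r) (v : 𝔄.Hsp r) :
    (Hsp.incl h v).toH = v.toH := by
  have h1 : ∀ v : (𝔄.fracPow r).domain, ((Submodule.inclusion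
      (fun _ hv => Hsp.mem_of_le (𝔄 := 𝔄) h hv) v : (𝔄.fracPow s).domain) : H) = v :=
    fun v => Submodule.coe_inclusion _ _
  exact h1 v

@[simp] theorem incl_projTo {r s : ℝ} (h : s ≤ r) (I : Finset ι) (u : H) :
    Hsp.incl h (𝔄.projTo I r u) = 𝔄.projTo I s u :=
  Hsp.toH_injective 𝔄 (by rw [Hsp.toH_incl, toH_projTo, toH_projTo])

theorem pow_mem_projRange {I : Finset ι} {r : ℝ} {v : 𝔄.Hsp r} (hv : v.toH ∈ 𝔄.projRange I) :
    Hsp.pow v ∈ 𝔄.projRange I := by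
  classical
  rw [mem_projRange] at hv ⊢
  refine 𝔄.ext_inner fun i => ?_
  rw [inner_proj, Hsp.inner_pow, ← hv, inner_proj]
  split_ifs <;> simp

theorem inner_eq_sum {I : Finset ι} {r : ℝ} (v w : 𝔄.Hsp r) (hv : v.toH ∈ 𝔄.projRange I) :
    inner ℝ v w = ∑ i ∈ I, ((-𝔄.eig i) ^ r * inner ℝ (𝔄.basis i) v.toH)
      * ((-𝔄.eig i) ^ r * inner ℝ (𝔄.basis i) w.toH) := by
  rw [Hsp.inner_def, 𝔄.inner_eq_sum_of_mem (𝔄.pow_mem_projRange hv)]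
  simp_rw [Hsp.inner_pow]

theorem norm_sq_eq_sum {I : Finset ι} {r : ℝ} (v : 𝔄.Hsp r) (hv : v.toH ∈ 𝔄.projRange I) :
    ‖v‖ ^ 2 = ∑ i ∈ I, ((-𝔄.eig i) ^ r * inner ℝ (𝔄.basis i) v.toH) ^ 2 := by
  rw [← real_inner_self_eq_norm_sq, 𝔄.inner_eq_sum v v hv]
  simp_rw [sq]

theorem norm_projTo_sq (I : Finset ι) (r : ℝ) (u : H) :
    ‖𝔄.projTo I r u‖ ^ 2 = ∑ i ∈ I, ((-𝔄.eig i) ^ r * inner ℝ (𝔄.basis i) u) ^ 2 := by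
  rw [𝔄.norm_sq_eq_sum _ (𝔄.proj_mem_projRange subset_rfl u)]
  refine Finset.sum_congr rfl fun i hi => ?_
  rw [toH_projTo, inner_proj_of_mem _ hi]

/-- Reduces every operator estimate below to a scalar inequality for each eigenvalue. -/
theorem norm_projTo_le_of_coord {I : Finset ι} {r s K : ℝ} (hK : 0 ≤ K) {u u' : H}
    (h : ∀ i ∈ I, |(-𝔄.eig i) ^ r * inner ℝ (𝔄.basis i) u|
      ≤ K * |(-𝔄.eig i) ^ s * inner ℝ (𝔄.basis i) u'|) :
    ‖𝔄.projTo I r u‖ ≤ K * ‖𝔄.projTo I s u'‖ := by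
  refine (sq_le_sq₀ (norm_nonneg _) (by positivity)).1 ?_
  rw [mul_pow, norm_projTo_sq, norm_projTo_sq, Finset.mul_sum]
  refine Finset.sum_le_sum fun i hi => ?_
  rw [← sq_abs, ← sq_abs ((-𝔄.eig i) ^ s * inner ℝ (𝔄.basis i) u'), ← mul_pow]
  exact pow_le_pow_left₀ (abs_nonneg _) (h i hi) 2

theorem norm_projTo_zero_le (I : Finset ι) (u : H) : ‖𝔄.projTo I 0 u‖ ≤ ‖u‖ := by
  refine (sq_le_sq₀ (norm_nonneg _) (norm_nonneg _)).1 ?_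
  rw [norm_projTo_sq]
  simp only [Real.rpow_zero, one_mul]
  exact sum_le_hasSum I (fun _ _ => sq_nonneg _) (hasSum_sq 𝔄.basis u)

/-- Membership in `H_r` is summability of nonnegative terms, so uniformly bounded finite sections
suffice. This is how an `H`-valued integral with singular integrand is placed in `H_r` without
integrating there. -/
theorem exists_norm_le_of_forall_projTo {r R : ℝ} (hR : 0 ≤ R) {u : H}
    (h : ∀ J, ‖𝔄.projTo J r u‖ ≤ R) : ∃ v : 𝔄.Hsp r, v.toH = u ∧ ‖v‖ ≤ R := by
  have hb : ∀ J : Finset ι, ∑ i ∈ J, ((-𝔄.eig i) ^ r * inner ℝ (𝔄.basis i) u) ^ 2 ≤ R ^ 2 := by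
    intro J
    rw [← norm_projTo_sq]
    exact pow_le_pow_left₀ (norm_nonneg _) (h J) 2
  have hs : Summable fun i => ((-𝔄.eig i) ^ r * inner ℝ (𝔄.basis i) u) ^ 2 :=
    summable_of_sum_le (fun _ => sq_nonneg _) hb
  let v : 𝔄.Hsp r := ⟨u, hs⟩
  refine ⟨v, rfl, (sq_le_sq₀ (norm_nonneg _) hR).1 ?_⟩
  exact (Hsp.hasSum_norm_sq 𝔄 v).tsum_eq ▸ hs.tsum_le_of_sum_le hb

theorem Hsp.norm_incl_le {r s : ℝ} (h : s ≤ r) :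
    ∃ K, 0 ≤ K ∧ ∀ v : 𝔄.Hsp r, ‖Hsp.incl h v‖ ≤ K * ‖v‖ := by
  obtain ⟨δ, h0, hδ⟩ := 𝔄.sup_eig_neg
  refine ⟨δ ^ (s - r), by positivity, fun v => ?_⟩
  refine (sq_le_sq₀ (norm_nonneg _) (by positivity)).1 ?_
  rw [mul_pow]
  refine hasSum_le (fun i => ?_) (Hsp.hasSum_norm_sq 𝔄 _) ((Hsp.hasSum_norm_sq 𝔄 v).mul_left _)
  have hi := 𝔄.eig_neg i
  have h1 : (-𝔄.eig i) ^ s = (-𝔄.eig i) ^ (s - r) * (-𝔄.eig i) ^ r := by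
    rw [← Real.rpow_add hi]
    ring_nf
  rw [h1, Hsp.toH_incl, mul_assoc, mul_pow]
  refine mul_le_mul_of_nonneg_right (pow_le_pow_left₀ (by positivity) ?_ 2) (sq_nonneg _)
  exact Real.rpow_le_rpow_of_nonpos h0 (by linarith [hδ i]) (by linarith)

theorem Hsp.continuous_incl {r s : ℝ} (h : s ≤ r) :
    Continuous (Hsp.incl h : 𝔄.Hsp r →ₗ[ℝ] 𝔄.Hsp s) := by
  obtain ⟨K, -, hK⟩ := Hsp.norm_incl_le 𝔄 h
  exact AddMonoidHomClass.continuous_of_bound _ K hK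

theorem Hsp.isometry_pow {r : ℝ} : Isometry (Hsp.pow : 𝔄.Hsp r →ₗ[ℝ] H) :=
  AddMonoidHomClass.isometry_of_norm _ fun v => (Hsp.norm_def v).symm

theorem Hsp.secondCountable [TopologicalSpace.SeparableSpace H] (r : ℝ) :
    SecondCountableTopology (𝔄.Hsp r) := by
  have : SecondCountableTopology H := UniformSpace.secondCountable_of_separable H
  exact (Hsp.isometry_pow 𝔄 (r := r)).isUniformInducing.isInducing.secondCountableTopology

/-- The bounded operator `(-A)^r P_I` on `H`. -/
noncomputable def fracProj (I : Finset ι) (r : ℝ) : H →L[ℝ] H :=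
  ∑ i ∈ I, ((-𝔄.eig i) ^ r) • (innerSL ℝ (𝔄.basis i)).smulRight (𝔄.basis i)

theorem fracProj_apply (I : Finset ι) (r : ℝ) (u : H) :
    𝔄.fracProj I r u = Hsp.pow (𝔄.projTo I r u) := by
  classical
  refine 𝔄.ext_inner fun i => ?_
  rw [Hsp.inner_pow, toH_projTo, inner_proj]
  have : 𝔄.fracProj I r u
      = ∑ i ∈ I, ((-𝔄.eig i) ^ r * inner ℝ (𝔄.basis i) u) • 𝔄.basis i := by
    simp [fracProj, smul_smul]
  rw [this, inner_basis_sum]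
  split_ifs <;> simp

theorem norm_fracProj (I : Finset ι) (r : ℝ) (u : H) :
    ‖𝔄.fracProj I r u‖ = ‖𝔄.projTo I r u‖ := by
  rw [fracProj_apply, Hsp.norm_def]

/-- `P_I` as a bounded operator from `H` to `H_r`. -/
noncomputable def projToL (I : Finset ι) (r : ℝ) : H →L[ℝ] 𝔄.Hsp r :=
  LinearMap.mkContinuous (𝔄.projTo I r) ‖𝔄.fracProj I r‖ fun u => by
    rw [← norm_fracProj]
    exact (𝔄.fracProj I r).le_opNorm u

/-- `(-A)^r` commutes with the projections and is an isometry on `H_r`, so convergence is inherited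
from `H`. -/
theorem tendsto_projTo {r : ℝ} (v : 𝔄.Hsp r) :
    Tendsto (fun J => 𝔄.projTo J r v.toH) atTop (𝓝 v) := by
  rw [(Hsp.isometry_pow 𝔄 (r := r)).isUniformInducing.isInducing.tendsto_nhds_iff]
  refine Tendsto.congr (fun J => ?_) (𝔄.tendsto_proj (Hsp.pow v))
  classical
  refine 𝔄.ext_inner fun i => ?_
  simp only [Function.comp_apply, Hsp.inner_pow, toH_projTo, inner_proj]
  split_ifs <;> simp

end Coordinates

/-! ### Smoothing and time regularity of the semigroup. -/

section Semigroup

variable {ι H : Type*} [NormedAddCommGroup H] [InnerProductSpace ℝ H] (𝔄 : DiagonalData ι H)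

theorem inner_diagCLM (m : ι → ℝ) (K : ℝ) (hK : ∀ i, |m i| ≤ K) (v : H) (i : ι) :
    inner ℝ (𝔄.basis i) (diagCLM 𝔄.basis m K hK v) = m i * inner ℝ (𝔄.basis i) v :=
  inner_diagOp 𝔄.basis m ⟨v, mem_domain_of_bounded hK v⟩ i

theorem inner_semigroup {t : ℝ} (ht : 0 ≤ t) (u : H) (i : ι) :
    inner ℝ (𝔄.basis i) (𝔄.semigroup t u)
      = Real.exp (t * 𝔄.eig i) * inner ℝ (𝔄.basis i) u := by
  rw [semigroup, inner_diagCLM, max_eq_left ht]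

theorem inner_negPow (r : ℝ) (hr : 0 ≤ r) (u : H) (i : ι) :
    inner ℝ (𝔄.basis i) (𝔄.negPow r hr u)
      = (-𝔄.eig i) ^ (-r) * inner ℝ (𝔄.basis i) u := by
  rw [negPow, inner_diagCLM]

theorem norm_semigroup_le (t : ℝ) (u : H) : ‖𝔄.semigroup t u‖ ≤ ‖u‖ := by
  have h : ‖𝔄.semigroup t‖ ≤ |(1 : ℝ)| := by
    unfold semigroup diagCLM
    exact LinearMap.mkContinuous_norm_le _ (abs_nonneg _) _
  simpa using (𝔄.semigroup t).le_of_opNorm_le h u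

/-- Contractivity makes the finite-rank approximations converge uniformly in `t`, and each of them
is a finite sum of exponentials. -/
theorem continuous_semigroup (u : H) : Continuous fun t => 𝔄.semigroup t u := by
  have key : TendstoUniformly (fun (J : Finset ι) t => 𝔄.semigroup t (𝔄.proj J u))
      (fun t => 𝔄.semigroup t u) atTop := by
    rw [Metric.tendstoUniformly_iff]
    intro ε hε
    filter_upwards [Metric.tendsto_nhds.1 (𝔄.tendsto_proj u) ε hε] with J hJ t
    rw [dist_eq_norm, ← map_sub]
    refine (𝔄.norm_semigroup_le t _).trans_lt ?_
    rwa [← dist_eq_norm, dist_comm]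
  refine key.continuous (Eventually.frequently (Eventually.of_forall fun J => ?_))
  have : (fun t => 𝔄.semigroup t (𝔄.proj J u)) = fun t => ∑ i ∈ J,
      (Real.exp (max t 0 * 𝔄.eig i) * inner ℝ (𝔄.basis i) u) • 𝔄.basis i := by
    classical
    funext t
    refine 𝔄.ext_inner fun i => ?_
    rw [semigroup, inner_diagCLM, inner_proj, inner_basis_sum]
    split_ifs <;> simp
  rw [this]
  fun_prop

theorem continuous_semigroup_uncurry : Continuous fun q : ℝ × H => 𝔄.semigroup q.1 q.2 := by
  rw [continuous_iff_continuousAt]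
  rintro ⟨t, u⟩
  have h1 : Tendsto (fun q : ℝ × H => 𝔄.semigroup q.1 (q.2 - u)) (𝓝 (t, u)) (𝓝 0) := by
    refine squeeze_zero_norm (fun q => 𝔄.norm_semigroup_le _ _) ?_
    have : Continuous fun q : ℝ × H => ‖q.2 - u‖ := by fun_prop
    simpa using this.tendsto (t, u)
  have h2 : Tendsto (fun q : ℝ × H => 𝔄.semigroup q.1 u) (𝓝 (t, u)) (𝓝 (𝔄.semigroup t u)) :=
    ((𝔄.continuous_semigroup u).comp continuous_fst).tendsto (t, u)
  have := h1.add h2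
  simp only [zero_add, ← map_add, sub_add_cancel] at this
  exact this

theorem rpow_le_exp {r x : ℝ} (hr : 0 ≤ r) (hr1 : r ≤ 1) (hx : 0 ≤ x) : x ^ r ≤ Real.exp x := by
  rcases le_total x 1 with h | h
  · exact (Real.rpow_le_one hx h hr).trans (Real.one_le_exp hx)
  · calc x ^ r ≤ x ^ (1 : ℝ) := Real.rpow_le_rpow_of_exponent_le h hr1
      _ = x := Real.rpow_one x
      _ ≤ Real.exp x := by linarith [Real.add_one_le_exp x]

theorem one_sub_exp_neg_le_rpow {r x : ℝ} (hr : 0 ≤ r) (hr1 : r ≤ 1) (hx : 0 ≤ x) :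
    1 - Real.exp (-x) ≤ x ^ r := by
  rcases le_total x 1 with h | h
  · calc 1 - Real.exp (-x) ≤ x := by linarith [Real.add_one_le_exp (-x)]
      _ = x ^ (1 : ℝ) := (Real.rpow_one x).symm
      _ ≤ x ^ r := Real.rpow_le_rpow_of_exponent_ge_of_imp hx h hr1 (by
            intro h0 h1; subst h0; linarith)
  · exact le_trans (by linarith [Real.exp_pos (-x)]) (Real.one_le_rpow h hr)

/-- This is `x^r ≤ e^x` at `x = t l`, the scalar form of parabolic smoothing. -/
theorem rpow_mul_exp_le {r t l : ℝ} (hr : 0 ≤ r) (hr1 : r ≤ 1) (ht : 0 < t) (hl : 0 < l) :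
    l ^ r * Real.exp (-(t * l)) ≤ t ^ (-r) := by
  have h := rpow_le_exp hr hr1 (mul_pos ht hl).le
  rw [Real.mul_rpow ht.le hl.le] at h
  rw [Real.exp_neg, Real.rpow_neg ht.le, ← div_eq_mul_inv, div_le_iff₀ (Real.exp_pos _),
    inv_mul_eq_div, le_div_iff₀ (by positivity)]
  linarith

theorem norm_projTo_semigroup_le (I : Finset ι) {r t : ℝ} (hr : 0 ≤ r) (hr1 : r ≤ 1) (ht : 0 < t)
    (u : H) : ‖𝔄.projTo I r (𝔄.semigroup t u)‖ ≤ t ^ (-r) * ‖u‖ := by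
  refine le_trans (𝔄.norm_projTo_le_of_coord (s := 0) (K := t ^ (-r)) (u' := u)
    (by positivity) fun i _ => ?_)
    (mul_le_mul_of_nonneg_left (𝔄.norm_projTo_zero_le I u) (by positivity))
  have hl := 𝔄.eig_neg i
  rw [inner_semigroup _ ht.le, ← mul_assoc, abs_mul, Real.rpow_zero, one_mul]
  refine mul_le_mul_of_nonneg_right ?_ (abs_nonneg _)
  rw [abs_of_pos (by positivity)]
  have := rpow_mul_exp_le hr hr1 ht hl
  rwa [show -(t * -𝔄.eig i) = t * 𝔄.eig i by ring] at this

/-- In each coordinate the difference is `-e^{tμ}(1 - e^{hμ})`. The second factor yields `h^q` at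
the price of `(-μ)^q`, and `e^{tμ}` then absorbs `(-μ)^{r+q}` into `t^{-(r+q)}`. -/
theorem norm_projTo_semigroup_sub_le (I : Finset ι) {r q t h : ℝ} (hr : 0 ≤ r) (hq : 0 ≤ q)
    (hrq : r + q ≤ 1) (ht : 0 < t) (hh : 0 ≤ h) (u : H) :
    ‖𝔄.projTo I r (𝔄.semigroup (t + h) u - 𝔄.semigroup t u)‖
      ≤ h ^ q * t ^ (-(r + q)) * ‖u‖ := by
  refine le_trans (𝔄.norm_projTo_le_of_coord (s := 0) (K := h ^ q * t ^ (-(r + q))) (u' := u)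
    (by positivity) fun i _ => ?_)
    (mul_le_mul_of_nonneg_left (𝔄.norm_projTo_zero_le I u) (by positivity))
  have hl := 𝔄.eig_neg i
  rw [inner_sub_right, inner_semigroup _ (by linarith), inner_semigroup _ ht.le, ← sub_mul,
    ← mul_assoc, abs_mul, Real.rpow_zero, one_mul]
  refine mul_le_mul_of_nonneg_right ?_ (abs_nonneg _)
  have h1 := rpow_mul_exp_le (by linarith) hrq ht hl
  have h2 := one_sub_exp_neg_le_rpow hq (by linarith) (mul_nonneg hh hl.le)
  have h3 : Real.exp (-(h * -𝔄.eig i)) ≤ 1 := Real.exp_le_one_iff.2 (by nlinarith)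
  rw [Real.mul_rpow hh hl.le] at h2
  rw [show -(t * -𝔄.eig i) = t * 𝔄.eig i by ring, Real.rpow_add hl] at h1
  rw [show -(h * -𝔄.eig i) = h * 𝔄.eig i by ring] at h2 h3
  rw [add_mul, Real.exp_add, abs_mul, abs_of_pos (Real.rpow_pos_of_pos hl r),
    show Real.exp (t * 𝔄.eig i) * Real.exp (h * 𝔄.eig i) - Real.exp (t * 𝔄.eig i)
      = -(Real.exp (t * 𝔄.eig i) * (1 - Real.exp (h * 𝔄.eig i))) by ring, abs_neg, abs_mul,
    abs_of_pos (Real.exp_pos _), abs_of_nonneg (by linarith)]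
  calc (-𝔄.eig i) ^ r * (Real.exp (t * 𝔄.eig i) * (1 - Real.exp (h * 𝔄.eig i)))
      ≤ (-𝔄.eig i) ^ r * (Real.exp (t * 𝔄.eig i) * (h ^ q * (-𝔄.eig i) ^ q)) := by gcongr
    _ = h ^ q * ((-𝔄.eig i) ^ r * (-𝔄.eig i) ^ q * Real.exp (t * 𝔄.eig i)) := by ring
    _ ≤ h ^ q * t ^ (-(r + q)) := by gcongr

/-- The operator `(-A)^{-q}(Id - P_I)` is split off and the remaining `(-A)^{r+q} e^{tA}` is
smoothed. The bound is uniform in the auxiliary set `J`, as `exists_norm_le_of_forall_projTo`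
requires. -/
theorem norm_projTo_sub_proj_semigroup_le (I J : Finset ι) {r q t : ℝ} (hr : 0 ≤ r) (hq : 0 ≤ q)
    (hrq : r + q ≤ 1) (ht : 0 < t) (u : H) :
    ‖𝔄.projTo J r (𝔄.semigroup t u - 𝔄.proj I (𝔄.semigroup t u))‖
      ≤ ‖𝔄.negPow q hq ∘L (ContinuousLinearMap.id ℝ H - 𝔄.proj I)‖ * (t ^ (-(r + q)) * ‖u‖) := by
  set Q := 𝔄.negPow q hq ∘L (ContinuousLinearMap.id ℝ H - 𝔄.proj I)
  have hQ : ∀ i, inner ℝ (𝔄.basis i) (Q u)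
      = (-𝔄.eig i) ^ (-q) * (inner ℝ (𝔄.basis i) u - inner ℝ (𝔄.basis i) (𝔄.proj I u)) := by
    intro i
    simp only [Q, ContinuousLinearMap.comp_apply, _root_.sub_apply, inner_negPow,
      ContinuousLinearMap.id_apply, inner_sub_right]
  have h1 : ‖𝔄.projTo J 0 (Q u)‖ ≤ ‖Q‖ * ‖u‖ :=
    (𝔄.norm_projTo_zero_le J _).trans (Q.le_opNorm u)
  calc _ ≤ t ^ (-(r + q)) * ‖𝔄.projTo J 0 (Q u)‖ := by
        refine 𝔄.norm_projTo_le_of_coord (by positivity) fun i _ => ?_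
        classical
        have hl := 𝔄.eig_neg i
        rw [hQ, inner_sub_right, inner_proj, inner_proj, Real.rpow_zero, one_mul,
          inner_semigroup _ ht.le]
        split_ifs
        · simp
        · rw [sub_zero, sub_zero, ← mul_assoc, abs_mul, abs_mul (_ ^ (-q)), ← mul_assoc]
          refine mul_le_mul_of_nonneg_right ?_ (abs_nonneg _)
          rw [abs_of_pos (by positivity), abs_of_pos (by positivity)]
          have h1 := rpow_mul_exp_le (by linarith) hrq ht hl
          rw [show -(t * -𝔄.eig i) = t * 𝔄.eig i by ring] at h1
          calc (-𝔄.eig i) ^ r * Real.exp (t * 𝔄.eig i)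
              = (-𝔄.eig i) ^ (r + q) * Real.exp (t * 𝔄.eig i) * (-𝔄.eig i) ^ (-q) := by
                rw [mul_right_comm, ← Real.rpow_add hl]; ring_nf
            _ ≤ _ := by gcongr
    _ ≤ t ^ (-(r + q)) * (‖Q‖ * ‖u‖) := by gcongr
    _ = _ := by ring

end Semigroup

/-! ### The intermediate space `V` and extension by density. -/

section Between

variable {ι H : Type*} [NormedAddCommGroup H] [InnerProductSpace ℝ H] {𝔄 : DiagonalData ι H}
  {ρ : ℝ} {V : Type*} [NormedAddCommGroup V] [NormedSpace ℝ V] (j : 𝔄.Between ρ V)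

theorem Between.continuous_incl {r : ℝ} (h : ρ ≤ r) : Continuous (j.incl h) :=
  j.ofHsp.continuous.comp (Hsp.continuous_incl 𝔄 h)

theorem Between.norm_incl_le {r : ℝ} (h : ρ ≤ r) :
    ∃ K, 0 ≤ K ∧ ∀ v : 𝔄.Hsp r, ‖j.incl h v‖ ≤ K * ‖v‖ := by
  obtain ⟨K, hK, h1⟩ := Hsp.norm_incl_le 𝔄 h
  refine ⟨‖j.ofHsp‖ * K, by positivity, fun v => ?_⟩
  calc ‖j.incl h v‖ ≤ ‖j.ofHsp‖ * ‖Hsp.incl h v‖ := j.ofHsp.le_opNorm _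
    _ ≤ ‖j.ofHsp‖ * (K * ‖v‖) := by gcongr; exact h1 v
    _ = _ := by ring

@[simp] theorem Between.toH_incl {r : ℝ} (h : ρ ≤ r) (v : 𝔄.Hsp r) :
    j.toH (j.incl h v) = v.toH := by
  change j.toH (j.ofHsp (Hsp.incl h v)) = _
  rw [j.toH_ofHsp, Hsp.toH_incl]

theorem Between.secondCountable [TopologicalSpace.SeparableSpace H] (j : 𝔄.Between ρ V) :
    SecondCountableTopology V := by
  have := Hsp.secondCountable 𝔄 ρ
  have : TopologicalSpace.SeparableSpace V := j.denseRange_ofHsp.separableSpace j.ofHsp.continuous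
  exact UniformSpace.secondCountable_of_separable V

/-- The finite-rank operator `P_I : H → V`. -/
noncomputable def Between.proj (I : Finset ι) : H →L[ℝ] V := j.ofHsp ∘L 𝔄.projToL I ρ

theorem Between.incl_projTo {r : ℝ} (h : ρ ≤ r) (I : Finset ι) (u : H) :
    j.incl h (𝔄.projTo I r u) = j.proj I u :=
  congrArg j.ofHsp (𝔄.incl_projTo h I u)

theorem Between.proj_apply (I : Finset ι) (u : H) :
    j.proj I u = j.ofHsp (𝔄.projTo I ρ u) := rfl

@[simp] theorem Between.toH_proj (I : Finset ι) (u : H) : j.toH (j.proj I u) = 𝔄.proj I u := by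
  rw [j.proj_apply, j.toH_ofHsp, toH_projTo]

theorem Between.norm_proj_le (I : Finset ι) (u : H) :
    ‖j.proj I u‖ ≤ ‖j.ofHsp‖ * ‖𝔄.projTo I ρ u‖ := j.ofHsp.le_opNorm _

theorem Between.closure_projRange (j : 𝔄.Between ρ V) :
    closure {v : V | ∃ I, j.toH v ∈ 𝔄.projRange I} = univ := by
  rw [← dense_iff_closure_eq]
  refine dense_iff_closure_eq.2 (eq_univ_of_univ_subset ?_)
  rw [← j.denseRange_ofHsp.closure_range]
  refine closure_minimal ?_ isClosed_closure
  rintro _ ⟨v, rfl⟩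
  refine mem_closure_of_tendsto ((j.ofHsp.continuous.tendsto v).comp (𝔄.tendsto_projTo v))
    (Eventually.of_forall fun J => ⟨J, ?_⟩)
  simp only [Function.comp_apply, j.toH_ofHsp, toH_projTo]
  exact 𝔄.proj_mem_projRange subset_rfl _

/-- The inequality is a closed condition on pairs. Vectors from `P_I(H)` and `P_J(H)` both lie in
`P_{I ∪ J}(H)`, so it holds on the square of the dense set of all finite combinations. -/
theorem Between.lipschitz_of_projRange (j : 𝔄.Between ρ V) {F : V → H} (hF : Continuous F)
    {c φ : ℝ} (hφ : 0 < φ)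
    (h : ∀ (I : Finset ι) (v w : V), j.toH v ∈ 𝔄.projRange I → j.toH w ∈ 𝔄.projRange I →
      ‖F v - F w‖ ^ 2 ≤ c * ‖v - w‖ ^ 2 * (1 + ‖v‖ ^ φ + ‖w‖ ^ φ)) (v w : V) :
    ‖F v - F w‖ ^ 2 ≤ c * ‖v - w‖ ^ 2 * (1 + ‖v‖ ^ φ + ‖w‖ ^ φ) := by
  classical
  set S := {v : V | ∃ I, j.toH v ∈ 𝔄.projRange I}
  have hc1 : Continuous fun v : V => ‖v‖ ^ φ := continuous_norm.rpow_const fun _ => Or.inr hφ.le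
  have hcl : IsClosed {q : V × V |
      ‖F q.1 - F q.2‖ ^ 2 ≤ c * ‖q.1 - q.2‖ ^ 2 * (1 + ‖q.1‖ ^ φ + ‖q.2‖ ^ φ)} := by
    refine isClosed_le (by fun_prop) ?_
    have h1 : Continuous fun q : V × V => ‖q.1‖ ^ φ := hc1.comp continuous_fst
    have h2 : Continuous fun q : V × V => ‖q.2‖ ^ φ := hc1.comp continuous_snd
    fun_prop
  have hsub : S ×ˢ S ⊆ {q : V × V |
      ‖F q.1 - F q.2‖ ^ 2 ≤ c * ‖q.1 - q.2‖ ^ 2 * (1 + ‖q.1‖ ^ φ + ‖q.2‖ ^ φ)} := by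
    rintro ⟨a, b⟩ ⟨⟨I, hI⟩, ⟨J, hJ⟩⟩
    refine h (I ∪ J) a b ?_ ?_
    · rw [← 𝔄.mem_projRange.1 hI]
      exact 𝔄.proj_mem_projRange Finset.subset_union_left _
    · rw [← 𝔄.mem_projRange.1 hJ]
      exact 𝔄.proj_mem_projRange Finset.subset_union_right _
  have := closure_minimal hsub hcl
  rw [closure_prod_eq, j.closure_projRange, univ_prod_univ] at this
  exact this (mem_univ (v, w))

end Between

end DiagonalData

/-! ### Polynomial growth of the nonlinearity. -/

section Growth

variable {V H : Type*} [NormedAddCommGroup V] [NormedAddCommGroup H]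

/-- `F` is locally Lipschitz with a constant that grows like the norm to the power `a`. -/
def PolyLipschitz (F : V → H) (K a : ℝ) : Prop :=
  ∀ v w, ‖F v - F w‖ ≤ K * ‖v - w‖ * (1 + ‖v‖ ^ a + ‖w‖ ^ a)

theorem PolyLipschitz.of_sq {F : V → H} {c φ : ℝ} (hc : 0 ≤ c)
    (h : ∀ v w, ‖F v - F w‖ ^ 2 ≤ c * ‖v - w‖ ^ 2 * (1 + ‖v‖ ^ φ + ‖w‖ ^ φ)) :
    PolyLipschitz F (√c) (φ / 2) := by
  intro v w
  refine (sq_le_sq₀ (norm_nonneg _) (by positivity)).1 ((h v w).trans ?_)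
  rw [mul_pow, mul_pow, Real.sq_sqrt hc]
  have e : ∀ x : V, ‖x‖ ^ φ = (‖x‖ ^ (φ / 2)) ^ 2 := fun x => by
    rw [← Real.rpow_natCast, ← Real.rpow_mul (norm_nonneg _)]
    norm_num
  rw [e v, e w]
  have h1 : 0 ≤ ‖v‖ ^ (φ / 2) := by positivity
  have h2 : 0 ≤ ‖w‖ ^ (φ / 2) := by positivity
  gcongr
  nlinarith [mul_nonneg h1 h2]

/-- Comparison with the value at `0`; the linear term is absorbed through `x ≤ 1 + x^{1+a}`. -/
theorem PolyLipschitz.growth {F : V → H} {K a : ℝ} (hK : 0 ≤ K) (ha : 0 < a)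
    (h : PolyLipschitz F K a) (v : V) :
    ‖F v‖ ≤ (‖F 0‖ + 2 * K) * (1 + ‖v‖ ^ (1 + a)) := by
  have h1 := h v 0
  rw [sub_zero, norm_zero, Real.zero_rpow ha.ne', add_zero] at h1
  have h2 : ‖F v‖ ≤ ‖F 0‖ + ‖F v - F 0‖ := by
    simpa using norm_add_le (F 0) (F v - F 0)
  have h3 : ‖v‖ ^ (1 + a) = ‖v‖ * ‖v‖ ^ a := by
    rcases (norm_nonneg v).eq_or_lt with h0 | h0
    · rw [← h0, Real.zero_rpow (by linarith), zero_mul]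
    · rw [Real.rpow_add h0, Real.rpow_one]
  have h4 : ‖v‖ ≤ 1 + ‖v‖ ^ (1 + a) := by
    rcases le_total ‖v‖ 1 with h0 | h0
    · have : 0 ≤ ‖v‖ ^ (1 + a) := by positivity
      linarith
    · calc ‖v‖ = ‖v‖ ^ (1 : ℝ) := (Real.rpow_one _).symm
        _ ≤ ‖v‖ ^ (1 + a) := Real.rpow_le_rpow_of_exponent_le h0 (by linarith)
        _ ≤ _ := by linarith
  have h5 : 0 ≤ ‖v‖ ^ (1 + a) := by positivity
  have h6 : K * ‖v‖ * (1 + ‖v‖ ^ a) ≤ 2 * K * (1 + ‖v‖ ^ (1 + a)) := by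
    have : ‖v‖ * (1 + ‖v‖ ^ a) ≤ 2 * (1 + ‖v‖ ^ (1 + a)) := by
      rw [mul_add, ← h3]; linarith
    calc K * ‖v‖ * (1 + ‖v‖ ^ a) = K * (‖v‖ * (1 + ‖v‖ ^ a)) := by ring
      _ ≤ K * (2 * (1 + ‖v‖ ^ (1 + a))) := by gcongr
      _ = _ := by ring
  nlinarith [mul_nonneg (norm_nonneg (F 0)) h5]

end Growth

/-! ### Bounded measurable drivers. -/

section Driver

variable {H : Type*} [NormedAddCommGroup H]

/-- Bounded strongly measurable paths. -/
structure IsDriver (g : ℝ → H) : Prop where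
  stronglyMeasurable : StronglyMeasurable g
  bounded : ∃ B, ∀ s, ‖g s‖ ≤ B

theorem IsDriver.sub {g g' : ℝ → H} (hg : IsDriver g) (hg' : IsDriver g') :
    IsDriver fun s => g s - g' s := by
  obtain ⟨B, hB⟩ := hg.bounded
  obtain ⟨B', hB'⟩ := hg'.bounded
  exact ⟨hg.1.sub hg'.1, B + B', fun s => (norm_sub_le _ _).trans (add_le_add (hB s) (hB' s))⟩

theorem IsDriver.intervalIntegrable {g : ℝ → H} (hg : IsDriver g) (a b : ℝ) :
    IntervalIntegrable g volume a b := by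
  obtain ⟨B, hB⟩ := hg.bounded
  rw [intervalIntegrable_iff]
  exact Measure.integrableOn_of_bounded (M := B) (by simp)
    hg.1.aestronglyMeasurable (Eventually.of_forall hB)

theorem IsDriver.stronglyMeasurableAtFilter {g : ℝ → H} (hg : IsDriver g) (l : Filter ℝ) :
    StronglyMeasurableAtFilter g l volume := ⟨univ, univ_mem, hg.1.aestronglyMeasurable⟩

theorem IsDriver.inner [InnerProductSpace ℝ H] {g : ℝ → H} (hg : IsDriver g) (u : H) :
    IsDriver fun s => inner ℝ u (g s) := by
  obtain ⟨B, hB⟩ := hg.bounded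
  refine ⟨stronglyMeasurable_const.inner hg.1, ‖u‖ * B, fun s => ?_⟩
  exact (norm_inner_le_norm u (g s)).trans (by gcongr; exact hB s)

theorem IsDriver.norm_sq {g : ℝ → H} (hg : IsDriver g) : IsDriver fun s => ‖g s‖ ^ 2 := by
  obtain ⟨B, hB⟩ := hg.bounded
  have hm : StronglyMeasurable fun s => ‖g s‖ ^ 2 := hg.1.norm.pow 2
  refine ⟨hm, B ^ 2, fun s => ?_⟩
  rw [norm_pow, norm_norm]
  exact pow_le_pow_left₀ (norm_nonneg _) (hB s) 2

end Driver

/-- No integrability is required, since otherwise the integral has the default value `0`. The open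
interval on the right keeps singular kernels away from their singularity. -/
theorem enorm_clm_intervalIntegral_le {H : Type*} [NormedAddCommGroup H] [NormedSpace ℝ H]
    [CompleteSpace H] (L : H →L[ℝ] H) (f : ℝ → H) {a b : ℝ} (hab : a ≤ b) :
    ‖L (∫ s in a..b, f s)‖ₑ ≤ ∫⁻ s in Ioo a b, ‖L (f s)‖ₑ := by
  by_cases hf : IntervalIntegrable f volume a b
  · rw [← L.intervalIntegral_comp_comm hf, intervalIntegral.integral_of_le hab,
      restrict_Ioo_eq_restrict_Ioc]
    exact enorm_integral_le_lintegral_enorm _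
  · rw [intervalIntegral.integral_undef hf]
    simp

/-! ### Convolution of a driver with the semigroup. -/

namespace DiagonalData

variable {ι H : Type*} [NormedAddCommGroup H] [InnerProductSpace ℝ H] (𝔄 : DiagonalData ι H)

/-- The coordinates of the convolution `∫₀ᵗ e^{(t-s)A} g(s) ds`. -/
noncomputable def convCoord (g : ℝ → H) (i : ι) (t : ℝ) : ℝ :=
  Real.exp (t * 𝔄.eig i) * ∫ s in (0 : ℝ)..t, Real.exp (-(s * 𝔄.eig i)) * inner ℝ (𝔄.basis i) (g s)

/-- The convolution `∫₀ᵗ P_I e^{(t-s)A} g(s) ds`; see `conv_eq_integral`. -/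
noncomputable def conv (I : Finset ι) (g : ℝ → H) (t : ℝ) : H :=
  ∑ i ∈ I, 𝔄.convCoord g i t • 𝔄.basis i

theorem inner_conv {I : Finset ι} {i : ι} (hi : i ∈ I) (g : ℝ → H) (t : ℝ) :
    inner ℝ (𝔄.basis i) (𝔄.conv I g t) = 𝔄.convCoord g i t := by
  classical
  simp only [conv, inner_basis_sum, hi, if_true]

theorem conv_mem (I : Finset ι) (g : ℝ → H) (t : ℝ) : 𝔄.conv I g t ∈ 𝔄.projRange I :=
  𝔄.mem_projRange.2 (𝔄.proj_sum I _)

theorem proj_conv (I : Finset ι) (g : ℝ → H) (t : ℝ) :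
    𝔄.proj I (𝔄.conv I g t) = 𝔄.conv I g t := 𝔄.proj_sum I _

variable {𝔄} {g g' : ℝ → H}

theorem intervalIntegrable_exp_inner (hg : IsDriver g) (l : ℝ) (i : ι) (a b : ℝ) :
    IntervalIntegrable (fun s => Real.exp (-(s * l)) * inner ℝ (𝔄.basis i) (g s)) volume a b :=
  ((hg.inner _).intervalIntegrable a b).continuousOn_mul (by fun_prop)

theorem convCoord_sub (hg : IsDriver g) (hg' : IsDriver g') (i : ι) (t : ℝ) :
    𝔄.convCoord (fun s => g s - g' s) i t = 𝔄.convCoord g i t - 𝔄.convCoord g' i t := by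
  simp only [convCoord, inner_sub_right, mul_sub]
  rw [intervalIntegral.integral_sub (intervalIntegrable_exp_inner hg _ i _ _)
    (intervalIntegrable_exp_inner hg' _ i _ _), mul_sub]

theorem conv_sub (I : Finset ι) (hg : IsDriver g) (hg' : IsDriver g') (t : ℝ) :
    𝔄.conv I (fun s => g s - g' s) t = 𝔄.conv I g t - 𝔄.conv I g' t := by
  simp only [conv, convCoord_sub hg hg', sub_smul, Finset.sum_sub_distrib]

theorem continuous_convCoord (hg : IsDriver g) (i : ι) : Continuous (𝔄.convCoord g i) := by
  have := intervalIntegral.continuous_primitive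
    (intervalIntegrable_exp_inner (𝔄 := 𝔄) hg (𝔄.eig i) i) 0
  unfold convCoord
  fun_prop

theorem continuous_conv (I : Finset ι) (hg : IsDriver g) : Continuous (𝔄.conv I g) :=
  continuous_finsetSum _ fun i _ => (continuous_convCoord hg i).smul continuous_const

/-- Only a right derivative is available: the driver of the scheme jumps at grid points but is
continuous from the right. -/
theorem hasDerivWithinAt_convCoord (hg : IsDriver g) (i : ι) {t : ℝ}
    (hc : ContinuousWithinAt g (Ici t) t) :
    HasDerivWithinAt (𝔄.convCoord g i)
      (𝔄.eig i * 𝔄.convCoord g i t + inner ℝ (𝔄.basis i) (g t)) (Ici t) t := by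
  have h1 : HasDerivWithinAt
      (fun u => ∫ s in (0 : ℝ)..u, Real.exp (-(s * 𝔄.eig i)) * inner ℝ (𝔄.basis i) (g s))
      (Real.exp (-(t * 𝔄.eig i)) * inner ℝ (𝔄.basis i) (g t)) (Ici t) t := by
    refine intervalIntegral.integral_hasDerivWithinAt_right (t := Ioi t)
      (intervalIntegrable_exp_inner hg _ i _ _) ?_ ?_
    · refine StronglyMeasurable.stronglyMeasurableAtFilter ?_
      exact (by fun_prop : Continuous fun s => Real.exp (-(s * 𝔄.eig i))).stronglyMeasurable.mul
        (hg.inner _).1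
    · refine ContinuousWithinAt.mul (by fun_prop) ?_
      exact ContinuousWithinAt.inner continuousWithinAt_const (hc.mono Ioi_subset_Ici_self)
  have h2 : HasDerivWithinAt (fun u => Real.exp (u * 𝔄.eig i))
      (Real.exp (t * 𝔄.eig i) * 𝔄.eig i) (Ici t) t := by
    have := ((hasDerivAt_id t).mul_const (𝔄.eig i)).exp
    simpa using this.hasDerivWithinAt
  refine (h2.mul h1).congr_deriv ?_
  unfold convCoord
  have : Real.exp (t * 𝔄.eig i) * Real.exp (-(t * 𝔄.eig i)) = 1 := by
    rw [← Real.exp_add]; simp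
  rw [← mul_assoc (Real.exp (t * 𝔄.eig i)) (Real.exp (-(t * 𝔄.eig i))), this]
  ring

/-- The weights stay free because two energies are needed: `w i = -μ_i + φ(𝒪)` for the a priori
bound and `w i = 1` for stability. -/
theorem hasDerivWithinAt_energy (hg : IsDriver g) (I : Finset ι) (w : ι → ℝ) {t : ℝ}
    (hc : ContinuousWithinAt g (Ici t) t) :
    HasDerivWithinAt (fun t => ∑ i ∈ I, w i * 𝔄.convCoord g i t ^ 2)
      (∑ i ∈ I, 2 * (w i * 𝔄.convCoord g i t
        * (𝔄.eig i * 𝔄.convCoord g i t + inner ℝ (𝔄.basis i) (g t)))) (Ici t) t := by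
  refine HasDerivWithinAt.fun_sum fun i _ => ?_
  refine (((hasDerivWithinAt_convCoord hg i hc).pow 2).const_mul (w i)).congr_deriv ?_
  push_cast
  ring

theorem exp_mul_convCoord (i : ι) (a t : ℝ) :
    Real.exp ((t - a) * 𝔄.eig i) * 𝔄.convCoord g i a = Real.exp (t * 𝔄.eig i) *
      ∫ s in (0 : ℝ)..a, Real.exp (-(s * 𝔄.eig i)) * inner ℝ (𝔄.basis i) (g s) := by
  rw [convCoord, ← mul_assoc, ← Real.exp_add]
  ring_nf

theorem convCoord_eq_add (hg : IsDriver g) (i : ι) (a t : ℝ) :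
    𝔄.convCoord g i t = Real.exp ((t - a) * 𝔄.eig i) * 𝔄.convCoord g i a
      + Real.exp (t * 𝔄.eig i) *
        ∫ s in a..t, Real.exp (-(s * 𝔄.eig i)) * inner ℝ (𝔄.basis i) (g s) := by
  rw [exp_mul_convCoord, ← mul_add, intervalIntegral.integral_add_adjacent_intervals
    (intervalIntegrable_exp_inner hg _ i _ _) (intervalIntegrable_exp_inner hg _ i _ _)]
  rfl

theorem convCoord_eq_of_const (hg : IsDriver g) (i : ι) {a t : ℝ} (hat : a ≤ t) {f : H}
    (hf : ∀ s ∈ Ico a t, g s = f) :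
    𝔄.convCoord g i t = Real.exp ((t - a) * 𝔄.eig i) * 𝔄.convCoord g i a
      + (1 - Real.exp ((t - a) * 𝔄.eig i)) * (-𝔄.eig i)⁻¹ * inner ℝ (𝔄.basis i) f := by
  rw [convCoord_eq_add hg i a t]
  congr 1
  have hne : 𝔄.eig i ≠ 0 := by have := 𝔄.eig_neg i; intro h; simp [h] at this
  have h1 : ∫ s in a..t, Real.exp (-(s * 𝔄.eig i)) * inner ℝ (𝔄.basis i) (g s)
      = ∫ s in a..t, Real.exp (-(s * 𝔄.eig i)) * inner ℝ (𝔄.basis i) f := by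
    refine intervalIntegral.integral_congr_ae ?_
    -- The driver is constant only on `[a, t)`; the endpoint is a null set.
    have hne : ∀ᵐ s : ℝ, s ≠ t := by simp [ae_iff, measure_singleton]
    filter_upwards [hne] with s hst hs
    rw [uIoc_of_le hat] at hs
    rw [hf s ⟨hs.1.le, lt_of_le_of_ne hs.2 hst⟩]
  have h2 : ∫ s in a..t, Real.exp (-(s * 𝔄.eig i))
      = (-𝔄.eig i)⁻¹ * Real.exp (-(t * 𝔄.eig i)) - (-𝔄.eig i)⁻¹ * Real.exp (-(a * 𝔄.eig i)) := by
    refine intervalIntegral.integral_eq_sub_of_hasDerivAt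
      (f := fun s => (-𝔄.eig i)⁻¹ * Real.exp (-(s * 𝔄.eig i))) (fun s _ => ?_)
      (Continuous.intervalIntegrable (by fun_prop) _ _)
    have := ((((hasDerivAt_id s).mul_const (𝔄.eig i)).fun_neg).exp).const_mul (-𝔄.eig i)⁻¹
    refine this.congr_deriv ?_
    simp only [id]
    field_simp
  rw [h1, intervalIntegral.integral_mul_const, h2, sub_mul t a, Real.exp_sub, Real.exp_neg,
    Real.exp_neg]
  have := Real.exp_pos (t * 𝔄.eig i)
  have := Real.exp_pos (a * 𝔄.eig i)
  field_simp
  ring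

/-- On a step with constant driver, variation of constants reads `z_t - z_a = (e^{(t-a)A} - 1) z_a +
(-A)^{-1}(1 - e^{(t-a)A}) f`. The first term trades smoothness `q - r` of `z_a` for a power of the
step size, the second gains `1 - r`. Only data at time `a` appear, so the truncation controls the
right-hand side pathwise. -/
theorem norm_projTo_conv_sub_le_of_const (hg : IsDriver g) (I : Finset ι) {r q a t : ℝ}
    (hr : 0 ≤ r) (hrq : r ≤ q) (hq : q ≤ 1) (hat : a ≤ t) {f : H}
    (hf : ∀ s ∈ Ico a t, g s = f) :
    ‖𝔄.projTo I r (𝔄.conv I g t - 𝔄.conv I g a)‖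
      ≤ (t - a) ^ (q - r) * ‖𝔄.projTo I q (𝔄.conv I g a)‖ + (t - a) ^ (1 - r) * ‖f‖ := by
  set u₁ : H := ∑ i ∈ I, ((Real.exp ((t - a) * 𝔄.eig i) - 1) * 𝔄.convCoord g i a) • 𝔄.basis i
    with hu₁
  set u₂ : H := ∑ i ∈ I, ((1 - Real.exp ((t - a) * 𝔄.eig i)) * (-𝔄.eig i)⁻¹
    * inner ℝ (𝔄.basis i) f) • 𝔄.basis i with hu₂
  have h0 : 𝔄.conv I g t - 𝔄.conv I g a = u₁ + u₂ := by
    rw [conv, conv, hu₁, hu₂, ← Finset.sum_sub_distrib, ← Finset.sum_add_distrib]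
    refine Finset.sum_congr rfl fun i _ => ?_
    rw [convCoord_eq_of_const hg i hat hf, ← sub_smul, ← add_smul]
    congr 1
    ring
  have hta : 0 ≤ t - a := by linarith
  have key : ∀ i : ι, ∀ θ : ℝ, 0 ≤ θ → θ ≤ 1 →
      |1 - Real.exp ((t - a) * 𝔄.eig i)| ≤ (t - a) ^ θ * (-𝔄.eig i) ^ θ := by
    intro i θ h0 h1
    have hl := 𝔄.eig_neg i
    have := one_sub_exp_neg_le_rpow h0 h1 (mul_nonneg hta hl.le)
    rw [show -((t - a) * -𝔄.eig i) = (t - a) * 𝔄.eig i by ring, Real.mul_rpow hta hl.le] at this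
    rw [abs_of_nonneg]
    · exact this
    · have : Real.exp ((t - a) * 𝔄.eig i) ≤ 1 := Real.exp_le_one_iff.2 (by nlinarith)
      linarith
  have h1 : ‖𝔄.projTo I r u₁‖ ≤ (t - a) ^ (q - r) * ‖𝔄.projTo I q (𝔄.conv I g a)‖ := by
    refine 𝔄.norm_projTo_le_of_coord (by positivity) fun i hi => ?_
    classical
    have hl := 𝔄.eig_neg i
    rw [hu₁, inner_basis_sum, if_pos hi, inner_conv _ hi, ← mul_assoc, abs_mul, abs_mul, abs_mul,
      ← mul_assoc]
    refine mul_le_mul_of_nonneg_right ?_ (abs_nonneg _)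
    rw [abs_of_pos (Real.rpow_pos_of_pos hl r), abs_of_pos (Real.rpow_pos_of_pos hl q),
      abs_sub_comm]
    calc _ ≤ (-𝔄.eig i) ^ r * ((t - a) ^ (q - r) * (-𝔄.eig i) ^ (q - r)) := by
          gcongr; exact key i _ (by linarith) (by linarith)
      _ = (t - a) ^ (q - r) * ((-𝔄.eig i) ^ r * (-𝔄.eig i) ^ (q - r)) := by ring
      _ = _ := by rw [← Real.rpow_add hl]; ring_nf
  have h2 : ‖𝔄.projTo I r u₂‖ ≤ (t - a) ^ (1 - r) * ‖f‖ := by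
    refine le_trans (𝔄.norm_projTo_le_of_coord (s := 0) (K := (t - a) ^ (1 - r)) (u' := f)
      (by positivity) fun i hi => ?_)
      (mul_le_mul_of_nonneg_left (𝔄.norm_projTo_zero_le I f) (by positivity))
    classical
    have hl := 𝔄.eig_neg i
    rw [hu₂, inner_basis_sum, if_pos hi, Real.rpow_zero, one_mul, abs_mul, abs_mul, abs_mul,
      ← mul_assoc]
    refine mul_le_mul_of_nonneg_right ?_ (abs_nonneg _)
    rw [abs_of_pos (Real.rpow_pos_of_pos hl r), abs_of_pos (inv_pos.2 hl)]
    calc _ ≤ (-𝔄.eig i) ^ r * ((t - a) ^ (1 - r) * (-𝔄.eig i) ^ (1 - r) * (-𝔄.eig i)⁻¹) := by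
          gcongr; exact key i _ (by linarith) (by linarith)
      _ = (t - a) ^ (1 - r) * ((-𝔄.eig i) ^ r * (-𝔄.eig i) ^ (1 - r) * (-𝔄.eig i)⁻¹) := by ring
      _ = (t - a) ^ (1 - r) := by
          rw [← Real.rpow_add hl, show r + (1 - r) = 1 by ring, Real.rpow_one,
            mul_inv_cancel₀ hl.ne', mul_one]
  rw [h0, map_add]
  exact (norm_add_le _ _).trans (add_le_add h1 h2)

theorem proj_semigroup_eq_sum (I : Finset ι) {t : ℝ} (ht : 0 ≤ t) (u : H) :
    𝔄.proj I (𝔄.semigroup t u)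
      = ∑ i ∈ I, (Real.exp (t * 𝔄.eig i) * inner ℝ (𝔄.basis i) u) • 𝔄.basis i := by
  rw [proj_apply]
  simp_rw [inner_semigroup 𝔄 ht]

theorem intervalIntegrable_exp_inner_smul (hg : IsDriver g) (i : ι) (a b t : ℝ) :
    IntervalIntegrable (fun s => (Real.exp ((t - s) * 𝔄.eig i)
      * inner ℝ (𝔄.basis i) (g s)) • 𝔄.basis i) volume a b := by
  have h : IntervalIntegrable (fun s => Real.exp ((t - s) * 𝔄.eig i)
      * inner ℝ (𝔄.basis i) (g s)) volume a b :=
    ((hg.inner _).intervalIntegrable a b).continuousOn_mul (by fun_prop)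
  exact ⟨h.1.smul_const _, h.2.smul_const _⟩

theorem intervalIntegrable_proj_semigroup (hg : IsDriver g) (I : Finset ι) {a b t : ℝ}
    (hab : a ≤ b) (hbt : b ≤ t) :
    IntervalIntegrable (fun s => 𝔄.proj I (𝔄.semigroup (t - s) (g s))) volume a b := by
  have h : IntervalIntegrable (fun s => ∑ i ∈ I,
      (Real.exp ((t - s) * 𝔄.eig i) * inner ℝ (𝔄.basis i) (g s)) • 𝔄.basis i) volume a b :=
    ⟨integrable_finsetSum _ fun i _ => (intervalIntegrable_exp_inner_smul hg i a b t).1,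
      integrable_finsetSum _ fun i _ => (intervalIntegrable_exp_inner_smul hg i a b t).2⟩
  refine h.congr fun s hs => ?_
  rw [uIoc_of_le hab] at hs
  exact (proj_semigroup_eq_sum I (by linarith [hs.2]) _).symm

theorem integral_proj_semigroup_eq_sum [CompleteSpace H] (hg : IsDriver g) (I : Finset ι)
    {a b t : ℝ} (hab : a ≤ b) (hbt : b ≤ t) :
    ∫ s in a..b, 𝔄.proj I (𝔄.semigroup (t - s) (g s)) = ∑ i ∈ I, (Real.exp (t * 𝔄.eig i) *
      ∫ s in a..b, Real.exp (-(s * 𝔄.eig i)) * inner ℝ (𝔄.basis i) (g s)) • 𝔄.basis i := by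
  have h1 : ∫ s in a..b, 𝔄.proj I (𝔄.semigroup (t - s) (g s)) = ∫ s in a..b, ∑ i ∈ I,
      (Real.exp ((t - s) * 𝔄.eig i) * inner ℝ (𝔄.basis i) (g s)) • 𝔄.basis i := by
    refine intervalIntegral.integral_congr fun s hs => ?_
    rw [uIcc_of_le hab] at hs
    exact proj_semigroup_eq_sum I (by linarith [hs.2]) _
  rw [h1, intervalIntegral.integral_finsetSum fun i _ =>
    intervalIntegrable_exp_inner_smul hg i a b t]
  refine Finset.sum_congr rfl fun i _ => ?_
  rw [intervalIntegral.integral_smul_const, ← intervalIntegral.integral_const_mul]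
  congr 1
  refine intervalIntegral.integral_congr fun s _ => ?_
  rw [← mul_assoc, ← Real.exp_add]
  ring_nf

theorem conv_eq_integral [CompleteSpace H] (hg : IsDriver g) (I : Finset ι) {t : ℝ} (ht : 0 ≤ t) :
    𝔄.conv I g t = ∫ s in (0 : ℝ)..t, 𝔄.proj I (𝔄.semigroup (t - s) (g s)) :=
  (integral_proj_semigroup_eq_sum hg I ht le_rfl).symm

theorem conv_sub_conv_eq_integral [CompleteSpace H] (hg : IsDriver g) (I : Finset ι) {a t : ℝ}
    (ha : 0 ≤ a) (hat : a ≤ t) :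
    𝔄.conv I g t - 𝔄.conv I g a
      = (∫ s in (0 : ℝ)..a, 𝔄.proj I (𝔄.semigroup (t - s) (g s) - 𝔄.semigroup (a - s) (g s)))
        + ∫ s in a..t, 𝔄.proj I (𝔄.semigroup (t - s) (g s)) := by
  simp_rw [map_sub]
  rw [intervalIntegral.integral_sub (intervalIntegrable_proj_semigroup hg I ha hat)
    (intervalIntegrable_proj_semigroup hg I ha le_rfl), conv_eq_integral hg I ha,
    conv_eq_integral hg I (ha.trans hat), ← intervalIntegral.integral_add_adjacent_intervals
    (intervalIntegrable_proj_semigroup hg I ha hat)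
    (intervalIntegrable_proj_semigroup hg I hat le_rfl)]
  abel

theorem projTo_proj (I : Finset ι) (r : ℝ) (u : H) :
    𝔄.projTo I r (𝔄.proj I u) = 𝔄.projTo I r u :=
  Hsp.toH_injective 𝔄 (𝔄.proj_proj_of_subset subset_rfl u)

theorem enorm_fracProj (I : Finset ι) (r : ℝ) (u : H) :
    ‖𝔄.fracProj I r u‖ₑ = ‖𝔄.projTo I r u‖ₑ := by
  rw [← ofReal_norm, ← ofReal_norm, norm_fracProj]

theorem enorm_le_ofReal_mul_enorm {E E' : Type*} [NormedAddCommGroup E] [NormedAddCommGroup E']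
    {x : E} {y : E'} {K : ℝ} (hK : 0 ≤ K) (h : ‖x‖ ≤ K * ‖y‖) : ‖x‖ₑ ≤ ENNReal.ofReal K * ‖y‖ₑ := by
  rw [← ofReal_norm, ← ofReal_norm, ← ENNReal.ofReal_mul hK]
  exact ENNReal.ofReal_le_ofReal h

theorem enorm_projTo_conv_le [CompleteSpace H] (hg : IsDriver g) (I : Finset ι) {r t : ℝ}
    (hr : 0 ≤ r) (hr1 : r ≤ 1) (ht : 0 ≤ t) :
    ‖𝔄.projTo I r (𝔄.conv I g t)‖ₑ
      ≤ ∫⁻ s in Ioo 0 t, ENNReal.ofReal ((t - s) ^ (-r)) * ‖g s‖ₑ := by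
  rw [conv_eq_integral hg I ht, ← enorm_fracProj]
  refine (enorm_clm_intervalIntegral_le _ _ ht).trans (setLIntegral_mono' measurableSet_Ioo ?_)
  intro s hs
  have hts : 0 < t - s := by linarith [hs.2]
  rw [enorm_fracProj, projTo_proj]
  exact enorm_le_ofReal_mul_enorm (by positivity) (𝔄.norm_projTo_semigroup_le I hr hr1 hts _)

/-- The integral is split at `a`. Before `a`, time regularity of the semigroup gives `(t-a)^q ≤
h^q`; after `a`, smoothing alone suffices because `(t-s)^{-r} = (t-s)^q (t-s)^{-(r+q)}`. Both pieces
carry a singularity of the same order. -/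
theorem enorm_projTo_conv_sub_le [CompleteSpace H] (hg : IsDriver g) (I : Finset ι)
    {r q a t h : ℝ} (hr : 0 ≤ r) (hq : 0 ≤ q) (hrq : r + q ≤ 1) (ha : 0 ≤ a) (hat : a ≤ t)
    (hh : t - a ≤ h) :
    ‖𝔄.projTo I r (𝔄.conv I g t - 𝔄.conv I g a)‖ₑ
      ≤ ENNReal.ofReal (h ^ q) *
        ((∫⁻ s in Ioo 0 a, ENNReal.ofReal ((a - s) ^ (-(r + q))) * ‖g s‖ₑ)
          + ∫⁻ s in Ioo a t, ENNReal.ofReal ((t - s) ^ (-(r + q))) * ‖g s‖ₑ) := by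
  rw [conv_sub_conv_eq_integral hg I ha hat, ← enorm_fracProj, map_add, mul_add]
  have hh0 : 0 ≤ h := by linarith
  refine (enorm_add_le _ _).trans (add_le_add ?_ ?_)
  · refine (enorm_clm_intervalIntegral_le _ _ ha).trans ?_
    rw [← lintegral_const_mul' _ _ ENNReal.ofReal_ne_top]
    refine setLIntegral_mono' measurableSet_Ioo fun s hs => ?_
    have has : 0 < a - s := by linarith [hs.2]
    rw [enorm_fracProj, projTo_proj, ← mul_assoc, ← ENNReal.ofReal_mul (by positivity)]
    refine enorm_le_ofReal_mul_enorm (by positivity) ?_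
    have := 𝔄.norm_projTo_semigroup_sub_le I hr hq hrq has (sub_nonneg.2 hat) (g s)
    rw [show a - s + (t - a) = t - s by ring] at this
    refine this.trans ?_
    gcongr
  · refine (enorm_clm_intervalIntegral_le _ _ hat).trans ?_
    rw [← lintegral_const_mul' _ _ ENNReal.ofReal_ne_top]
    refine setLIntegral_mono' measurableSet_Ioo fun s hs => ?_
    have hts : 0 < t - s := by linarith [hs.2]
    rw [enorm_fracProj, projTo_proj, ← mul_assoc, ← ENNReal.ofReal_mul (by positivity)]
    refine enorm_le_ofReal_mul_enorm (by positivity) ?_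
    refine (𝔄.norm_projTo_semigroup_le I hr (by linarith) hts (g s)).trans ?_
    have h1 : (t - s) ^ (-r) = (t - s) ^ q * (t - s) ^ (-(r + q)) := by
      rw [← Real.rpow_add hts]; ring_nf
    rw [h1]
    have : t - s ≤ h := by linarith [hs.1]
    gcongr

theorem stronglyMeasurable_conv {Ω : Type*} [MeasurableSpace Ω] {g : ℝ → Ω → H}
    (hg : StronglyMeasurable (Function.uncurry g)) (I : Finset ι) {t : ℝ} (ht : 0 ≤ t) :
    StronglyMeasurable fun ω => 𝔄.conv I (fun s => g s ω) t := by
  unfold conv convCoord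
  refine Finset.stronglyMeasurable_fun_sum _ fun i _ => ?_
  refine StronglyMeasurable.smul_const ?_ _
  refine StronglyMeasurable.const_mul ?_ _
  simp_rw [intervalIntegral.integral_of_le ht]
  have : StronglyMeasurable fun q : ℝ × Ω =>
      Real.exp (-(q.1 * 𝔄.eig i)) * inner ℝ (𝔄.basis i) (Function.uncurry g q) := by
    refine StronglyMeasurable.mul ?_ (stronglyMeasurable_const.inner hg)
    exact (by fun_prop : Measurable fun q : ℝ × Ω =>
      Real.exp (-(q.1 * 𝔄.eig i))).stronglyMeasurable
  exact this.integral_prod_left'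

end DiagonalData

/-! ### The time grid. -/

section Grid

variable {h t s : ℝ}

theorem gridFloor_le (hh : 0 < h) (t : ℝ) : gridFloor h t ≤ t := (isGreatest_gridFloor hh t).1.2

theorem lt_gridFloor_add (hh : 0 < h) (t : ℝ) : t < gridFloor h t + h := by
  have := Int.lt_floor_add_one (t / h)
  rw [div_lt_iff₀ hh] at this
  unfold gridFloor
  linarith

theorem gridFloor_nonneg (hh : 0 < h) (ht : 0 ≤ t) : 0 ≤ gridFloor h t :=
  mul_nonneg hh.le (by exact_mod_cast Int.floor_nonneg.2 (div_nonneg ht hh.le))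

theorem gridFloor_eq_of_mem (hh : 0 < h) (hs : s ∈ Ico (gridFloor h t) (gridFloor h t + h)) :
    gridFloor h s = gridFloor h t := by
  have : ⌊s / h⌋ = ⌊t / h⌋ := by
    rw [Int.floor_eq_iff, le_div_iff₀ hh, div_lt_iff₀ hh]
    unfold gridFloor at hs
    constructor <;> linarith [hs.1, hs.2]
  rw [gridFloor, this, gridFloor]

theorem gridFloor_mem_Icc {T : ℝ} (hh : 0 < h) (ht : t ∈ Icc 0 T) : gridFloor h t ∈ Icc 0 T :=
  ⟨gridFloor_nonneg hh ht.1, (gridFloor_le hh t).trans ht.2⟩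

theorem eventually_gridFloor_eq (hh : 0 < h) (t : ℝ) :
    ∀ᶠ s in 𝓝[≥] t, gridFloor h s = gridFloor h t := by
  filter_upwards [Ico_mem_nhdsGE (lt_gridFloor_add hh t)] with s hs
  exact gridFloor_eq_of_mem hh ⟨(gridFloor_le hh t).trans hs.1, hs.2⟩

/-- A function of the preceding grid point is constant just to the right of `t`, so no regularity of
`k` is needed. -/
theorem continuousWithinAt_of_gridFloor {E : Type*} [TopologicalSpace E] {g k : ℝ → E} {T : ℝ}
    (hh : 0 < h) (hg : ∀ s ∈ Icc 0 T, g s = k (gridFloor h s)) (ht : t ∈ Ico 0 T) :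
    ContinuousWithinAt g (Ici t) t := by
  refine continuousWithinAt_const (b := g t) |>.congr_of_eventuallyEq ?_ rfl
  filter_upwards [eventually_gridFloor_eq hh t, Ico_mem_nhdsGE ht.2] with s hs hs'
  rw [hg s ⟨ht.1.trans hs'.1, hs'.2.le⟩, hg t ⟨ht.1, ht.2.le⟩, hs]

end Grid

/-! ### Pathwise energy estimates. -/

/-- Gronwall's inequality with right derivatives: `e^{-Kt} f(t)` is compared with the primitive of
`b`, using `e^{-Kt} ≤ 1` and `b ≥ 0`. -/
theorem le_exp_mul_integral_of_right_deriv_le {f f' b : ℝ → ℝ} {T K : ℝ} (hK : 0 ≤ K)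
    (hf : ContinuousOn f (Icc 0 T)) (hf' : ∀ t ∈ Ico 0 T, HasDerivWithinAt f (f' t) (Ici t) t)
    (hf0 : f 0 ≤ 0) (hb : IsDriver b) (hb0 : ∀ t ∈ Ico 0 T, 0 ≤ b t)
    (hbc : ∀ t ∈ Ico 0 T, ContinuousWithinAt b (Ici t) t)
    (bound : ∀ t ∈ Ico 0 T, f' t ≤ K * f t + b t) {t : ℝ} (ht : t ∈ Icc 0 T) :
    f t ≤ Real.exp (K * t) * ∫ s in (0 : ℝ)..t, b s := by
  have key := image_le_of_deriv_right_le_deriv_boundary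
    (f := fun t => Real.exp (-(K * t)) * f t)
    (f' := fun t => Real.exp (-(K * t)) * (-K) * f t + Real.exp (-(K * t)) * f' t)
    (B := fun t => ∫ s in (0 : ℝ)..t, b s) (B' := b) (a := 0) (b := T)
    ((by fun_prop : Continuous fun t => Real.exp (-(K * t))).continuousOn.mul hf)
    (fun x hx => ?_) (by simpa using hf0)
    (intervalIntegral.continuous_primitive hb.intervalIntegrable 0).continuousOn
    (fun x hx => intervalIntegral.integral_hasDerivWithinAt_right (t := Ioi x)
      (hb.intervalIntegrable _ _) (hb.stronglyMeasurableAtFilter _)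
      ((hbc x hx).mono Ioi_subset_Ici_self)) (fun x hx => ?_) ht
  · have h1 : Real.exp (-(K * t)) = (Real.exp (K * t))⁻¹ := Real.exp_neg _
    simp only [h1, inv_mul_le_iff₀ (Real.exp_pos (K * t))] at key
    exact key
  · refine HasDerivWithinAt.mul ?_ (hf' x hx)
    have := (((hasDerivAt_id x).const_mul K).fun_neg).exp
    refine (this.congr_deriv ?_).hasDerivWithinAt
    simp
  · have h1 : Real.exp (-(K * x)) ≤ 1 := Real.exp_le_one_iff.2 (by nlinarith [hx.1])
    have h2 := Real.exp_pos (-(K * x))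
    have h3 := bound x hx
    have h4 := hb0 x hx
    calc _ = Real.exp (-(K * x)) * (f' x - K * f x) := by ring
      _ ≤ Real.exp (-(K * x)) * b x := by gcongr; linarith
      _ ≤ 1 * b x := by gcongr
      _ = b x := one_mul _

theorem rpow_mul_rpow_neg_le {h T χ α β : ℝ} (hh : 0 < h) (hhT : h ≤ T) (hαβ : χ * β ≤ α) :
    h ^ α * (h ^ (-χ)) ^ β ≤ T ^ (α - χ * β) := by
  rw [← Real.rpow_mul hh.le, ← Real.rpow_add hh]
  have : α + -χ * β = α - χ * β := by ring
  rw [this]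
  exact Real.rpow_le_rpow hh.le hhT (by linarith)

/-- The constant term of the growth bound is absorbed as well, because `h ≤ T` makes `h^{-χ}`
bounded below by `T^{-χ}`. -/
theorem PolyLipschitz.exists_norm_le_rpow {V H : Type*} [NormedAddCommGroup V]
    [NormedAddCommGroup H] {F : V → H} {L a T χ K : ℝ} (hL : 0 ≤ L) (ha : 0 < a)
    (hF : PolyLipschitz F L a) (hχ : 0 < χ) (hT : 0 < T) (hK : 0 ≤ K) :
    ∃ C, 0 ≤ C ∧ ∀ h, 0 < h → h ≤ T → ∀ y, ‖y‖ ≤ K * h ^ (-χ) →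
      ‖F y‖ ≤ C * (h ^ (-χ)) ^ (1 + a) := by
  refine ⟨(‖F 0‖ + 2 * L) * (T ^ (χ * (1 + a)) + K ^ (1 + a)), by positivity, ?_⟩
  intro h hh hhT y hy
  refine (hF.growth hL ha y).trans ?_
  rw [mul_assoc, add_mul (T ^ _)]
  have hx : 0 ≤ h ^ (-χ) := by positivity
  gcongr
  · rw [← Real.rpow_mul hh.le, neg_mul, Real.rpow_neg hh.le, ← div_eq_mul_inv,
      one_le_div (by positivity)]
    gcongr
  · rw [← Real.mul_rpow hK hx]
    gcongr

section

variable {ι H : Type*} [NormedAddCommGroup H] [InnerProductSpace ℝ H] {𝔄 : DiagonalData ι H}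
  {V : Type*} [NormedAddCommGroup V] [NormedSpace ℝ V]

/-- Along one step of the scheme the nonlinearity changes by a bounded amount, thanks to the
truncation. -/
theorem DiagonalData.Between.exists_norm_sub_le {ρ : ℝ} (j : 𝔄.Between ρ V) {F : V → H}
    {T L φ γ χ K : ℝ} (hL : 0 ≤ L) (hφ : 0 < φ) (hF : PolyLipschitz F L (φ / 2)) (hT : 0 < T)
    (hρ : 0 ≤ ρ) (hργ : ρ ≤ γ) (hγ : γ ≤ 1) (hχ : 0 < χ) (hχ1 : χ * (1 + φ / 2) ≤ γ - ρ)
    (hχ2 : χ * (1 + φ) ≤ 1 - ρ) (hK : 0 ≤ K) :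
    ∃ C, 0 ≤ C ∧ ∀ h, 0 < h → h ≤ T → ∀ (I : Finset ι) (g : ℝ → H) (o : V) (a t : ℝ),
      IsDriver g → a ≤ t → t ≤ a + h →
      (∀ s ∈ Ico a t, g s = F (j.proj I (𝔄.conv I g a) + o)) →
      ‖𝔄.projTo I γ (𝔄.conv I g a)‖ ≤ h ^ (-χ) → ‖j.proj I (𝔄.conv I g a) + o‖ ≤ K * h ^ (-χ) →
      ‖F (j.proj I (𝔄.conv I g a) + o) - F (j.proj I (𝔄.conv I g t) + o)‖ ≤ C := by
  obtain ⟨C₁, hC₁, h₁⟩ := hF.exists_norm_le_rpow hL (half_pos hφ) hχ hT hK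
  set J := ‖j.ofHsp‖
  have hJ : 0 ≤ J := norm_nonneg j.ofHsp
  -- `J * A` will bound the increment `‖y - w‖`, and `K' h^{-χ}` will then bound `‖w‖`. `B` bounds
  -- the increment after multiplication by the Lipschitz factor `h^{-χφ/2}`; its two exponents of
  -- `T` are nonnegative exactly by `hχ1` and `hχ2`.
  set A := T ^ (γ - ρ - χ * 1) + C₁ * T ^ (1 - ρ - χ * (1 + φ / 2))
  set B := T ^ (γ - ρ - χ * (1 + φ / 2)) + C₁ * T ^ (1 - ρ - χ * (1 + φ / 2 + φ / 2))
  set K' := K + J * A * T ^ χ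
  have hA : 0 ≤ A := by positivity
  have hB : 0 ≤ B := by positivity
  have hK' : 0 ≤ K' := by positivity
  refine ⟨L * J * (T ^ (χ * (φ / 2)) + K ^ (φ / 2) + K' ^ (φ / 2)) * B, by positivity, ?_⟩
  intro h hh hhT I g o a t hg hat hth hgs hz hy
  set x := h ^ (-χ) with hx
  have hx0 : 0 < x := by positivity
  have h1x : ∀ q, 0 ≤ q → 1 ≤ T ^ (χ * q) * x ^ q := by
    intro q hq
    rw [hx, ← Real.rpow_mul hh.le, neg_mul, Real.rpow_neg hh.le, ← div_eq_mul_inv,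
      one_le_div (by positivity)]
    gcongr
  set y := j.proj I (𝔄.conv I g a) + o
  set w := j.proj I (𝔄.conv I g t) + o
  have hta : 0 ≤ t - a := by linarith
  have hta' : t - a ≤ h := by linarith
  have hρ1 : ρ ≤ 1 := hργ.trans hγ
  have hD : ‖y - w‖ ≤ J * (h ^ (γ - ρ) * x + h ^ (1 - ρ) * (C₁ * x ^ (1 + φ / 2))) := by
    have e : y - w = -(j.proj I (𝔄.conv I g t - 𝔄.conv I g a)) := by
      simp only [y, w, map_sub]; abel
    rw [e, norm_neg]
    refine (j.norm_proj_le I _).trans ?_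
    gcongr
    refine (DiagonalData.norm_projTo_conv_sub_le_of_const hg I hρ hργ hγ hat hgs).trans ?_
    gcongr
    exact h₁ h hh hhT y hy
  have hχφ : 0 < χ * φ := mul_pos hχ hφ
  have e1 : h ^ (γ - ρ) * x ≤ T ^ (γ - ρ - χ * 1) := by
    have := rpow_mul_rpow_neg_le (χ := χ) (α := γ - ρ) (β := 1) hh hhT (by nlinarith)
    rwa [Real.rpow_one] at this
  have e2 : h ^ (1 - ρ) * x ^ (1 + φ / 2) ≤ T ^ (1 - ρ - χ * (1 + φ / 2)) :=
    rpow_mul_rpow_neg_le hh hhT (by nlinarith)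
  have e3 : h ^ (γ - ρ) * x ^ (1 + φ / 2) ≤ T ^ (γ - ρ - χ * (1 + φ / 2)) :=
    rpow_mul_rpow_neg_le hh hhT (by nlinarith)
  have e4 : h ^ (1 - ρ) * x ^ (1 + φ / 2 + φ / 2)
      ≤ T ^ (1 - ρ - χ * (1 + φ / 2 + φ / 2)) :=
    rpow_mul_rpow_neg_le hh hhT (by nlinarith)
  have hDA : ‖y - w‖ ≤ J * A := by
    refine hD.trans ?_
    gcongr
    calc _ = h ^ (γ - ρ) * x + C₁ * (h ^ (1 - ρ) * x ^ (1 + φ / 2)) := by ring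
      _ ≤ A := add_le_add e1 (mul_le_mul_of_nonneg_left e2 hC₁)
  have hw : ‖w‖ ≤ K' * x := by
    have : ‖w‖ ≤ ‖y‖ + ‖y - w‖ := by
      have := norm_sub_norm_le w y
      rw [norm_sub_rev] at this
      linarith
    -- A constant is at most a multiple of `x`, as `T ^ χ * x ≥ 1`; this turns the bound on the
    -- increment into one of the form `K' * x`.
    have h2 := h1x 1 zero_le_one
    rw [mul_one, Real.rpow_one] at h2
    calc ‖w‖ ≤ K * x + J * A * 1 := by linarith
      _ ≤ K * x + J * A * (T ^ χ * x) := by gcongr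
      _ = K' * x := by simp only [K']; ring
  have hfac : 1 + ‖y‖ ^ (φ / 2) + ‖w‖ ^ (φ / 2)
      ≤ (T ^ (χ * (φ / 2)) + K ^ (φ / 2) + K' ^ (φ / 2)) * x ^ (φ / 2) := by
    rw [add_mul, add_mul, ← Real.mul_rpow hK hx0.le, ← Real.mul_rpow hK' hx0.le]
    gcongr
    exact h1x _ (by positivity)
  calc ‖F y - F w‖ ≤ L * ‖y - w‖ * (1 + ‖y‖ ^ (φ / 2) + ‖w‖ ^ (φ / 2)) := hF y w
    _ ≤ L * (J * (h ^ (γ - ρ) * x + h ^ (1 - ρ) * (C₁ * x ^ (1 + φ / 2))))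
        * ((T ^ (χ * (φ / 2)) + K ^ (φ / 2) + K' ^ (φ / 2)) * x ^ (φ / 2)) := by gcongr
    _ = L * J * (T ^ (χ * (φ / 2)) + K ^ (φ / 2) + K' ^ (φ / 2))
        * (h ^ (γ - ρ) * (x * x ^ (φ / 2))
          + C₁ * (h ^ (1 - ρ) * (x ^ (1 + φ / 2) * x ^ (φ / 2)))) := by ring
    _ = L * J * (T ^ (χ * (φ / 2)) + K ^ (φ / 2) + K' ^ (φ / 2))
        * (h ^ (γ - ρ) * x ^ (1 + φ / 2)
          + C₁ * (h ^ (1 - ρ) * x ^ (1 + φ / 2 + φ / 2))) := by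
        rw [Real.rpow_add hx0 (1 + φ / 2) (φ / 2), Real.rpow_add hx0 1 (φ / 2), Real.rpow_one]
    _ ≤ _ := by
        gcongr
        exact add_le_add e3 (mul_le_mul_of_nonneg_left e4 hC₁)

end

namespace DiagonalData

variable {ι H : Type*} [NormedAddCommGroup H] [InnerProductSpace ℝ H] {𝔄 : DiagonalData ι H}
  {V : Type*} [NormedAddCommGroup V] [NormedSpace ℝ V]

theorem norm_projTo_sq_conv (I : Finset ι) (r : ℝ) (g : ℝ → H) (t : ℝ) :
    ‖𝔄.projTo I r (𝔄.conv I g t)‖ ^ 2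
      = ∑ i ∈ I, ((-𝔄.eig i) ^ r * 𝔄.convCoord g i t) ^ 2 := by
  rw [norm_projTo_sq]
  exact Finset.sum_congr rfl fun i hi => by rw [inner_conv _ hi]

theorem inner_projTo_conv (I : Finset ι) (r : ℝ) (g : ℝ → H) (t : ℝ) (f : H) :
    inner ℝ (𝔄.projTo I r (𝔄.conv I g t)) (𝔄.projTo I r f)
      = ∑ i ∈ I, ((-𝔄.eig i) ^ r * 𝔄.convCoord g i t)
          * ((-𝔄.eig i) ^ r * inner ℝ (𝔄.basis i) f) := by
  rw [𝔄.inner_eq_sum _ _ (𝔄.proj_mem_projRange subset_rfl _)]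
  refine Finset.sum_congr rfl fun i hi => ?_
  rw [toH_projTo, toH_projTo, inner_proj_of_mem _ hi, inner_proj_of_mem _ hi, inner_conv _ hi]

theorem inner_conv_left (I : Finset ι) (g : ℝ → H) (t : ℝ) (f : H) :
    inner ℝ (𝔄.conv I g t) f
      = ∑ i ∈ I, 𝔄.convCoord g i t * inner ℝ (𝔄.basis i) f := by
  rw [𝔄.inner_eq_sum_of_mem (𝔄.conv_mem I g t)]
  exact Finset.sum_congr rfl fun i hi => by rw [inner_conv _ hi]

theorem norm_sq_conv (I : Finset ι) (g : ℝ → H) (t : ℝ) :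
    ‖𝔄.conv I g t‖ ^ 2 = ∑ i ∈ I, 𝔄.convCoord g i t ^ 2 := by
  rw [𝔄.norm_sq_eq_sum_of_mem (𝔄.conv_mem I g t)]
  exact Finset.sum_congr rfl fun i hi => by rw [inner_conv _ hi]

/-- Moving half a power of `-A` across the pairing turns it into `⟨-A P_I u, f⟩_H`. A perturbation
bounded only in `H` can thus be absorbed by the `H_1` dissipation. -/
theorem inner_projTo_half_le (I : Finset ι) (u f : H) :
    inner ℝ (𝔄.projTo I (1 / 2) u) (𝔄.projTo I (1 / 2) f) ≤ ‖𝔄.projTo I 1 u‖ * ‖f‖ := by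
  have h : inner ℝ (𝔄.projTo I (1 / 2) u) (𝔄.projTo I (1 / 2) f)
      = inner ℝ (𝔄.projTo I 1 u).pow f := by
    rw [𝔄.inner_eq_sum _ _ (𝔄.proj_mem_projRange subset_rfl _),
      𝔄.inner_eq_sum_of_mem (𝔄.pow_mem_projRange (𝔄.proj_mem_projRange subset_rfl _))]
    refine Finset.sum_congr rfl fun i hi => ?_
    rw [toH_projTo, toH_projTo, inner_proj_of_mem _ hi, inner_proj_of_mem _ hi, Hsp.inner_pow,
      toH_projTo, inner_proj_of_mem _ hi]
    have : (-𝔄.eig i) ^ (1 : ℝ) = (-𝔄.eig i) ^ (1 / 2 : ℝ) * (-𝔄.eig i) ^ (1 / 2 : ℝ) := by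
      rw [← Real.rpow_add (𝔄.eig_neg i)]; norm_num
    rw [this]
    ring
  rw [h, Hsp.norm_def]
  exact real_inner_le_norm _ _

/-- With weights `-μ_i + q` the derivative contains the pairing in `H_{1/2}` plus `q` times the
pairing in `H`, which is the combination bounded by the coercivity condition for `q = φ(x)`. -/
theorem sum_energy_deriv_eq (I : Finset ι) (q : ℝ) (g : ℝ → H) (t : ℝ) :
    ∑ i ∈ I, 2 * ((-𝔄.eig i + q) * 𝔄.convCoord g i t
        * (𝔄.eig i * 𝔄.convCoord g i t + inner ℝ (𝔄.basis i) (g t)))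
      = 2 * (-‖𝔄.projTo I 1 (𝔄.conv I g t)‖ ^ 2
          - q * ‖𝔄.projTo I (1 / 2) (𝔄.conv I g t)‖ ^ 2
          + inner ℝ (𝔄.projTo I (1 / 2) (𝔄.conv I g t)) (𝔄.projTo I (1 / 2) (g t))
          + q * inner ℝ (𝔄.conv I g t) (g t)) := by
  rw [norm_projTo_sq_conv, norm_projTo_sq_conv, inner_projTo_conv, inner_conv_left, Finset.mul_sum,
    Finset.mul_sum, ← Finset.sum_neg_distrib, ← Finset.sum_sub_distrib, ← Finset.sum_add_distrib,
    ← Finset.sum_add_distrib, Finset.mul_sum]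
  refine Finset.sum_congr rfl fun i _ => ?_
  have e : (-𝔄.eig i) ^ (1 / 2 : ℝ) * (-𝔄.eig i) ^ (1 / 2 : ℝ) = -𝔄.eig i := by
    rw [← Real.rpow_add (𝔄.eig_neg i)]; norm_num
  rw [Real.rpow_one]
  linear_combination (-2 * (-q * 𝔄.convCoord g i t ^ 2
    + 𝔄.convCoord g i t * inner ℝ (𝔄.basis i) (g t))) * e

theorem sum_energy_eq (I : Finset ι) (q : ℝ) (g : ℝ → H) (t : ℝ) :
    ∑ i ∈ I, (-𝔄.eig i + q) * 𝔄.convCoord g i t ^ 2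
      = ‖𝔄.projTo I (1 / 2) (𝔄.conv I g t)‖ ^ 2 + q * ‖𝔄.conv I g t‖ ^ 2 := by
  rw [norm_projTo_sq_conv, norm_sq_conv, Finset.mul_sum, ← Finset.sum_add_distrib]
  refine Finset.sum_congr rfl fun i _ => ?_
  have e : (-𝔄.eig i) ^ (1 / 2 : ℝ) * (-𝔄.eig i) ^ (1 / 2 : ℝ) = -𝔄.eig i := by
    rw [← Real.rpow_add (𝔄.eig_neg i)]; norm_num
  linear_combination (-𝔄.convCoord g i t ^ 2) * e

theorem continuous_energy {g : ℝ → H} (hg : IsDriver g) (I : Finset ι) (w : ι → ℝ) :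
    Continuous fun t => ∑ i ∈ I, w i * 𝔄.convCoord g i t ^ 2 :=
  continuous_finsetSum _ fun i _ => ((continuous_convCoord hg i).pow 2).const_mul (w i)

/-- Here `S₁`, `Sh`, `S₀` stand for the squared norms of `z` in `H_1`, `H_{1/2}`, `H`; `p₁`, `p₀`
are pairings with the drift to which coercivity applies, and `d₁`, `d₀` pairings with an error of
norm at most `K`. The dissipation `-S₁` pays for `ε S₁` from coercivity and `(1-ε) S₁` from Young's
inequality, and `-q Sh` cancels the term `q Sh`. What remains fits under `(2c+1)` times the energy
plus a constant. -/
theorem energy_bound_aux {c ε q Q K S₁ Sh S₀ p₁ p₀ d₁ d₀ b : ℝ} (hε : 0 < 1 - ε)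
    (hq : 0 ≤ q) (hSh : 0 ≤ Sh) (hS₀ : 0 ≤ S₀) (hQ : 0 ≤ Q)
    (hco : p₁ + q * p₀ ≤ ε * S₁ + (c + q) * Sh + c * q * S₀ + Q)
    (hd₁ : d₁ ≤ (1 - ε) * S₁ + K ^ 2 / (4 * (1 - ε))) (hd₀ : d₀ ≤ S₀ / 2 + K ^ 2 / 2)
    (hb : b = (2 + K ^ 2 / (2 * (1 - ε)) + K ^ 2) * (1 + Q + q)) :
    2 * (-S₁ - q * Sh + (p₁ + d₁) + q * (p₀ + d₀)) ≤ (2 * c + 1) * (Sh + q * S₀) + b := by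
  have h0 := mul_le_mul_of_nonneg_left hd₀ hq
  have e1 : 0 ≤ K ^ 2 / (2 * (1 - ε)) := by positivity
  have e2 : 0 ≤ K ^ 2 := by positivity
  have hB1 : 2 * Q + K ^ 2 / (2 * (1 - ε)) + q * K ^ 2 ≤ b := by
    rw [hb]
    have f1 := mul_nonneg e1 hQ
    have f2 := mul_nonneg e1 hq
    have f3 := mul_nonneg e2 hQ
    linarith
  have hB2 : K ^ 2 / (2 * (1 - ε)) = 2 * (K ^ 2 / (4 * (1 - ε))) := by field_simp; ring
  have := mul_nonneg hq hS₀
  linarith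

/-- Pathwise a priori bound for the tamed exponential Euler scheme. -/
theorem exists_norm_projTo_half_conv_le {T c φ ε ρ γ χ : ℝ} (hT : 0 < T) (hc : 0 < c) (hφ : 0 < φ)
    (hε : ε ∈ Ico (0 : ℝ) 1) (hρ : ρ ∈ Ico (0 : ℝ) (1 / 2)) (hγ : γ ∈ Ioc ρ (1 / 2))
    (hχ : 0 < χ) (hχ1 : χ * (1 + φ / 2) ≤ γ - ρ) (hχ2 : χ * (1 + φ) ≤ 1 - ρ)
    (j : 𝔄.Between ρ V) {phi Phi : C(Icc (0 : ℝ) T, 𝔄.Hsp 1) → ℝ≥0} {F : V → H}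
    (hF_coercive : ∀ (I : Finset ι) (v : 𝔄.Hsp 1), v.toH ∈ 𝔄.projRange I →
      ∀ (x : C(Icc (0 : ℝ) T, 𝔄.Hsp 1)) (t : Icc (0 : ℝ) T),
      inner ℝ (DiagonalData.Hsp.incl half_le_one_real v)
          (𝔄.projTo I (1 / 2) (F (j.incl (le_one_of_lt_half hρ.2) (v + x t))))
        + phi x * inner ℝ v.toH (F (j.incl (le_one_of_lt_half hρ.2) (v + x t)))
      ≤ ε * ‖v‖ ^ 2
        + (c + phi x) * ‖DiagonalData.Hsp.incl half_le_one_real v‖ ^ 2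
        + c * phi x * ‖v.toH‖ ^ 2 + Phi x)
    {L : ℝ} (hL : 0 ≤ L) (hF : PolyLipschitz F L (φ / 2)) :
    ∃ C, 0 ≤ C ∧ ∀ h, 0 < h → h ≤ T → ∀ (I : Finset ι) (o : ℝ → 𝔄.Hsp 1)
      (ho : ContinuousOn o (Icc 0 T)), (∀ t ∈ Icc 0 T, (o t).toH ∈ 𝔄.projRange I) →
      ∀ (y : ℝ → 𝔄.Hsp γ) (g : ℝ → H), IsDriver g →
      (∀ s ∈ Icc 0 T, g s = if ‖y (gridFloor h s)‖
          + ‖Hsp.incl (le_one_of_le_half hγ.2) (o (gridFloor h s))‖ ≤ h ^ (-χ)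
        then F (j.incl hγ.1.le (y (gridFloor h s))) else 0) →
      (∀ s ∈ Icc 0 T, (y (gridFloor h s)).toH
        = 𝔄.conv I g (gridFloor h s) + (o (gridFloor h s)).toH) →
      ∀ t ∈ Icc 0 T, ‖𝔄.projTo I (1 / 2) (𝔄.conv I g t)‖ ^ 2
        ≤ C * (1 + Phi (pathOn ho) + phi (pathOn ho)) := by
  obtain ⟨J, hJ, hJV⟩ := j.norm_incl_le hγ.1.le
  obtain ⟨K, hK, hstep⟩ := j.exists_norm_sub_le hL hφ hF hT hρ.1 hγ.1.le
    (le_one_of_le_half hγ.2) hχ hχ1 hχ2 hJ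
  have hε1 : 0 < 1 - ε := by linarith [hε.2]
  set B := 2 + K ^ 2 / (2 * (1 - ε)) + K ^ 2
  have hB : 0 ≤ B := by positivity
  refine ⟨Real.exp ((2 * c + 1) * T) * (T * B), by positivity, ?_⟩
  intro h hh hhT I o ho hoI y g hg hgs hys
  set q : ℝ := (phi (pathOn ho) : ℝ) with hq
  set Q : ℝ := (Phi (pathOn ho) : ℝ) with hQ
  have hq0 : 0 ≤ q := (phi (pathOn ho)).2
  have hQ0 : 0 ≤ Q := (Phi (pathOn ho)).2
  clear_value q Q
  obtain ⟨w, hw⟩ : ∃ w : ι → ℝ, ∀ i, w i = -𝔄.eig i + q := ⟨_, fun _ => rfl⟩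
  have hrc : ∀ t ∈ Ico 0 T, ContinuousWithinAt g (Ici t) t := fun t ht =>
    continuousWithinAt_of_gridFloor hh (k := fun a => if ‖y a‖
      + ‖Hsp.incl (le_one_of_le_half hγ.2) (o a)‖ ≤ h ^ (-χ)
      then F (j.incl hγ.1.le (y a)) else 0) hgs ht
  set b : ℝ → ℝ := fun _ => B * (1 + Q + q)
  have hbd : ∀ t ∈ Ico 0 T, ∑ i ∈ I, 2 * (w i * 𝔄.convCoord g i t
        * (𝔄.eig i * 𝔄.convCoord g i t + inner ℝ (𝔄.basis i) (g t)))
      ≤ (2 * c + 1) * (∑ i ∈ I, w i * 𝔄.convCoord g i t ^ 2) + b t := by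
    intro t ht
    simp_rw [hw]
    have htI : t ∈ Icc 0 T := ⟨ht.1, ht.2.le⟩
    rw [sum_energy_deriv_eq, sum_energy_eq]
    set z := 𝔄.conv I g t with hz
    set a := gridFloor h t with ha
    have haI : a ∈ Icc 0 T := gridFloor_mem_Icc hh htI
    have hS1 : 0 ≤ ‖𝔄.projTo I 1 z‖ ^ 2 := by positivity
    have hSh : 0 ≤ ‖𝔄.projTo I (1 / 2) z‖ ^ 2 := by positivity
    have hS0 : 0 ≤ ‖z‖ ^ 2 := by positivity
    have hbt : b t = B * (1 + Q + q) := rfl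
    have hb0 : 0 ≤ b t := by rw [hbt]; positivity
    have hqS := mul_nonneg hq0 hSh
    have hqS0 := mul_nonneg hq0 hS0
    by_cases hind : ‖y a‖ + ‖Hsp.incl (le_one_of_le_half hγ.2) (o a)‖ ≤ h ^ (-χ)
    -- The truncation does not act: the driver is `F(y_a)` on the whole step, and `y_a = z_a + o_a`.
    · have hya : j.incl hγ.1.le (y a)
          = j.proj I (𝔄.conv I g a) + j.incl (le_one_of_lt_half hρ.2) (o a) := by
        apply j.toH_injective
        rw [map_add, j.toH_incl, j.toH_incl, j.toH_proj, proj_conv]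
        exact hys t htI
      have hpz : 𝔄.projTo I γ (𝔄.conv I g a)
          = y a - Hsp.incl (le_one_of_le_half hγ.2) (o a) := by
        apply Hsp.toH_injective 𝔄
        rw [map_sub, toH_projTo, Hsp.toH_incl, proj_conv, hys t htI]
        abel
      have hgt : ∀ s ∈ Icc a t, g s = F (j.incl hγ.1.le (y a)) := by
        intro s hs
        have hgs' : gridFloor h s = a :=
          gridFloor_eq_of_mem hh ⟨hs.1, hs.2.trans_lt (lt_gridFloor_add hh t)⟩
        rw [hgs s ⟨haI.1.trans hs.1, hs.2.trans ht.2.le⟩, hgs', if_pos hind]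
      have hat : a ≤ t := gridFloor_le hh t
      have hd := hstep h hh hhT I g (j.incl (le_one_of_lt_half hρ.2) (o a)) a t hg hat
        (lt_gridFloor_add hh t).le
        (fun s hs => by rw [hgt s ⟨hs.1, hs.2.le⟩, hya])
        (by
          rw [hpz]
          exact (norm_sub_le _ _).trans hind)
        (by
          rw [← hya]
          refine (hJV _).trans ?_
          gcongr
          exact le_trans (le_add_of_nonneg_right (norm_nonneg _)) hind)
      -- The drift with the convolution at the current time `t` but the noise frozen at `a`.
      -- Coercivity admits it with the path evaluated at time `a`, so the noise increment over the
      -- step never has to be estimated.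
      set f₀ := F (j.proj I z + j.incl (le_one_of_lt_half hρ.2) (o a)) with hf₀
      have hg0 : g t = f₀ + (g t - f₀) := by abel
      have hdg : ‖g t - f₀‖ ≤ K := by
        rw [hgt t ⟨hat, le_rfl⟩, hya]
        exact hd
      have hco := hF_coercive I (𝔄.projTo I 1 z) (𝔄.proj_mem_projRange subset_rfl z)
        (pathOn ho) ⟨a, haI⟩
      have hx : (pathOn ho) ⟨a, haI⟩ = o a := rfl
      rw [hx, map_add, j.incl_projTo, incl_projTo, toH_projTo, hz, proj_conv, ← hz, ← hf₀, ← hq, ← hQ] at hco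
      rw [hg0, map_add, inner_add_right, inner_add_right]
      have hp1 := inner_projTo_half_le (𝔄 := 𝔄) I z (g t - f₀)
      have hp0 := real_inner_le_norm z (g t - f₀)
      have hp1' : ‖𝔄.projTo I 1 z‖ * ‖g t - f₀‖
          -- Young's inequality with weight `1 - ε`, exactly the dissipation left over by
          -- coercivity.
          ≤ (1 - ε) * ‖𝔄.projTo I 1 z‖ ^ 2 + K ^ 2 / (4 * (1 - ε)) := by
        have h1 : ‖𝔄.projTo I 1 z‖ * ‖g t - f₀‖ ≤ ‖𝔄.projTo I 1 z‖ * K := by gcongr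
        refine h1.trans ?_
        have h2 : (1 - ε) * ‖𝔄.projTo I 1 z‖ ^ 2 + K ^ 2 / (4 * (1 - ε))
            - ‖𝔄.projTo I 1 z‖ * K
            = (2 * (1 - ε) * ‖𝔄.projTo I 1 z‖ - K) ^ 2 / (4 * (1 - ε)) := by
          field_simp
          ring
        have h3 : 0 ≤ (2 * (1 - ε) * ‖𝔄.projTo I 1 z‖ - K) ^ 2 / (4 * (1 - ε)) := by positivity
        linarith
      have hp0' : ‖z‖ * ‖g t - f₀‖ ≤ ‖z‖ ^ 2 / 2 + K ^ 2 / 2 := by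
        have h1 : ‖z‖ * ‖g t - f₀‖ ≤ ‖z‖ * K := by gcongr
        have h2 := sq_nonneg (‖z‖ - K)
        rw [sub_sq] at h2
        linarith
      exact energy_bound_aux hε1 hq0 hSh hS0 hQ0 hco (hp1.trans hp1') (hp0.trans hp0') hbt
    -- The truncation acts: the driver vanishes and only dissipative terms remain.
    · rw [hgs t htI, if_neg hind, map_zero, inner_zero_right, inner_zero_right]
      have : 0 ≤ (2 * c + 1) * (‖𝔄.projTo I (1 / 2) z‖ ^ 2 + q * ‖z‖ ^ 2) := by positivity
      linarith
  intro t ht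
  have key := le_exp_mul_integral_of_right_deriv_le (T := T) (K := 2 * c + 1) (b := b)
    (by positivity) (continuous_energy hg I w).continuousOn
    (fun t ht => hasDerivWithinAt_energy hg I w (hrc t ht))
    (by simp [convCoord]) ⟨stronglyMeasurable_const, ‖B * (1 + Q + q)‖, fun _ => le_rfl⟩
    (fun _ _ => by positivity) (fun _ _ => continuousWithinAt_const) hbd ht
  simp_rw [hw] at key
  rw [intervalIntegral.integral_const, sum_energy_eq, smul_eq_mul, sub_zero] at key
  have h1 : 0 ≤ q * ‖𝔄.conv I g t‖ ^ 2 := by positivity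
  calc ‖𝔄.projTo I (1 / 2) (𝔄.conv I g t)‖ ^ 2
      ≤ Real.exp ((2 * c + 1) * t) * (t * (B * (1 + Q + q))) := by linarith
    _ ≤ Real.exp ((2 * c + 1) * T) * (T * (B * (1 + Q + q))) := by
        have := ht.1
        gcongr <;> exact ht.2
    _ = _ := by ring

/-- Pathwise stability: the difference of two convolutions is controlled by the defect. -/
theorem norm_sq_conv_sub_le {T c : ℝ} (hc : 0 ≤ c) {ρ : ℝ} (hρ : ρ ≤ 1) (j : 𝔄.Between ρ V)
    {F : V → H}
    (hF_mono : ∀ (I : Finset ι) (v w : 𝔄.Hsp 1),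
      v.toH ∈ 𝔄.projRange I → w.toH ∈ 𝔄.projRange I →
      inner ℝ (v.toH - w.toH) (v.gen + F (j.incl hρ v) - w.gen - F (j.incl hρ w))
        ≤ c * ‖v.toH - w.toH‖ ^ 2)
    (I : Finset ι) {g g' : ℝ → H} (hg : IsDriver g) (hg' : IsDriver g')
    (hgc : ∀ t ∈ Ico 0 T, ContinuousWithinAt g (Ici t) t)
    (hgc' : ∀ t ∈ Ico 0 T, ContinuousWithinAt g' (Ici t) t)
    {o : ℝ → 𝔄.Hsp 1} (hoI : ∀ t ∈ Icc 0 T, (o t).toH ∈ 𝔄.projRange I) {d : ℝ → H}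
    (hd : IsDriver d) (hdc : ∀ t ∈ Ico 0 T, ContinuousWithinAt d (Ici t) t)
    (hdeq : ∀ t ∈ Icc 0 T, d t = g t - F (j.proj I (𝔄.conv I g t) + j.incl hρ (o t))
      + F (j.proj I (𝔄.conv I g' t) + j.incl hρ (o t)) - g' t) {t : ℝ} (ht : t ∈ Icc 0 T) :
    ‖𝔄.conv I g t - 𝔄.conv I g' t‖ ^ 2
      ≤ Real.exp ((2 * c + 1) * T) * ∫ s in (0 : ℝ)..t, ‖d s‖ ^ 2 := by
  set k : ℝ → H := fun s => g s - g' s with hk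
  have hkd : IsDriver k := hg.sub hg'
  have hkc : ∀ t ∈ Ico 0 T, ContinuousWithinAt k (Ici t) t := fun t ht =>
    (hgc t ht).sub (hgc' t ht)
  have key := le_exp_mul_integral_of_right_deriv_le (T := T) (K := 2 * c + 1)
    (b := fun s => ‖d s‖ ^ 2) (by positivity)
    (continuous_energy (𝔄 := 𝔄) hkd I fun _ => 1).continuousOn
    (fun t ht => hasDerivWithinAt_energy hkd I (fun _ => 1) (hkc t ht))
    (by simp [convCoord]) hd.norm_sq (fun _ _ => by positivity) (fun t ht => (hdc t ht).norm.pow 2)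
    (fun t ht => ?_) ht
  · simp only [one_mul, ← norm_sq_conv] at key
    rw [hk, conv_sub I hg hg'] at key
    refine key.trans ?_
    have : 0 ≤ ∫ s in (0 : ℝ)..t, ‖d s‖ ^ 2 :=
      intervalIntegral.integral_nonneg ht.1 fun _ _ => by positivity
    gcongr
    exact ht.2
  · have htI : t ∈ Icc 0 T := ⟨ht.1, ht.2.le⟩
    simp only [one_mul]
    set z := 𝔄.conv I k t with hz
    have hzs : z = 𝔄.conv I g t - 𝔄.conv I g' t := conv_sub I hg hg' t
    have hmem : ∀ g : ℝ → H, (𝔄.projTo I 1 (𝔄.conv I g t) + o t).toH ∈ 𝔄.projRange I := by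
      intro g
      rw [map_add]
      exact Submodule.add_mem _ (𝔄.proj_mem_projRange subset_rfl _) (hoI t htI)
    -- Both points contain the same noise `o t`, so it cancels in the difference and in the two
    -- values of `A`.
    have hm := hF_mono I (𝔄.projTo I 1 (𝔄.conv I g t) + o t)
      (𝔄.projTo I 1 (𝔄.conv I g' t) + o t) (hmem g) (hmem g')
    simp only [map_add, j.incl_projTo, toH_projTo, proj_conv, add_sub_add_right_eq_sub,
      ← hzs] at hm
    set Fv := F (j.proj I (𝔄.conv I g t) + j.incl hρ (o t))
    set Fw := F (j.proj I (𝔄.conv I g' t) + j.incl hρ (o t))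
    set gv := (𝔄.projTo I 1 (𝔄.conv I g t) + o t).gen with hgv
    set gw := (𝔄.projTo I 1 (𝔄.conv I g' t) + o t).gen with hgw
    have hsum : ∑ i ∈ I, 2 * (𝔄.convCoord k i t
        * (𝔄.eig i * 𝔄.convCoord k i t + inner ℝ (𝔄.basis i) (k t)))
        = 2 * inner ℝ z (gv - gw + k t) := by
      rw [hz, inner_conv_left, Finset.mul_sum]
      refine Finset.sum_congr rfl fun i hi => ?_
      simp only [hgv, hgw, inner_add_right, inner_sub_right, Hsp.inner_gen, map_add, toH_projTo,
        proj_conv, inner_conv _ hi, hk, convCoord_sub hg hg']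
      ring
    rw [hsum, ← norm_sq_conv, ← hz]
    -- The defect is what must be added to the monotone difference in order to obtain the actual
    -- velocity of `z`.
    have e1 : gv - gw + k t = (gv + Fv - gw - Fw) + d t := by
      rw [hdeq t htI]
      simp only [hk]
      abel
    rw [e1, inner_add_right]
    have h1 := real_inner_le_norm z (d t)
    nlinarith [sq_nonneg (‖z‖ - ‖d t‖)]

end DiagonalData

/-! ### `L^q` norms with values in `[0, ∞]`. -/

section LpN

variable {Ω : Type*} [MeasurableSpace Ω] {P : Measure Ω}

/-- The `L^q` norm of a nonnegative extended real function. -/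
noncomputable def lpN (P : Measure Ω) (q : ℝ) (f : Ω → ℝ≥0∞) : ℝ≥0∞ :=
  (∫⁻ ω, f ω ^ q ∂P) ^ (1 / q)

variable {q : ℝ} {f g : Ω → ℝ≥0∞}

theorem lpN_mono_ae (hq : 0 ≤ q) (h : ∀ᵐ ω ∂P, f ω ≤ g ω) : lpN P q f ≤ lpN P q g := by
  refine ENNReal.rpow_le_rpow (lintegral_mono_ae ?_) (by positivity)
  filter_upwards [h] with ω hω
  exact ENNReal.rpow_le_rpow hω hq

theorem lpN_mono (hq : 0 ≤ q) (h : ∀ ω, f ω ≤ g ω) : lpN P q f ≤ lpN P q g :=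
  lpN_mono_ae hq (Eventually.of_forall h)

theorem lpN_const_mul (hq : 0 < q) {c : ℝ≥0∞} (hc : c ≠ ∞) (f : Ω → ℝ≥0∞) :
    lpN P q (fun ω => c * f ω) = c * lpN P q f := by
  unfold lpN
  simp_rw [ENNReal.mul_rpow_of_nonneg _ _ hq.le]
  rw [lintegral_const_mul' _ _ (ENNReal.rpow_ne_top_of_nonneg hq.le hc),
    ENNReal.mul_rpow_of_nonneg _ _ (by positivity), ← ENNReal.rpow_mul, mul_one_div_cancel hq.ne',
    ENNReal.rpow_one]

theorem lpN_add_le (hq : 1 ≤ q) (hf : Measurable f) (hg : Measurable g) :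
    lpN P q (fun ω => f ω + g ω) ≤ lpN P q f + lpN P q g :=
  ENNReal.lintegral_Lp_add_le hf.aemeasurable hg.aemeasurable hq

theorem lpN_rpow (hq : 0 < q) {r : ℝ} (hr : 0 < r) (f : Ω → ℝ≥0∞) :
    lpN P q (fun ω => f ω ^ r) = lpN P (q * r) f ^ r := by
  unfold lpN
  simp_rw [← ENNReal.rpow_mul]
  rw [mul_comm r q]
  congr 1
  field_simp

theorem lpN_mul_le (hq : 0 < q) (hf : Measurable f) (hg : Measurable g) :
    lpN P q (fun ω => f ω * g ω) ≤ lpN P (2 * q) f * lpN P (2 * q) g := by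
  have h := ENNReal.lintegral_mul_le_Lp_mul_Lq P Real.HolderConjugate.two_two
    (hf.pow_const q).aemeasurable (hg.pow_const q).aemeasurable
  have h2 := ENNReal.rpow_le_rpow h (z := 1 / q) (by positivity)
  unfold lpN
  simp only [Pi.mul_apply, ← ENNReal.rpow_mul] at h2
  simp_rw [ENNReal.mul_rpow_of_nonneg _ _ hq.le]
  refine h2.trans_eq ?_
  rw [ENNReal.mul_rpow_of_nonneg _ _ (by positivity), ← ENNReal.rpow_mul, ← ENNReal.rpow_mul,
    mul_comm q 2]
  congr 2 <;> field_simp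

theorem eLpNorm_eq_lpN {E : Type*} [TopologicalSpace E] [ContinuousENorm E] (hq : 0 < q)
    (f : Ω → E) : eLpNorm f (ENNReal.ofReal q) P = lpN P q fun ω => ‖f ω‖ₑ := by
  rw [eLpNorm_eq_lintegral_rpow_enorm_toReal (by simpa using hq) ENNReal.ofReal_ne_top,
    ENNReal.toReal_ofReal hq.le]
  rfl

theorem lpN_le_lpN_of_le [IsProbabilityMeasure P] {q' : ℝ} (hq : 0 < q) (hqq' : q ≤ q')
    (hf : Measurable f) : lpN P q f ≤ lpN P q' f := by
  have h := eLpNorm_le_eLpNorm_of_exponent_le (μ := P) (ENNReal.ofReal_le_ofReal hqq')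
    hf.aestronglyMeasurable
  rw [eLpNorm_eq_lpN hq, eLpNorm_eq_lpN (hq.trans_le hqq')] at h
  simpa using h

theorem lpN_const [IsProbabilityMeasure P] (hq : 0 < q) (c : ℝ≥0∞) :
    lpN P q (fun _ => c) = c := by
  unfold lpN
  rw [lintegral_const, measure_univ, mul_one, ← ENNReal.rpow_mul, mul_one_div_cancel hq.ne',
    ENNReal.rpow_one]

theorem lpN_le_of_lintegral_le (hq : 0 < q) {B : ℝ≥0∞}
    (h : ∫⁻ ω, f ω ^ q ∂P ≤ B) : lpN P q f ≤ B ^ (1 / q) :=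
  ENNReal.rpow_le_rpow h (by positivity)

/-- Jensen's inequality for a measure that need not be a probability, by Hölder against the constant
`1`. -/
theorem rpow_lintegral_le {S : Type*} [MeasurableSpace S] (ν : Measure S) (hq : 1 ≤ q)
    {f : S → ℝ≥0∞} (hf : Measurable f) :
    (∫⁻ s, f s ∂ν) ^ q ≤ ν univ ^ (q - 1) * ∫⁻ s, f s ^ q ∂ν := by
  have hq0 : 0 < q := by linarith
  rcases hq.eq_or_lt with rfl | hq1
  · simp
  have hconj : q.HolderConjugate (Real.conjExponent q) := Real.HolderConjugate.conjExponent hq1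
  have h := ENNReal.lintegral_mul_le_Lp_mul_Lq ν hconj hf.aemeasurable
    (aemeasurable_const (b := (1 : ℝ≥0∞)))
  simp only [Pi.mul_apply, mul_one, ENNReal.one_rpow, lintegral_const, one_mul] at h
  refine (ENNReal.rpow_le_rpow h hq0.le).trans_eq ?_
  rw [ENNReal.mul_rpow_of_nonneg _ _ hq0.le, ← ENNReal.rpow_mul, ← ENNReal.rpow_mul,
    one_div_mul_cancel hq0.ne', ENNReal.rpow_one, mul_comm]
  congr 2
  rw [Real.conjExponent]
  field_simp

/-- Minkowski's integral inequality, in the form of a uniform bound. -/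
theorem lpN_lintegral_le [SFinite P] {S : Type*} [MeasurableSpace S] (ν : Measure S)
    [SFinite ν] (hq : 1 ≤ q) {f : S → Ω → ℝ≥0∞} (hf : Measurable (Function.uncurry f)) {B : ℝ≥0∞}
    (hB : ∀ᵐ s ∂ν, lpN P q (f s) ≤ B) :
    lpN P q (fun ω => ∫⁻ s, f s ω ∂ν) ≤ ν univ * B := by
  have hq0 : 0 < q := by linarith
  have h1 : ∫⁻ ω, (∫⁻ s, f s ω ∂ν) ^ q ∂P ≤ (ν univ * B) ^ q := by
    calc ∫⁻ ω, (∫⁻ s, f s ω ∂ν) ^ q ∂P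
        ≤ ∫⁻ ω, ν univ ^ (q - 1) * ∫⁻ s, f s ω ^ q ∂ν ∂P :=
          lintegral_mono fun ω => rpow_lintegral_le ν hq (hf.comp measurable_prodMk_right)
      _ = ν univ ^ (q - 1) * ∫⁻ ω, ∫⁻ s, f s ω ^ q ∂ν ∂P := by
          refine lintegral_const_mul _ ?_
          exact Measurable.lintegral_prod_left' (f := fun x : S × Ω => f x.1 x.2 ^ q)
            (hf.pow_const q)
      _ = ν univ ^ (q - 1) * ∫⁻ s, ∫⁻ ω, f s ω ^ q ∂P ∂ν := by
          rw [lintegral_lintegral_swap]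
          exact ((hf.pow_const q).comp measurable_swap).aemeasurable
      _ ≤ ν univ ^ (q - 1) * ∫⁻ _s, B ^ q ∂ν := by
          gcongr 1
          refine lintegral_mono_ae ?_
          filter_upwards [hB] with s hs
          have := ENNReal.rpow_le_rpow hs hq0.le
          rwa [lpN, ← ENNReal.rpow_mul, one_div_mul_cancel hq0.ne', ENNReal.rpow_one] at this
      _ = (ν univ * B) ^ q := by
          rw [lintegral_const, ENNReal.mul_rpow_of_nonneg _ _ hq0.le]
          have : ν univ ^ q = ν univ ^ (q - 1) * ν univ := by
            conv_rhs => rw [← ENNReal.rpow_one (ν univ), ← ENNReal.rpow_mul, one_mul,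
              ← ENNReal.rpow_add_of_nonneg _ _ (by linarith) zero_le_one]
            ring_nf
          rw [this]
          ring
  refine (ENNReal.rpow_le_rpow h1 (z := 1 / q) (by positivity)).trans_eq ?_
  rw [← ENNReal.rpow_mul, mul_one_div_cancel hq0.ne', ENNReal.rpow_one]

/-- The kernel is treated as the density of the measure in Minkowski's inequality, so only its total
mass enters; this permits integrable singularities. -/
theorem lpN_lintegral_mul_le [SFinite P] {k : ℝ → ℝ≥0∞} (hk : Measurable k) (hq : 1 ≤ q)
    {f : ℝ → Ω → ℝ≥0∞} (hf : Measurable (Function.uncurry f)) {S : Set ℝ} (hS : MeasurableSet S)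
    {B K : ℝ≥0∞} (hB : ∀ s ∈ S, lpN P q (f s) ≤ B) (hK : ∫⁻ s in S, k s ≤ K) :
    lpN P q (fun ω => ∫⁻ s in S, k s * f s ω) ≤ K * B := by
  have h := lpN_lintegral_le (P := P) ((volume.restrict S).withDensity k) hq hf (B := B) ?_
  · have e : (fun ω => ∫⁻ s, f s ω ∂(volume.restrict S).withDensity k)
        = fun ω => ∫⁻ s in S, k s * f s ω := by
      funext ω
      have hm : Measurable fun s => f s ω := hf.comp measurable_prodMk_right
      exact lintegral_withDensity_eq_lintegral_mul _ hk hm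
    rw [e, withDensity_apply _ MeasurableSet.univ, Measure.restrict_univ] at h
    exact h.trans (by gcongr)
  · refine (withDensity_absolutelyContinuous _ _).ae_le ?_
    filter_upwards [ae_restrict_mem hS] with s hs
    exact hB s hs

end LpN

theorem lintegral_kernel_le {a t T κ : ℝ} (ha : 0 ≤ a) (hat : a ≤ t) (ht : t ≤ T) (hκ : κ < 1) :
    ∫⁻ s in Ioo a t, ENNReal.ofReal ((t - s) ^ (-κ)) ≤ ENNReal.ofReal (T ^ (1 - κ) / (1 - κ)) := by
  have h0 : 0 ≤ t := ha.trans hat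
  have hint : IntervalIntegrable (fun s => (t - s) ^ (-κ)) volume a t := by
    have h := (intervalIntegral.intervalIntegrable_rpow' (a := t - a) (b := t - t)
      (r := -κ) (by linarith)).comp_sub_left t
    simpa using h
  have hpos : ∀ᵐ s ∂(volume.restrict (Ioc a t)), 0 ≤ (t - s) ^ (-κ) := by
    filter_upwards [ae_restrict_mem measurableSet_Ioc] with s hs
    exact Real.rpow_nonneg (by linarith [hs.2]) _
  rw [restrict_Ioo_eq_restrict_Ioc, ← ofReal_integral_eq_lintegral_ofReal hint.1 hpos,
    ← intervalIntegral.integral_of_le hat]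
  refine ENNReal.ofReal_le_ofReal ?_
  rw [intervalIntegral.integral_comp_sub_left (fun s => s ^ (-κ)) t, sub_self,
    integral_rpow (Or.inl (by linarith)), Real.zero_rpow (by linarith), sub_zero,
    show -κ + 1 = 1 - κ by ring]
  have h1 : 0 < 1 - κ := by linarith
  have h2 : 0 ≤ t - a := by linarith
  have h3 : t - a ≤ T := by linarith
  gcongr

/-! ### Extending paths from `[0, T]` to the real line. -/

section Clamp

/-- The nearest point of `[0, T]`. -/
def clamp (T s : ℝ) : ℝ := max 0 (min s T)

theorem clamp_mem {T : ℝ} (hT : 0 ≤ T) (s : ℝ) : clamp T s ∈ Icc 0 T :=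
  ⟨le_max_left _ _, max_le hT (min_le_right _ _)⟩

theorem clamp_of_mem {T s : ℝ} (hs : s ∈ Icc 0 T) : clamp T s = s := by
  rw [clamp, min_eq_left hs.2, max_eq_right hs.1]

theorem continuous_clamp (T : ℝ) : Continuous (clamp T) := by
  unfold clamp
  fun_prop

variable {E : Type*} [TopologicalSpace E] {f : ℝ → E} {T : ℝ}

theorem ContinuousOn.comp_clamp (hT : 0 ≤ T) (hf : ContinuousOn f (Icc 0 T)) :
    Continuous fun s => f (clamp T s) :=
  hf.comp_continuous (continuous_clamp T) (clamp_mem hT)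

theorem isDriver_comp_clamp {H : Type*} [NormedAddCommGroup H] {f : ℝ → H} (hT : 0 ≤ T)
    (hf : ContinuousOn f (Icc 0 T)) : IsDriver fun s => f (clamp T s) := by
  obtain ⟨B, hB⟩ := isCompact_Icc.exists_bound_of_continuousOn hf
  exact ⟨(hf.comp_clamp hT).stronglyMeasurable, B, fun s => hB _ (clamp_mem hT s)⟩

theorem IsDriver.add {H : Type*} [NormedAddCommGroup H] {g g' : ℝ → H} (hg : IsDriver g)
    (hg' : IsDriver g') : IsDriver fun s => g s + g' s := by
  obtain ⟨B, hB⟩ := hg.bounded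
  obtain ⟨B', hB'⟩ := hg'.bounded
  exact ⟨hg.1.add hg'.1, B + B', fun s => (norm_add_le _ _).trans (add_le_add (hB s) (hB' s))⟩

theorem stronglyMeasurable_section {Ω : Type*} [MeasurableSpace Ω] {f : ℝ → Ω → E}
    (hf : StronglyMeasurable (Function.uncurry f)) (ω : Ω) : StronglyMeasurable fun s => f s ω :=
  hf.comp_measurable measurable_prodMk_right

end Clamp

/-! ### The Galerkin residual and the driver of the scheme. -/

namespace DiagonalData

variable {ι H : Type*} [NormedAddCommGroup H] [InnerProductSpace ℝ H] {𝔄 : DiagonalData ι H}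
  {V : Type*} [NormedAddCommGroup V] [NormedSpace ℝ V]

theorem continuous_semigroup_comp {X : Type*} [TopologicalSpace X] {f : X → ℝ} {g : X → H}
    (hf : Continuous f) (hg : Continuous g) : Continuous fun x => 𝔄.semigroup (f x) (g x) :=
  Continuous.comp (g := fun q : ℝ × H => 𝔄.semigroup q.1 q.2) (f := fun x => (f x, g x))
    𝔄.continuous_semigroup_uncurry (hf.prodMk hg)

/-- The bounded operators `(-A)^r P_J (Id - P_I)` may be taken under the integral in `H`. The
resulting bound does not depend on `J` and is finite because the driver is bounded and `r + q < 1`;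
hence the part of the exact convolution outside `P_I(H)` lies in `H_r`. -/
theorem exists_residual [CompleteSpace H] {g : ℝ → H} (hg : IsDriver g) (hgc : Continuous g)
    (I : Finset ι) {r q t : ℝ} (hr : 0 ≤ r) (hq : 0 ≤ q) (hrq : r + q < 1) (ht : 0 ≤ t) :
    𝔄.proj I (∫ s in (0 : ℝ)..t, 𝔄.semigroup (t - s) (g s)) = 𝔄.conv I g t ∧
    ∃ v : 𝔄.Hsp r, v.toH = (∫ s in (0 : ℝ)..t, 𝔄.semigroup (t - s) (g s)) - 𝔄.conv I g t ∧
      ‖v‖ₑ ≤ ‖𝔄.negPow q hq ∘L (ContinuousLinearMap.id ℝ H - 𝔄.proj I)‖ₑ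
        * ∫⁻ s in Ioo 0 t, ENNReal.ofReal ((t - s) ^ (-(r + q))) * ‖g s‖ₑ := by
  set u := ∫ s in (0 : ℝ)..t, 𝔄.semigroup (t - s) (g s) with hu
  set Q := 𝔄.negPow q hq ∘L (ContinuousLinearMap.id ℝ H - 𝔄.proj I) with hQ
  have hcont : Continuous fun s => 𝔄.semigroup (t - s) (g s) :=
    continuous_semigroup_comp (by fun_prop) hgc
  have h1 : 𝔄.proj I u = 𝔄.conv I g t :=
    ((𝔄.proj I).intervalIntegral_comp_comm (hcont.intervalIntegrable 0 t)).symm.trans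
      (conv_eq_integral hg I ht).symm
  refine ⟨h1, ?_⟩
  set R := ‖Q‖ₑ * ∫⁻ s in Ioo 0 t, ENNReal.ofReal ((t - s) ^ (-(r + q))) * ‖g s‖ₑ with hR
  have hRtop : R ≠ ∞ := by
    obtain ⟨B, hB⟩ := hg.bounded
    refine ENNReal.mul_ne_top (by simp) (ne_top_of_le_ne_top (b :=
      ENNReal.ofReal (t ^ (1 - (r + q)) / (1 - (r + q))) * ENNReal.ofReal B)
      (ENNReal.mul_ne_top (by simp) (by simp)) ?_)
    refine le_trans ?_ (mul_le_mul_left (lintegral_kernel_le le_rfl ht le_rfl hrq) _)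
    rw [← lintegral_mul_const' _ _ ENNReal.ofReal_ne_top]
    refine lintegral_mono fun s => ?_
    gcongr
    rw [← ofReal_norm]
    exact ENNReal.ofReal_le_ofReal (hB s)
  have key : ∀ J, ‖𝔄.projTo J r (u - 𝔄.conv I g t)‖ ≤ R.toReal := by
    intro J
    rw [← norm_fracProj, ← toReal_enorm]
    refine ENNReal.toReal_mono hRtop ?_
    have e : 𝔄.fracProj J r (u - 𝔄.conv I g t)
        = (𝔄.fracProj J r ∘L (ContinuousLinearMap.id ℝ H - 𝔄.proj I)) u := by
      rw [← h1]; rfl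
    rw [e]
    refine (enorm_clm_intervalIntegral_le _ _ ht).trans ?_
    rw [hR, ← lintegral_const_mul' _ _ (by simp)]
    refine setLIntegral_mono' measurableSet_Ioo fun s hs => ?_
    have hts : 0 < t - s := by linarith [hs.2]
    have h2 := 𝔄.norm_projTo_sub_proj_semigroup_le I J hr hq hrq.le hts (g s)
    rw [← hQ, ← norm_fracProj] at h2
    have e2 : (𝔄.fracProj J r ∘L (ContinuousLinearMap.id ℝ H - 𝔄.proj I))
        (𝔄.semigroup (t - s) (g s)) = 𝔄.fracProj J r (𝔄.semigroup (t - s) (g s)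
          - 𝔄.proj I (𝔄.semigroup (t - s) (g s))) := rfl
    rw [e2, ← ofReal_norm, ← ofReal_norm, ← ofReal_norm (g s),
      ← ENNReal.ofReal_mul (by positivity), ← ENNReal.ofReal_mul (by positivity)]
    exact ENNReal.ofReal_le_ofReal h2
  obtain ⟨v, hv, hvR⟩ := 𝔄.exists_norm_le_of_forall_projTo ENNReal.toReal_nonneg key
  refine ⟨v, hv, ?_⟩
  rw [← ofReal_norm, ← ENNReal.ofReal_toReal hRtop]
  exact ENNReal.ofReal_le_ofReal hvR

section Scheme

variable {ρ γ : ℝ} {Ω : Type*}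

open Classical in
/-- The value of the tamed nonlinearity at the grid point `a`. -/
noncomputable def tamed (j : 𝔄.Between ρ V) (hργ : ρ ≤ γ) (hγ1 : γ ≤ 1) (F : V → H) (R : ℝ)
    (y : ℝ → Ω → 𝔄.Hsp γ) (o : ℝ → Ω → 𝔄.Hsp 1) (a : ℝ) (ω : Ω) : H :=
  if ‖y a ω‖ + ‖Hsp.incl hγ1 (o a ω)‖ ≤ R then F (j.incl hργ (y a ω)) else 0

open Classical in
/-- The piecewise constant driver of the scheme. -/
noncomputable def schemeDriver (j : 𝔄.Between ρ V) (hργ : ρ ≤ γ) (hγ1 : γ ≤ 1) (F : V → H)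
    (T h R : ℝ) (y : ℝ → Ω → 𝔄.Hsp γ) (o : ℝ → Ω → 𝔄.Hsp 1) (s : ℝ) (ω : Ω) : H :=
  if gridFloor h s ∈ Icc 0 T then tamed j hργ hγ1 F R y o (gridFloor h s) ω else 0

variable {j : 𝔄.Between ρ V} {hργ : ρ ≤ γ} {hγ1 : γ ≤ 1} {F : V → H} {T h R : ℝ}
  {y : ℝ → Ω → 𝔄.Hsp γ} {o : ℝ → Ω → 𝔄.Hsp 1}

theorem schemeDriver_of_mem (hh : 0 < h) {s : ℝ} (hs : s ∈ Icc 0 T) (ω : Ω) :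
    schemeDriver j hργ hγ1 F T h R y o s ω = tamed j hργ hγ1 F R y o (gridFloor h s) ω := by
  rw [schemeDriver, if_pos (gridFloor_mem_Icc hh hs)]

theorem norm_tamed_le (a : ℝ) (ω : Ω) :
    ‖tamed j hργ hγ1 F R y o a ω‖ ≤ ‖F (j.incl hργ (y a ω))‖ := by
  unfold tamed
  split_ifs
  · rfl
  · simp

theorem continuousWithinAt_schemeDriver (hh : 0 < h) {t : ℝ} (ht : t ∈ Ico 0 T) (ω : Ω) :
    ContinuousWithinAt (fun s => schemeDriver j hργ hγ1 F T h R y o s ω) (Ici t) t :=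
  continuousWithinAt_of_gridFloor hh (k := fun a => tamed j hργ hγ1 F R y o a ω)
    (fun _ hs => schemeDriver_of_mem hh hs ω) ht

/-- The process `y` has no path regularity, but the driver factors through `ℤ × Ω`. As `ℤ` is
countable, measurability in `ω` at each grid point suffices. -/
theorem stronglyMeasurable_schemeDriver [MeasurableSpace Ω] [TopologicalSpace.SeparableSpace H]
    (hF : Continuous F) (hy : ∀ t ∈ Icc 0 T, Measurable (y t))
    (ho : ∀ t ∈ Icc 0 T, Measurable (o t)) :
    StronglyMeasurable (Function.uncurry (schemeDriver j hργ hγ1 F T h R y o)) := by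
  classical
  borelize H
  have : SecondCountableTopology H := UniformSpace.secondCountable_of_separable H
  have hk : ∀ k : ℤ, Measurable fun ω =>
      if h * (k : ℝ) ∈ Icc 0 T then tamed j hργ hγ1 F R y o (h * k) ω else 0 := by
    intro k
    by_cases hkT : h * (k : ℝ) ∈ Icc 0 T
    · simp only [hkT, if_true]
      unfold tamed
      refine Measurable.ite ?_ ?_ measurable_const
      · refine measurableSet_le ?_ measurable_const
        have h1 := (hy _ hkT).norm
        have h2 : Measurable fun ω => ‖Hsp.incl hγ1 (o (h * k) ω)‖ :=
          (Hsp.continuous_incl 𝔄 hγ1).norm.measurable.comp (ho _ hkT)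
        exact h1.add h2
      · exact (hF.comp (j.continuous_incl hργ)).measurable.comp (hy _ hkT)
    · simp only [hkT, if_false]
      exact measurable_const
  have hm : Measurable (fun x : ℤ × Ω =>
      if h * (x.1 : ℝ) ∈ Icc 0 T then tamed j hργ hγ1 F R y o (h * x.1) x.2 else 0) :=
    measurable_from_prod_countable_right hk
  have hfl : Measurable fun x : ℝ × Ω => ((⌊x.1 / h⌋, x.2) : ℤ × Ω) := by fun_prop
  exact (hm.comp hfl).stronglyMeasurable

theorem isDriver_schemeDriver [MeasurableSpace Ω] [TopologicalSpace.SeparableSpace H]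
    (hF : Continuous F) (hh : 0 < h) (hy : ∀ t ∈ Icc 0 T, Measurable (y t))
    (ho : ∀ t ∈ Icc 0 T, Measurable (o t)) (ω : Ω) :
    IsDriver fun s => schemeDriver j hργ hγ1 F T h R y o s ω := by
  classical
  refine ⟨stronglyMeasurable_section (stronglyMeasurable_schemeDriver hF hy ho) ω, ?_⟩
  obtain ⟨f, hf⟩ : ∃ f : ℝ → H, ∀ a, f a = tamed j hργ hγ1 F R y o a ω := ⟨_, fun _ => rfl⟩
  simp only [schemeDriver, ← hf]
  -- Only finitely many grid points lie in `[0, T]`, so the sum of all norms there is a bound.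
  refine ⟨∑ k ∈ Finset.Icc 0 ⌊T / h⌋, ‖f (h * (k : ℝ))‖, fun s => ?_⟩
  split_ifs with hs
  · rw [gridFloor] at hs ⊢
    have hmem : ⌊s / h⌋ ∈ Finset.Icc 0 ⌊T / h⌋ := by
      have := (mul_nonneg_iff_of_pos_left hh).1 hs.1
      refine Finset.mem_Icc.2 ⟨by exact_mod_cast this, ?_⟩
      rw [Int.le_floor, le_div_iff₀ hh]
      linarith [hs.2]
    exact Finset.single_le_sum (f := fun k : ℤ => ‖f (h * (k : ℝ))‖)
      (fun _ _ => norm_nonneg _) hmem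
  · rw [norm_zero]
    positivity

/-- The identity holds almost surely at each fixed time. There are countably many grid points, so
one null set serves all of them, as the pathwise energy estimate requires. -/
theorem ae_grid_eq [MeasurableSpace Ω] {P : Measure Ω} (hh : 0 < h) {z : ℝ → Ω → H}
    (hY : ∀ t ∈ Icc 0 T, ∀ᵐ ω ∂P, (y t ω).toH = z t ω + (o t ω).toH) :
    ∀ᵐ ω ∂P, ∀ s ∈ Icc 0 T,
      (y (gridFloor h s) ω).toH = z (gridFloor h s) ω + (o (gridFloor h s) ω).toH := by
  have : ∀ᵐ ω ∂P, ∀ k : ℤ, h * (k : ℝ) ∈ Icc 0 T →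
      (y (h * k) ω).toH = z (h * k) ω + (o (h * k) ω).toH := by
    rw [ae_all_iff]
    intro k
    by_cases hk : h * (k : ℝ) ∈ Icc 0 T
    · filter_upwards [hY _ hk] with ω hω _ using hω
    · exact Eventually.of_forall fun ω h' => absurd h' hk
  filter_upwards [this] with ω hω s hs
  exact hω ⌊s / h⌋ (gridFloor_mem_Icc hh hs)

theorem integral_tamed_eq_conv [MeasurableSpace Ω] [TopologicalSpace.SeparableSpace H]
    [CompleteSpace H] (hF : Continuous F) (hh : 0 < h) (hy : ∀ t ∈ Icc 0 T, Measurable (y t))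
    (ho : ∀ t ∈ Icc 0 T, Measurable (o t)) (I : Finset ι) {t : ℝ} (ht : t ∈ Icc 0 T) (ω : Ω) :
    ∫ s in (0 : ℝ)..t, 𝔄.proj I (𝔄.semigroup (t - s)
        (tamed j hργ hγ1 F R y o (gridFloor h s) ω))
      = 𝔄.conv I (fun s => schemeDriver j hργ hγ1 F T h R y o s ω) t := by
  rw [conv_eq_integral (isDriver_schemeDriver hF hh hy ho ω) I ht.1]
  refine intervalIntegral.integral_congr fun s hs => ?_
  rw [uIcc_of_le ht.1] at hs
  simp only [schemeDriver_of_mem hh ⟨hs.1, hs.2.trans ht.2⟩ ω]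

end Scheme

end DiagonalData

theorem enorm_rpow_eq {E : Type*} [NormedAddCommGroup E] (x : E) {r : ℝ} (hr : 0 ≤ r) :
    ‖x‖ₑ ^ r = ENNReal.ofReal (‖x‖ ^ r) := by
  rw [← ofReal_norm, ENNReal.ofReal_rpow_of_nonneg (norm_nonneg _) hr]

/-! ### Moments of the nonlinearity along a process. -/

section Nemytskii

variable {Ω : Type*} [MeasurableSpace Ω] {P : Measure Ω} [IsProbabilityMeasure P]
  {V H : Type*} [NormedAddCommGroup V] [NormedAddCommGroup H] [MeasurableSpace V] [BorelSpace V]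
  {F : V → H}

theorem lpN_growth_le {K a q : ℝ} (hK : 0 ≤ K) (ha : 0 < a) (hq : 1 ≤ q)
    (hF : ∀ v, ‖F v‖ ≤ K * (1 + ‖v‖ ^ (1 + a))) {U : Ω → V} (hU : Measurable U) :
    lpN P q (fun ω => ‖F (U ω)‖ₑ)
      ≤ ENNReal.ofReal K * (1 + lpN P (q * (1 + a)) (fun ω => ‖U ω‖ₑ) ^ (1 + a)) := by
  have hq0 : 0 < q := by linarith
  have ha0 : 0 < 1 + a := by linarith
  have h1 : ∀ ω, ‖F (U ω)‖ₑ ≤ ENNReal.ofReal K * (1 + ‖U ω‖ₑ ^ (1 + a)) := by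
    intro ω
    rw [enorm_rpow_eq _ ha0.le, ← ENNReal.ofReal_one, ← ENNReal.ofReal_add zero_le_one
      (by positivity), ← ENNReal.ofReal_mul hK, ← ofReal_norm]
    exact ENNReal.ofReal_le_ofReal (hF _)
  refine (lpN_mono hq0.le h1).trans ?_
  rw [lpN_const_mul hq0 ENNReal.ofReal_ne_top]
  gcongr
  refine (lpN_add_le hq measurable_const (hU.enorm.pow_const _)).trans ?_
  rw [lpN_const hq0, lpN_rpow hq0 ha0]

/-- Cauchy–Schwarz separates the increment from the growth factor. This is why errors in `V` are
measured in `L^{2p}`, and why moments of order `2 q a` enter. -/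
theorem lpN_polyLipschitz_le [SecondCountableTopology V] {L a q : ℝ} (hL : 0 ≤ L) (ha : 0 < a)
    (hq : 1 ≤ q) (hF : PolyLipschitz F L a) {U W : Ω → V} (hU : Measurable U)
    (hW : Measurable W) :
    lpN P q (fun ω => ‖F (U ω) - F (W ω)‖ₑ)
      ≤ ENNReal.ofReal L * (lpN P (2 * q) (fun ω => ‖U ω - W ω‖ₑ)
        * (1 + lpN P (2 * q * a) (fun ω => ‖U ω‖ₑ) ^ a
          + lpN P (2 * q * a) (fun ω => ‖W ω‖ₑ) ^ a)) := by
  have hq0 : 0 < q := by linarith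
  have h1 : ∀ ω, ‖F (U ω) - F (W ω)‖ₑ
      ≤ ENNReal.ofReal L * (‖U ω - W ω‖ₑ * (1 + ‖U ω‖ₑ ^ a + ‖W ω‖ₑ ^ a)) := by
    intro ω
    rw [enorm_rpow_eq _ ha.le, enorm_rpow_eq _ ha.le, ← ENNReal.ofReal_one,
      ← ENNReal.ofReal_add zero_le_one (by positivity), ← ENNReal.ofReal_add (by positivity)
      (by positivity), ← ofReal_norm, ← ofReal_norm, ← ENNReal.ofReal_mul (by positivity),
      ← ENNReal.ofReal_mul hL, ← mul_assoc]
    exact ENNReal.ofReal_le_ofReal (hF _ _)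
  have hmU : Measurable fun ω => ‖U ω‖ₑ ^ a := hU.enorm.pow_const _
  have hmW : Measurable fun ω => ‖W ω‖ₑ ^ a := hW.enorm.pow_const _
  have hm1 : Measurable fun ω => 1 + ‖U ω‖ₑ ^ a := measurable_const.add hmU
  refine (lpN_mono hq0.le h1).trans ?_
  rw [lpN_const_mul hq0 ENNReal.ofReal_ne_top]
  gcongr
  refine (lpN_mul_le hq0 (hU.sub hW).enorm (hm1.add hmW)).trans (mul_le_mul' le_rfl ?_)
  refine (lpN_add_le (by linarith) hm1 hmW).trans ?_
  rw [lpN_rpow (by linarith) ha]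
  gcongr
  refine (lpN_add_le (by linarith) measurable_const hmU).trans ?_
  rw [lpN_const (by linarith), lpN_rpow (by linarith) ha]

end Nemytskii

/-! ### Time convolutions in `L^q(Ω)`. -/

section Kernel

variable {Ω : Type*} [MeasurableSpace Ω] {P : Measure Ω} [IsProbabilityMeasure P]
  {H : Type*} [NormedAddCommGroup H] {g : ℝ → Ω → H}

theorem measurable_kernel (t κ : ℝ) : Measurable fun s => ENNReal.ofReal ((t - s) ^ (-κ)) := by
  fun_prop

theorem measurable_lintegral_kernel (hg : StronglyMeasurable (Function.uncurry g)) (a b t κ : ℝ) :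
    Measurable fun ω => ∫⁻ s in Ioo a b, ENNReal.ofReal ((t - s) ^ (-κ)) * ‖g s ω‖ₑ := by
  refine Measurable.lintegral_prod_left'
    (f := fun x : ℝ × Ω => ENNReal.ofReal ((t - x.1) ^ (-κ)) * ‖g x.1 x.2‖ₑ) ?_
  exact ((measurable_kernel t κ).comp measurable_fst).mul hg.enorm

theorem lpN_lintegral_kernel_le (hg : StronglyMeasurable (Function.uncurry g)) {q a t T κ : ℝ}
    (hq : 1 ≤ q) (ha : 0 ≤ a) (hat : a ≤ t) (ht : t ≤ T) (hκ : κ < 1) {B : ℝ≥0∞}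
    (hB : ∀ s ∈ Icc 0 T, lpN P q (fun ω => ‖g s ω‖ₑ) ≤ B) :
    lpN P q (fun ω => ∫⁻ s in Ioo a t, ENNReal.ofReal ((t - s) ^ (-κ)) * ‖g s ω‖ₑ)
      ≤ ENNReal.ofReal (T ^ (1 - κ) / (1 - κ)) * B :=
  lpN_lintegral_mul_le (f := fun s ω => ‖g s ω‖ₑ) (measurable_kernel t κ) hq hg.enorm
    measurableSet_Ioo (fun s hs => hB s ⟨ha.trans hs.1.le, hs.2.le.trans ht⟩)
    (lintegral_kernel_le ha hat ht hκ)

/-- An `L²`-in-time pathwise bound yields a bound of the `L^q(Ω)` norm, `q ≥ 2`. -/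
theorem lpN_le_of_norm_sq_le_integral {E : Ω → H} {d : ℝ → Ω → H}
    (hd : StronglyMeasurable (Function.uncurry d)) (hdd : ∀ ω, IsDriver fun s => d s ω)
    {C q t T : ℝ} (hC : 0 ≤ C) (hq : 2 ≤ q) (ht : t ∈ Icc 0 T)
    (hE : ∀ ω, ‖E ω‖ ^ 2 ≤ C * ∫ s in (0 : ℝ)..t, ‖d s ω‖ ^ 2) {B : ℝ≥0∞}
    (hB : ∀ s ∈ Icc 0 T, lpN P q (fun ω => ‖d s ω‖ₑ) ≤ B) :
    lpN P q (fun ω => ‖E ω‖ₑ) ≤ (ENNReal.ofReal C * ENNReal.ofReal T) ^ (1 / 2 : ℝ) * B := by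
  have hq0 : 0 < q / 2 := by linarith
  -- Minkowski is applied to the squares in `L^{q/2}`, which needs `q ≥ 2`; the factor `1` is the
  -- trivial kernel of `lpN_lintegral_mul_le`.
  have h1 : ∀ ω, ‖E ω‖ₑ ^ (2 : ℝ)
      ≤ ENNReal.ofReal C * ∫⁻ s in Ioo 0 t, 1 * ‖d s ω‖ₑ ^ (2 : ℝ) := by
    intro ω
    have hint : IntervalIntegrable (fun s => ‖d s ω‖ ^ 2) volume 0 t :=
      (hdd ω).norm_sq.intervalIntegrable 0 t
    have h2 := hE ω
    rw [intervalIntegral.integral_of_le ht.1] at h2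
    simp only [one_mul]
    rw [restrict_Ioo_eq_restrict_Ioc]
    have h3 : ∫⁻ s in Ioc 0 t, ‖d s ω‖ₑ ^ (2 : ℝ)
        = ENNReal.ofReal (∫ s in Ioc 0 t, ‖d s ω‖ ^ 2) := by
      rw [ofReal_integral_eq_lintegral_ofReal hint.1
        (Eventually.of_forall fun s => by positivity)]
      refine lintegral_congr fun s => ?_
      rw [enorm_rpow_eq _ zero_le_two, Real.rpow_two]
    rw [h3, ← ENNReal.ofReal_mul hC, enorm_rpow_eq _ zero_le_two, Real.rpow_two]
    exact ENNReal.ofReal_le_ofReal h2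
  have hB2 : ∀ s ∈ Ioo 0 t, lpN P (q / 2) (fun ω => ‖d s ω‖ₑ ^ (2 : ℝ)) ≤ B ^ (2 : ℝ) := by
    intro s hs
    rw [lpN_rpow hq0 two_pos, div_mul_cancel₀ _ two_ne_zero]
    exact ENNReal.rpow_le_rpow (hB s ⟨hs.1.le, hs.2.le.trans ht.2⟩) zero_le_two
  have h4 : lpN P (q / 2) (fun ω => ‖E ω‖ₑ ^ (2 : ℝ))
      ≤ ENNReal.ofReal C * (ENNReal.ofReal T * B ^ (2 : ℝ)) := by
    refine (lpN_mono hq0.le h1).trans ?_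
    rw [lpN_const_mul hq0 ENNReal.ofReal_ne_top]
    gcongr
    refine lpN_lintegral_mul_le (f := fun s ω => ‖d s ω‖ₑ ^ (2 : ℝ)) measurable_const
      (by linarith) (hd.enorm.pow_const _) measurableSet_Ioo hB2 ?_
    rw [lintegral_const, one_mul, Measure.restrict_apply MeasurableSet.univ, univ_inter,
      Real.volume_Ioo, sub_zero]
    exact ENNReal.ofReal_le_ofReal ht.2
  rw [lpN_rpow hq0 two_pos, div_mul_cancel₀ _ two_ne_zero, ← mul_assoc] at h4
  have h5 := ENNReal.rpow_le_rpow h4 (z := 1 / 2) (by norm_num)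
  rw [← ENNReal.rpow_mul, ENNReal.mul_rpow_of_nonneg _ _ (by norm_num), ← ENNReal.rpow_mul] at h5
  norm_num at h5 ⊢
  exact h5

end Kernel

namespace DiagonalData

variable {ι H : Type*} [NormedAddCommGroup H] [InnerProductSpace ℝ H] [CompleteSpace H]
  {𝔄 : DiagonalData ι H} {Ω : Type*} [MeasurableSpace Ω] {P : Measure Ω}
  [IsProbabilityMeasure P] {g : ℝ → Ω → H}

theorem lpN_projTo_conv_le (hg : StronglyMeasurable (Function.uncurry g))
    (hgd : ∀ ω, IsDriver fun s => g s ω) (I : Finset ι) {q r t T : ℝ} (hq : 1 ≤ q) (hr : 0 ≤ r)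
    (hr1 : r < 1) (ht : t ∈ Icc 0 T) {B : ℝ≥0∞}
    (hB : ∀ s ∈ Icc 0 T, lpN P q (fun ω => ‖g s ω‖ₑ) ≤ B) :
    lpN P q (fun ω => ‖𝔄.projTo I r (𝔄.conv I (fun s => g s ω) t)‖ₑ)
      ≤ ENNReal.ofReal (T ^ (1 - r) / (1 - r)) * B :=
  (lpN_mono (by linarith) fun ω => enorm_projTo_conv_le (hgd ω) I hr hr1.le ht.1).trans
    (lpN_lintegral_kernel_le hg hq le_rfl ht.1 ht.2 hr1 hB)

theorem lpN_projTo_conv_sub_le (hg : StronglyMeasurable (Function.uncurry g))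
    (hgd : ∀ ω, IsDriver fun s => g s ω) (I : Finset ι) {q r e a t h T : ℝ} (hq : 1 ≤ q)
    (hr : 0 ≤ r) (he : 0 ≤ e) (hre : r + e < 1) (ha : 0 ≤ a) (hat : a ≤ t) (ht : t ≤ T)
    (hh : t - a ≤ h) {B : ℝ≥0∞} (hB : ∀ s ∈ Icc 0 T, lpN P q (fun ω => ‖g s ω‖ₑ) ≤ B) :
    lpN P q (fun ω => ‖𝔄.projTo I r
        (𝔄.conv I (fun s => g s ω) t - 𝔄.conv I (fun s => g s ω) a)‖ₑ)
      ≤ ENNReal.ofReal (h ^ e)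
        * (2 * (ENNReal.ofReal (T ^ (1 - (r + e)) / (1 - (r + e))) * B)) := by
  have hq0 : 0 < q := by linarith
  refine (lpN_mono hq0.le fun ω =>
    enorm_projTo_conv_sub_le (hgd ω) I hr he hre.le ha hat hh).trans ?_
  rw [lpN_const_mul hq0 ENNReal.ofReal_ne_top, two_mul]
  gcongr
  refine (lpN_add_le hq (measurable_lintegral_kernel hg _ _ _ _)
    (measurable_lintegral_kernel hg _ _ _ _)).trans (add_le_add ?_ ?_)
  · exact lpN_lintegral_kernel_le hg hq le_rfl ha (hat.trans ht) hre hB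
  · exact lpN_lintegral_kernel_le hg hq ha hat ht hre hB

end DiagonalData

theorem stronglyMeasurable_uncurry_clamp {Ω E : Type*} [MeasurableSpace Ω] [TopologicalSpace E]
    [TopologicalSpace.PseudoMetrizableSpace E] {T : ℝ} (hT : 0 ≤ T) {f : ℝ → Ω → E}
    (hf : ∀ t ∈ Icc 0 T, StronglyMeasurable (f t))
    (hfc : ∀ ω, ContinuousOn (fun t => f t ω) (Icc 0 T)) :
    StronglyMeasurable (Function.uncurry fun s ω => f (clamp T s) ω) :=
  stronglyMeasurable_uncurry_of_continuous_of_stronglyMeasurable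
    (fun ω => (hfc ω).comp_clamp hT) fun s => hf _ (clamp_mem hT s)

theorem enorm_clm_le {E E' : Type*} [NormedAddCommGroup E] [NormedSpace ℝ E]
    [NormedAddCommGroup E'] [NormedSpace ℝ E'] (L : E →L[ℝ] E') (x : E) :
    ‖L x‖ₑ ≤ ‖L‖ₑ * ‖x‖ₑ := L.le_opENorm x

theorem stronglyMeasurable_drift {Ω V H : Type*} [MeasurableSpace Ω] [NormedAddCommGroup V]
    [MeasurableSpace V] [BorelSpace V] [SecondCountableTopology V] [NormedAddCommGroup H] {F : V → H}
    {X : ℝ → Ω → V} {T : ℝ} (hT : 0 ≤ T) (hF : Continuous F)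
    (hX : ∀ t ∈ Icc 0 T, Measurable (X t)) (hXc : ∀ ω, ContinuousOn (fun t => X t ω) (Icc 0 T)) :
    StronglyMeasurable (Function.uncurry fun s ω => F (X (clamp T s) ω)) :=
  stronglyMeasurable_uncurry_clamp (f := fun t ω => F (X t ω)) hT
    (fun t ht => hF.comp_stronglyMeasurable (hX t ht).stronglyMeasurable)
    fun ω => hF.comp_continuousOn (hXc ω)

theorem isDriver_drift {Ω V H : Type*} [NormedAddCommGroup V] [NormedAddCommGroup H] {F : V → H}
    {X : ℝ → Ω → V} {T : ℝ} (hT : 0 ≤ T) (hF : Continuous F)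
    (hXc : ∀ ω, ContinuousOn (fun t => X t ω) (Icc 0 T)) (ω : Ω) :
    IsDriver fun s => F (X (clamp T s) ω) :=
  isDriver_comp_clamp (f := fun t => F (X t ω)) hT (hF.comp_continuousOn (hXc ω))

/-! ### The components of the strong error. -/

namespace DiagonalData

variable {ι H : Type*} [NormedAddCommGroup H] [InnerProductSpace ℝ H]
  {𝔄 : DiagonalData ι H} {Ω : Type*} [MeasurableSpace Ω] {P : Measure Ω}
  {V : Type*} [NormedAddCommGroup V] [NormedSpace ℝ V]
  {ρ γ : ℝ} {j : 𝔄.Between ρ V} {F : V → H} {T : ℝ}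

theorem enorm_between_proj_le (j : 𝔄.Between ρ V) (I : Finset ι) (u : H) :
    ‖j.proj I u‖ₑ ≤ ‖j.ofHsp‖ₑ * ‖𝔄.projTo I ρ u‖ₑ := enorm_clm_le j.ofHsp _

/-- Distance in `V` between the exact solution and `∫ P_I e^{(t-s)A} F(X_s) ds + 𝒪`. -/
theorem lpN_sub_galerkin_le [CompleteSpace H] [IsProbabilityMeasure P] [MeasurableSpace V]
    [BorelSpace V] [SecondCountableTopology V] {X O : ℝ → Ω → V}
    {o : ℝ → Ω → 𝔄.Hsp 1} (hT : 0 ≤ T) (hF : Continuous F) (hρ1 : ρ ≤ 1)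
    (hX : ∀ t ∈ Icc 0 T, Measurable (X t)) (hXc : ∀ ω, ContinuousOn (fun t => X t ω) (Icc 0 T))
    {t : ℝ} (ht : t ∈ Icc 0 T) (hO : Measurable (O t)) (ho : Measurable (o t))
    (hX_eq : ∀ᵐ ω ∂P, j.toH (X t ω)
      = (∫ s in (0 : ℝ)..t, 𝔄.semigroup (t - s) (F (X s ω))) + j.toH (O t ω))
    (I : Finset ι) {q r : ℝ} (hq : 1 ≤ q) (hρ : 0 ≤ ρ) (hr : 0 ≤ r) (hρr : ρ + r < 1) {B : ℝ≥0∞}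
    (hB : ∀ s ∈ Icc 0 T, lpN P q (fun ω => ‖F (X s ω)‖ₑ) ≤ B) :
    lpN P q (fun ω => ‖X t ω - (j.proj I (𝔄.conv I (fun s => F (X (clamp T s) ω)) t)
        + j.incl hρ1 (o t ω))‖ₑ)
      ≤ ‖j.ofHsp‖ₑ * (‖𝔄.negPow r hr ∘L (ContinuousLinearMap.id ℝ H - 𝔄.proj I)‖ₑ
          * (ENNReal.ofReal (T ^ (1 - (ρ + r)) / (1 - (ρ + r))) * B))
        + (lpN P q (fun ω => ‖O t ω - j.incl hρ1 (𝔄.projTo I 1 (j.toH (O t ω)))‖ₑ)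
          + lpN P q (fun ω => ‖j.incl hρ1 (𝔄.projTo I 1 (j.toH (O t ω)) - o t ω)‖ₑ)) := by
  set Q := 𝔄.negPow r hr ∘L (ContinuousLinearMap.id ℝ H - 𝔄.proj I)
  have hq0 : 0 < q := by linarith
  have hgm := stronglyMeasurable_drift (F := F) hT hF hX hXc
  have hcont : Continuous fun v : V => ‖v - j.proj I (j.toH v)‖ₑ := by fun_prop
  have hm1 : Measurable fun ω => ‖O t ω - j.incl hρ1 (𝔄.projTo I 1 (j.toH (O t ω)))‖ₑ := by
    simp_rw [j.incl_projTo]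
    exact hcont.measurable.comp hO
  have hm2 : Measurable fun ω => ‖j.incl hρ1 (𝔄.projTo I 1 (j.toH (O t ω)) - o t ω)‖ₑ := by
    simp_rw [map_sub, j.incl_projTo]
    have h1 : Measurable fun ω => j.proj I (j.toH (O t ω)) :=
      ((j.proj I).continuous.comp j.toH.continuous).measurable.comp hO
    have h2 : Measurable fun ω => j.incl hρ1 (o t ω) :=
      (j.continuous_incl hρ1).measurable.comp ho
    exact (h1.sub h2).enorm
  have hm0 := measurable_lintegral_kernel hgm 0 t t (ρ + r)
  have hpt : ∀ᵐ ω ∂P, ‖X t ω - (j.proj I (𝔄.conv I (fun s => F (X (clamp T s) ω)) t)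
        + j.incl hρ1 (o t ω))‖ₑ
      ≤ ‖j.ofHsp‖ₑ * (‖Q‖ₑ * ∫⁻ s in Ioo 0 t, ENNReal.ofReal ((t - s) ^ (-(ρ + r)))
          * ‖F (X (clamp T s) ω)‖ₑ)
        + (‖O t ω - j.incl hρ1 (𝔄.projTo I 1 (j.toH (O t ω)))‖ₑ
          + ‖j.incl hρ1 (𝔄.projTo I 1 (j.toH (O t ω)) - o t ω)‖ₑ) := by
    filter_upwards [hX_eq] with ω hω
    have hd := isDriver_drift (F := F) hT hF hXc ω
    obtain ⟨h1, v, hv, hvn⟩ := exists_residual (𝔄 := 𝔄) hd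
      (hF.comp ((hXc ω).comp_clamp hT)) I hρ hr hρr ht.1
    have hint : ∫ s in (0 : ℝ)..t, 𝔄.semigroup (t - s) (F (X s ω))
        = ∫ s in (0 : ℝ)..t, 𝔄.semigroup (t - s) (F (X (clamp T s) ω)) := by
      refine intervalIntegral.integral_congr fun s hs => ?_
      rw [uIcc_of_le ht.1] at hs
      simp only [clamp_of_mem ⟨hs.1, hs.2.trans ht.2⟩]
    -- The three terms are the Galerkin residual, the part of `O` outside `P_I(H)`, and the
    -- discretization error of the projected noise. The identity is checked in `H` and holds in `V`
    -- by injectivity.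
    have e : X t ω - (j.proj I (𝔄.conv I (fun s => F (X (clamp T s) ω)) t)
        + j.incl hρ1 (o t ω)) = j.ofHsp v
        + ((O t ω - j.incl hρ1 (𝔄.projTo I 1 (j.toH (O t ω))))
          + j.incl hρ1 (𝔄.projTo I 1 (j.toH (O t ω)) - o t ω)) := by
      apply j.toH_injective
      simp only [map_add, map_sub, j.toH_incl, j.toH_ofHsp, j.toH_proj, toH_projTo, proj_conv]
      rw [hω, hv, hint]
      abel
    rw [e]
    refine (enorm_add_le _ _).trans (add_le_add ?_ (enorm_add_le _ _))
    exact (enorm_clm_le _ _).trans (by gcongr)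
  refine (lpN_mono_ae hq0.le hpt).trans ?_
  refine (lpN_add_le hq ((hm0.const_mul _).const_mul _) (hm1.add hm2)).trans
    (add_le_add ?_ (lpN_add_le hq hm1 hm2))
  rw [lpN_const_mul hq0 (by simp), lpN_const_mul hq0 (by simp)]
  gcongr
  refine lpN_lintegral_kernel_le hgm hq le_rfl ht.1 ht.2 hρr fun s hs => ?_
  simp only [clamp_of_mem hs]
  exact hB s hs

theorem lpN_proj_conv_add_le [CompleteSpace H] [IsProbabilityMeasure P] [MeasurableSpace V]
    [BorelSpace V] {g : ℝ → Ω → H} {o : ℝ → Ω → 𝔄.Hsp 1} (hρ1 : ρ ≤ 1)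
    (hg : StronglyMeasurable (Function.uncurry g)) (hgd : ∀ ω, IsDriver fun s => g s ω)
    (I : Finset ι) {q t : ℝ} (hq : 1 ≤ q) (hρ : 0 ≤ ρ) (hρ' : ρ < 1) (ht : t ∈ Icc 0 T)
    (ho : Measurable (o t)) {B : ℝ≥0∞}
    (hB : ∀ s ∈ Icc 0 T, lpN P q (fun ω => ‖g s ω‖ₑ) ≤ B) :
    lpN P q (fun ω => ‖j.proj I (𝔄.conv I (fun s => g s ω) t) + j.incl hρ1 (o t ω)‖ₑ)
      ≤ ‖j.ofHsp‖ₑ * (ENNReal.ofReal (T ^ (1 - ρ) / (1 - ρ)) * B)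
        + lpN P q (fun ω => ‖j.incl hρ1 (o t ω)‖ₑ) := by
  have hq0 : 0 < q := by linarith
  have h1 : Measurable fun ω => j.incl hρ1 (o t ω) := (j.continuous_incl hρ1).measurable.comp ho
  have h2 : Measurable fun ω => ‖𝔄.projTo I ρ (𝔄.conv I (fun s => g s ω) t)‖ₑ :=
    ((𝔄.projToL I ρ).continuous.comp_stronglyMeasurable (stronglyMeasurable_conv hg I ht.1)).enorm
  refine (lpN_mono hq0.le fun ω => (enorm_add_le _ _).trans
    (add_le_add (enorm_between_proj_le j I _) le_rfl)).trans ?_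
  refine (lpN_add_le hq (h2.const_mul _) h1.enorm).trans ?_
  rw [lpN_const_mul hq0 (by simp)]
  gcongr
  exact lpN_projTo_conv_le hg hgd I hq hρ hρ' ht hB

/-- Increments of the scheme in `V` over one step. -/
theorem lpN_scheme_increment_le [CompleteSpace H] [IsProbabilityMeasure P] [MeasurableSpace V]
    [BorelSpace V] [SecondCountableTopology V] {g : ℝ → Ω → H} {o : ℝ → Ω → 𝔄.Hsp 1} {O : ℝ → Ω → V}
    (hρ1 : ρ ≤ 1) (hg : StronglyMeasurable (Function.uncurry g))
    (hgd : ∀ ω, IsDriver fun s => g s ω) (I : Finset ι) {q r a t h : ℝ} (hq : 1 ≤ q) (hρ : 0 ≤ ρ)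
    (hr : 0 ≤ r) (hρr : ρ + r < 1) (ha : 0 ≤ a) (hat : a ≤ t) (ht : t ≤ T) (hh : t - a ≤ h)
    (hoa : Measurable (o a)) (hot : Measurable (o t)) (hOa : Measurable (O a))
    (hOt : Measurable (O t)) {B : ℝ≥0∞} (hB : ∀ s ∈ Icc 0 T, lpN P q (fun ω => ‖g s ω‖ₑ) ≤ B) :
    lpN P q (fun ω => ‖(j.proj I (𝔄.conv I (fun s => g s ω) t) + j.incl hρ1 (o t ω))
        - (j.proj I (𝔄.conv I (fun s => g s ω) a) + j.incl hρ1 (o a ω))‖ₑ)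
      ≤ ‖j.ofHsp‖ₑ * (ENNReal.ofReal (h ^ r)
          * (2 * (ENNReal.ofReal (T ^ (1 - (ρ + r)) / (1 - (ρ + r))) * B)))
        + (lpN P q (fun ω => ‖j.incl hρ1 (𝔄.projTo I 1 (j.toH (O t ω - O a ω)))‖ₑ)
          + (lpN P q (fun ω => ‖j.incl hρ1 (𝔄.projTo I 1 (j.toH (O t ω)) - o t ω)‖ₑ)
            + lpN P q (fun ω => ‖j.incl hρ1 (𝔄.projTo I 1 (j.toH (O a ω)) - o a ω)‖ₑ))) := by
  have hq0 : 0 < q := by linarith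
  have hPO : ∀ s, Measurable (O s) → Measurable fun ω => j.proj I (j.toH (O s ω)) := fun s hs =>
    ((j.proj I).continuous.comp j.toH.continuous).measurable.comp hs
  have hmo : ∀ s, Measurable (o s) → Measurable fun ω => j.incl hρ1 (o s ω) := fun s hs =>
    (j.continuous_incl hρ1).measurable.comp hs
  have h1 : Measurable fun ω => ‖𝔄.projTo I ρ
      (𝔄.conv I (fun s => g s ω) t - 𝔄.conv I (fun s => g s ω) a)‖ₑ :=
    ((𝔄.projToL I ρ).continuous.comp_stronglyMeasurable
      ((stronglyMeasurable_conv hg I (ha.trans hat)).sub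
        (stronglyMeasurable_conv hg I ha))).enorm
  have h2 : Measurable fun ω => ‖j.incl hρ1 (𝔄.projTo I 1 (j.toH (O t ω - O a ω)))‖ₑ := by
    simp_rw [map_sub, j.incl_projTo]
    exact ((hPO t hOt).sub (hPO a hOa)).enorm
  have h3 : ∀ s, Measurable (o s) → Measurable (O s) →
      Measurable fun ω => ‖j.incl hρ1 (𝔄.projTo I 1 (j.toH (O s ω)) - o s ω)‖ₑ := by
    intro s hs hs'
    simp_rw [map_sub, j.incl_projTo]
    exact ((hPO s hs').sub (hmo s hs)).enorm
  have hpt : ∀ ω, ‖(j.proj I (𝔄.conv I (fun s => g s ω) t) + j.incl hρ1 (o t ω))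
        - (j.proj I (𝔄.conv I (fun s => g s ω) a) + j.incl hρ1 (o a ω))‖ₑ
      ≤ ‖j.ofHsp‖ₑ * ‖𝔄.projTo I ρ
          (𝔄.conv I (fun s => g s ω) t - 𝔄.conv I (fun s => g s ω) a)‖ₑ
        + (‖j.incl hρ1 (𝔄.projTo I 1 (j.toH (O t ω - O a ω)))‖ₑ
          + (‖j.incl hρ1 (𝔄.projTo I 1 (j.toH (O t ω)) - o t ω)‖ₑ
            + ‖j.incl hρ1 (𝔄.projTo I 1 (j.toH (O a ω)) - o a ω)‖ₑ)) := by
    intro ω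
    -- The noise increment is routed through `P_I O`: an increment of `P_I O` plus the approximation
    -- errors at both ends.
    have e : (j.proj I (𝔄.conv I (fun s => g s ω) t) + j.incl hρ1 (o t ω))
        - (j.proj I (𝔄.conv I (fun s => g s ω) a) + j.incl hρ1 (o a ω))
        = j.proj I (𝔄.conv I (fun s => g s ω) t - 𝔄.conv I (fun s => g s ω) a)
          + (j.incl hρ1 (𝔄.projTo I 1 (j.toH (O t ω - O a ω)))
          + (-j.incl hρ1 (𝔄.projTo I 1 (j.toH (O t ω)) - o t ω)
            + j.incl hρ1 (𝔄.projTo I 1 (j.toH (O a ω)) - o a ω))) := by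
      simp only [map_sub]
      abel
    rw [e, ← enorm_neg (j.incl hρ1 (𝔄.projTo I 1 (j.toH (O t ω)) - o t ω))]
    refine (enorm_add_le _ _).trans (add_le_add (enorm_between_proj_le j I _) ?_)
    exact (enorm_add_le _ _).trans (add_le_add le_rfl (enorm_add_le _ _))
  refine (lpN_mono hq0.le hpt).trans ?_
  have h23 := (h3 t hot hOt).add (h3 a hoa hOa)
  refine (lpN_add_le hq (h1.const_mul _) (h2.add h23)).trans (add_le_add ?_
    ((lpN_add_le hq h2 h23).trans (add_le_add le_rfl
      (lpN_add_le hq (h3 t hot hOt) (h3 a hoa hOa)))))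
  rw [lpN_const_mul hq0 (by simp)]
  gcongr
  exact lpN_projTo_conv_sub_le hg hgd I hq hρ hr hρr ha hat ht hh hB

/-- The truncation is active with small probability only. -/
theorem lpN_sub_tamed_le {hργ : ρ ≤ γ} {hγ1 : γ ≤ 1} {y : ℝ → Ω → 𝔄.Hsp γ}
    {o : ℝ → Ω → 𝔄.Hsp 1} (hF : Continuous F) {a h χ p θ : ℝ} (hh : 0 < h) (hp : 0 < p)
    (hθ : 0 < θ) (hy : Measurable (y a)) (ho : Measurable (o a)) :
    lpN P p (fun ω => ‖F (j.incl hργ (y a ω)) - tamed j hργ hγ1 F (h ^ (-χ)) y o a ω‖ₑ)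
      ≤ lpN P (2 * p) (fun ω => ‖F (j.incl hργ (y a ω))‖ₑ)
        * (ENNReal.ofReal (h ^ χ) * lpN P (2 * p * θ)
            (fun ω => ‖y a ω‖ₑ + ‖Hsp.incl hγ1 (o a ω)‖ₑ)) ^ θ := by
  have hm1 : Measurable fun ω => ‖F (j.incl hργ (y a ω))‖ₑ :=
    (hF.comp (j.continuous_incl hργ)).enorm.measurable.comp hy
  have hm2 : Measurable fun ω => ‖y a ω‖ₑ + ‖Hsp.incl hγ1 (o a ω)‖ₑ :=
    hy.enorm.add ((Hsp.continuous_incl 𝔄 hγ1).enorm.measurable.comp ho)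
  -- Markov's inequality in pointwise form: where the truncation acts, `h^χ (‖y‖ + ‖o‖) > 1`, so
  -- inserting its `θ`-th power only increases the right-hand side.
  have hpt : ∀ ω, ‖F (j.incl hργ (y a ω)) - tamed j hργ hγ1 F (h ^ (-χ)) y o a ω‖ₑ
      ≤ ‖F (j.incl hργ (y a ω))‖ₑ
        * (ENNReal.ofReal (h ^ χ) * (‖y a ω‖ₑ + ‖Hsp.incl hγ1 (o a ω)‖ₑ)) ^ θ := by
    intro ω
    unfold tamed
    split_ifs with hc
    · rw [sub_self, enorm_zero]
      exact zero_le
    · rw [sub_zero]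
      refine le_mul_of_one_le_right' ?_
      refine ENNReal.one_le_rpow ?_ hθ
      rw [← ofReal_norm, ← ofReal_norm, ← ENNReal.ofReal_add (norm_nonneg _) (norm_nonneg _),
        ← ENNReal.ofReal_mul (by positivity), ← ENNReal.ofReal_one]
      refine ENNReal.ofReal_le_ofReal ?_
      rw [not_le, Real.rpow_neg hh.le, inv_lt_iff_one_lt_mul₀ (by positivity)] at hc
      linarith
  refine (lpN_mono hp.le hpt).trans ?_
  refine (lpN_mul_le hp hm1 ((hm2.const_mul _).pow_const _)).trans ?_
  rw [lpN_rpow (by positivity) hθ, lpN_const_mul (by positivity) ENNReal.ofReal_ne_top]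

end DiagonalData

namespace DiagonalData

variable {ι H : Type*} [NormedAddCommGroup H] [InnerProductSpace ℝ H]
  {𝔄 : DiagonalData ι H} {Ω : Type*} [MeasurableSpace Ω] {P : Measure Ω}
  {V : Type*} [NormedAddCommGroup V] [NormedSpace ℝ V]
  {ρ γ : ℝ} {j : 𝔄.Between ρ V} {F : V → H} {T : ℝ}

/-- The scheme is an identity in `H`; injectivity of `V ⊆ H` transfers it to `V`, where `F` is
defined. -/
theorem Between.eq_of_toH_eq (j : 𝔄.Between ρ V) {r s : ℝ} (hr : ρ ≤ r) (hs : ρ ≤ s)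
    (I : Finset ι) {y : 𝔄.Hsp r} {g : ℝ → H} {t : ℝ} {o : 𝔄.Hsp s}
    (h : y.toH = 𝔄.conv I g t + o.toH) :
    j.incl hr y = j.proj I (𝔄.conv I g t) + j.incl hs o := by
  apply j.toH_injective
  rw [map_add, j.toH_incl, j.toH_incl, j.toH_proj, proj_conv, h]

theorem Between.incl_incl (j : 𝔄.Between ρ V) {r s : ℝ} (hs : ρ ≤ s) (hr : ρ ≤ r) (hsr : s ≤ r)
    (v : 𝔄.Hsp r) : j.incl hs (Hsp.incl hsr v) = j.incl hr v := by
  apply j.toH_injective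
  rw [j.toH_incl, j.toH_incl, Hsp.toH_incl]

/-- The defect of the scheme with respect to its own continuous interpolation. -/
theorem lpN_scheme_defect_le [CompleteSpace H] [TopologicalSpace.SeparableSpace H]
    [IsProbabilityMeasure P] [MeasurableSpace V] [BorelSpace V] [SecondCountableTopology V]
    {hργ : ρ ≤ γ} {hγ1 : γ ≤ 1} (hρ1 : ρ ≤ 1) {y : ℝ → Ω → 𝔄.Hsp γ} {o : ℝ → Ω → 𝔄.Hsp 1}
    {O : ℝ → Ω → V} {g : ℝ → Ω → H} (hgm : StronglyMeasurable (Function.uncurry g))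
    (hgd : ∀ ω, IsDriver fun s => g s ω) (hF : Continuous F) {L φ : ℝ} (hL : 0 ≤ L) (hφ : 0 < φ)
    (hFL : PolyLipschitz F L (φ / 2)) {h χ p e r ϑ : ℝ} (hh : 0 < h) (hp : 1 ≤ p) (hϑ : 0 < ϑ)
    (hρ : 0 ≤ ρ) (hr : 0 ≤ r) (hρr : ρ + r < 1) (he1 : 1 ≤ e) (heφ : p * φ ≤ e)
    (heϑ : 2 * p * ϑ ≤ e) (hy : ∀ t ∈ Icc 0 T, Measurable (y t))
    (ho : ∀ t ∈ Icc 0 T, Measurable (o t)) (hO : ∀ t ∈ Icc 0 T, Measurable (O t)) (I : Finset ι)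
    (hgt : ∀ s ∈ Icc 0 T, ∀ ω,
      g s ω = tamed j hργ hγ1 F (h ^ (-χ)) y o (gridFloor h s) ω)
    (hyeq : ∀ t ∈ Icc 0 T, ∀ᵐ ω ∂P, (y t ω).toH
      = 𝔄.conv I (fun s => g s ω) t + (o t ω).toH)
    {K : ℝ} (hK0 : 0 ≤ K) (hK : ∀ v : 𝔄.Hsp γ, ‖j.incl hργ v‖ ≤ K * ‖v‖) {bY bO bF D : ℝ≥0∞}
    (hbY : ∀ t ∈ Icc 0 T, lpN P e (fun ω => ‖y t ω‖ₑ) ≤ bY)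
    (hbO : ∀ t ∈ Icc 0 T, lpN P e (fun ω => ‖Hsp.incl hγ1 (o t ω)‖ₑ) ≤ bO)
    (hbF : ∀ t ∈ Icc 0 T, lpN P (2 * p) (fun ω => ‖F (j.incl hργ (y t ω))‖ₑ) ≤ bF)
    (hD1 : ∀ t ∈ Icc 0 T, lpN P (2 * p) (fun ω => ‖j.incl hρ1
      (𝔄.projTo I 1 (j.toH (O t ω - O (gridFloor h t) ω)))‖ₑ) ≤ D)
    (hD2 : ∀ t ∈ Icc 0 T, lpN P (2 * p) (fun ω => ‖j.incl hρ1
      (𝔄.projTo I 1 (j.toH (O t ω)) - o t ω)‖ₑ) ≤ D) {t : ℝ} (ht : t ∈ Icc 0 T) :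
    lpN P p (fun ω => ‖F (j.proj I (𝔄.conv I
          (fun s => g s ω) t) + j.incl hρ1 (o t ω))
        - g t ω‖ₑ)
      ≤ ENNReal.ofReal L * ((‖j.ofHsp‖ₑ * (ENNReal.ofReal (h ^ r)
            * (2 * (ENNReal.ofReal (T ^ (1 - (ρ + r)) / (1 - (ρ + r))) * bF))) + (D + (D + D)))
          * (1 + (ENNReal.ofReal K * bY) ^ (φ / 2) + (ENNReal.ofReal K * bY) ^ (φ / 2)))
        + bF * (ENNReal.ofReal (h ^ χ) * (bY + bO)) ^ ϑ := by
  have hp0 : 0 < p := by linarith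
  set a := gridFloor h t
  have ha : a ∈ Icc 0 T := gridFloor_mem_Icc hh ht
  have hat : a ≤ t := gridFloor_le hh t
  have hJ : ∀ s ∈ Icc 0 T, Measurable fun ω => j.incl hργ (y s ω) := fun s hs =>
    (j.continuous_incl hργ).measurable.comp (hy s hs)
  have hgB : ∀ s ∈ Icc 0 T, lpN P (2 * p) (fun ω => ‖g s ω‖ₑ) ≤ bF := by
    intro s hs
    refine (lpN_mono (by linarith) fun ω => ?_).trans (hbF _ (gridFloor_mem_Icc hh hs))
    rw [hgt s hs, ← ofReal_norm, ← ofReal_norm]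
    exact ENNReal.ofReal_le_ofReal (norm_tamed_le _ _)
  have hJb : ∀ s ∈ Icc 0 T, lpN P (2 * p * (φ / 2)) (fun ω => ‖j.incl hργ (y s ω)‖ₑ)
      ≤ ENNReal.ofReal K * bY := by
    intro s hs
    have hpφ : 0 < 2 * p * (φ / 2) := by positivity
    refine (lpN_mono hpφ.le fun ω => enorm_le_ofReal_mul_enorm hK0 (hK _)).trans ?_
    rw [lpN_const_mul hpφ ENNReal.ofReal_ne_top]
    gcongr
    exact (lpN_le_lpN_of_le hpφ (by linarith) (hy s hs).enorm).trans (hbY s hs)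
  -- The defect splits into the change of `F` since the last grid point and the effect of the
  -- truncation there.
  have hpt : ∀ᵐ ω ∂P, ‖F (j.proj I (𝔄.conv I (fun s => g s ω) t) + j.incl hρ1 (o t ω)) - g t ω‖ₑ
      ≤ ‖F (j.incl hργ (y t ω)) - F (j.incl hργ (y a ω))‖ₑ
        + ‖F (j.incl hργ (y a ω)) - tamed j hργ hγ1 F (h ^ (-χ)) y o a ω‖ₑ := by
    filter_upwards [hyeq t ht] with ω hω
    rw [← j.eq_of_toH_eq hργ hρ1 I hω, hgt t ht]
    refine le_trans (le_of_eq ?_) (enorm_add_le _ _)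
    rw [sub_add_sub_cancel]
  have hm1 : Measurable fun ω => ‖F (j.incl hργ (y t ω)) - F (j.incl hργ (y a ω))‖ₑ := by
    have hc : Continuous fun q : V × V => ‖F q.1 - F q.2‖ₑ := by fun_prop
    exact hc.measurable.comp ((hJ t ht).prodMk (hJ a ha))
  have hm2 : Measurable fun ω =>
      ‖F (j.incl hργ (y a ω)) - tamed j hργ hγ1 F (h ^ (-χ)) y o a ω‖ₑ := by
    have h1 : StronglyMeasurable fun ω => F (j.incl hργ (y a ω)) :=
      hF.comp_stronglyMeasurable (hJ a ha).stronglyMeasurable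
    have h2 : StronglyMeasurable fun ω => g t ω :=
      hgm.comp_measurable (measurable_const.prodMk measurable_id)
    simp_rw [hgt t ht] at h2
    exact (h1.sub h2).enorm
  refine (lpN_mono_ae hp0.le hpt).trans ((lpN_add_le hp hm1 hm2).trans (add_le_add ?_ ?_))
  · refine (lpN_polyLipschitz_le hL (half_pos hφ) hp hFL (hJ t ht) (hJ a ha)).trans ?_
    gcongr ENNReal.ofReal L * (?_ * (1 + ?_ ^ (φ / 2) + ?_ ^ (φ / 2)))
    · have hae : ∀ᵐ ω ∂P, ‖j.incl hργ (y t ω) - j.incl hργ (y a ω)‖ₑ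
          ≤ ‖(j.proj I (𝔄.conv I (fun s => g s ω) t) + j.incl hρ1 (o t ω))
            - (j.proj I (𝔄.conv I (fun s => g s ω) a) + j.incl hρ1 (o a ω))‖ₑ := by
        filter_upwards [hyeq t ht, hyeq a ha] with ω h1 h2
        rw [← j.eq_of_toH_eq hργ hρ1 I h1, ← j.eq_of_toH_eq hργ hρ1 I h2]
      refine (lpN_mono_ae (by linarith) hae).trans ?_
      refine (lpN_scheme_increment_le (r := r) (h := h) (O := O) hρ1 hgm hgd I (by linarith) hρ hr
        hρr ha.1 hat ht.2 (by linarith [lt_gridFloor_add hh t]) (ho a ha) (ho t ht) (hO a ha)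
        (hO t ht) hgB).trans ?_
      gcongr
      · exact hD1 t ht
      · exact hD2 t ht
      · exact hD2 a ha
    · exact hJb t ht
    · exact hJb a ha
  · refine (lpN_sub_tamed_le hF hh hp0 hϑ (hy a ha) (ho a ha)).trans ?_
    have hmo : Measurable fun ω => ‖Hsp.incl hγ1 (o a ω)‖ₑ :=
      (Hsp.continuous_incl 𝔄 hγ1).enorm.measurable.comp (ho a ha)
    gcongr
    · exact hbF a ha
    · refine (lpN_le_lpN_of_le (by positivity) heϑ ((hy a ha).enorm.add hmo)).trans ?_
      exact (lpN_add_le he1 (hy a ha).enorm hmo).trans (add_le_add (hbY a ha) (hbO a ha))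

/-- Strong error in terms of the two defects. -/
theorem lpN_error_le [CompleteSpace H] [IsProbabilityMeasure P] [MeasurableSpace V] [BorelSpace V]
    [SecondCountableTopology V] (hT : 0 ≤ T) {c : ℝ} (hc : 0 ≤ c) (hρ1 : ρ ≤ 1)
    (hF : Continuous F)
    (hF_mono : ∀ (I : Finset ι) (v w : 𝔄.Hsp 1),
      v.toH ∈ 𝔄.projRange I → w.toH ∈ 𝔄.projRange I →
      inner ℝ (v.toH - w.toH) (v.gen + F (j.incl hρ1 v) - w.gen - F (j.incl hρ1 w))
        ≤ c * ‖v.toH - w.toH‖ ^ 2)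
    (I : Finset ι) {X : ℝ → Ω → V} {o : ℝ → Ω → 𝔄.Hsp 1} {g : ℝ → Ω → H}
    (hX : ∀ t ∈ Icc 0 T, Measurable (X t)) (hXc : ∀ ω, ContinuousOn (fun t => X t ω) (Icc 0 T))
    (ho : ∀ t ∈ Icc 0 T, Measurable (o t)) (hoc : ∀ ω, ContinuousOn (fun t => o t ω) (Icc 0 T))
    (hoI : ∀ t ∈ Icc 0 T, ∀ ω, (o t ω).toH ∈ 𝔄.projRange I)
    (hg : StronglyMeasurable (Function.uncurry g)) (hgd : ∀ ω, IsDriver fun s => g s ω)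
    (hgc : ∀ t ∈ Ico 0 T, ∀ ω, ContinuousWithinAt (fun s => g s ω) (Ici t) t)
    {Y : Ω → H} {p t : ℝ} (hp : 2 ≤ p) (ht : t ∈ Icc 0 T)
    (hY : ∀ᵐ ω ∂P, Y ω = 𝔄.conv I (fun s => g s ω) t + (o t ω).toH) {B₀ B₁ B₂ : ℝ≥0∞}
    (hB₀ : lpN P p (fun ω => ‖X t ω - (j.proj I (𝔄.conv I (fun s => F (X (clamp T s) ω)) t)
        + j.incl hρ1 (o t ω))‖ₑ) ≤ B₀)
    (hB₁ : ∀ t ∈ Icc 0 T, lpN P p (fun ω => ‖F (X t ω)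
      - F (j.proj I (𝔄.conv I (fun s => F (X (clamp T s) ω)) t) + j.incl hρ1 (o t ω))‖ₑ) ≤ B₁)
    (hB₂ : ∀ t ∈ Icc 0 T, lpN P p (fun ω =>
      ‖F (j.proj I (𝔄.conv I (fun s => g s ω) t) + j.incl hρ1 (o t ω)) - g t ω‖ₑ) ≤ B₂) :
    lpN P p (fun ω => ‖j.toH (X t ω) - Y ω‖ₑ)
      ≤ ‖j.toH‖ₑ * B₀ + (ENNReal.ofReal (Real.exp ((2 * c + 1) * T)) * ENNReal.ofReal T) ^ (1 / 2 : ℝ)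
        * (B₁ + B₂) := by
  have hp0 : 0 < p := by linarith
  have hp1 : 1 ≤ p := by linarith
  set k : ℝ → Ω → H := fun s ω => F (X (clamp T s) ω) with hk
  have hkm : StronglyMeasurable (Function.uncurry k) := stronglyMeasurable_drift hT hF hX hXc
  have hkd : ∀ ω, IsDriver fun s => k s ω := isDriver_drift hT hF hXc
  set v : ℝ → Ω → V := fun t ω => j.proj I (𝔄.conv I (fun s => k s ω) t) + j.incl hρ1 (o t ω)
    with hv
  set w : ℝ → Ω → V := fun t ω => j.proj I (𝔄.conv I (fun s => g s ω) t) + j.incl hρ1 (o t ω)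
    with hw
  have hint : ∀ {f : ℝ → Ω → H}, StronglyMeasurable (Function.uncurry f) →
      (∀ ω, IsDriver fun s => f s ω) →
      (∀ t ∈ Icc 0 T, StronglyMeasurable fun ω =>
        j.proj I (𝔄.conv I (fun s => f s ω) t) + j.incl hρ1 (o t ω)) ∧
      (∀ ω, ContinuousOn (fun t =>
        j.proj I (𝔄.conv I (fun s => f s ω) t) + j.incl hρ1 (o t ω)) (Icc 0 T)) := by
    intro f hfm hfd
    refine ⟨fun t ht => ?_, fun ω => ?_⟩
    · exact ((j.proj I).continuous.comp_stronglyMeasurable (stronglyMeasurable_conv hfm I ht.1)).add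
        ((j.continuous_incl hρ1).measurable.comp (ho t ht)).stronglyMeasurable
    · exact ((j.proj I).continuous.comp (continuous_conv I (hfd ω))).continuousOn.add
        ((j.continuous_incl hρ1).comp_continuousOn (hoc ω))
  obtain ⟨hvm, hvc⟩ := hint hkm hkd
  obtain ⟨hwm, hwc⟩ := hint hg hgd
  have hFm : ∀ u : ℝ → Ω → V, (∀ t ∈ Icc 0 T, StronglyMeasurable (u t)) →
      (∀ ω, ContinuousOn (fun t => u t ω) (Icc 0 T)) →
      StronglyMeasurable (Function.uncurry fun s ω => F (u (clamp T s) ω)) ∧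
      ∀ ω, IsDriver (fun s => F (u (clamp T s) ω)) ∧ Continuous fun s => F (u (clamp T s) ω) :=
    fun u hu huc => ⟨stronglyMeasurable_drift hT hF (fun t ht => (hu t ht).measurable) huc,
      fun ω => ⟨isDriver_drift hT hF huc ω, hF.comp ((huc ω).comp_clamp hT)⟩⟩
  obtain ⟨hFvm, hFvd⟩ := hFm v hvm hvc
  obtain ⟨hFwm, hFwd⟩ := hFm w hwm hwc
  -- In `k - F(v) + F(w) - g` the argument is clamped so that `d` is a driver on the whole line; on
  -- `[0, T]` it is the defect in `norm_sq_conv_sub_le`.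
  set d : ℝ → Ω → H := fun s ω => k s ω - F (v (clamp T s) ω) + F (w (clamp T s) ω) - g s ω
    with hd
  have hdm : StronglyMeasurable (Function.uncurry d) := ((hkm.sub hFvm).add hFwm).sub hg
  have hdd : ∀ ω, IsDriver fun s => d s ω := fun ω =>
    (((hkd ω).sub (hFvd ω).1).add (hFwd ω).1).sub (hgd ω)
  have hkc : ∀ ω, Continuous fun s => k s ω := fun ω => hF.comp ((hXc ω).comp_clamp hT)
  have hE : ∀ ω, ‖𝔄.conv I (fun s => k s ω) t - 𝔄.conv I (fun s => g s ω) t‖ ^ 2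
      ≤ Real.exp ((2 * c + 1) * T) * ∫ s in (0 : ℝ)..t, ‖d s ω‖ ^ 2 := by
    intro ω
    refine norm_sq_conv_sub_le hc hρ1 j hF_mono I (hkd ω) (hgd ω)
      (fun t _ => (hkc ω).continuousWithinAt) (fun t ht => hgc t ht ω) (o := fun t => o t ω)
      (fun t ht => hoI t ht ω) (hdd ω) (fun t ht => ?_) (fun t ht => ?_) ht
    · exact ((((hkc ω).sub (hFvd ω).2).add (hFwd ω).2).continuousWithinAt).sub (hgc t ht ω)
    · simp only [hd, hv, hw, clamp_of_mem ht]
  have hdB : ∀ s ∈ Icc 0 T, lpN P p (fun ω => ‖d s ω‖ₑ) ≤ B₁ + B₂ := by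
    intro s hs
    have h1 : ∀ ω, ‖d s ω‖ₑ ≤ ‖F (X s ω) - F (v s ω)‖ₑ + ‖F (w s ω) - g s ω‖ₑ := by
      intro ω
      have e : d s ω = (F (X s ω) - F (v s ω)) + (F (w s ω) - g s ω) := by
        simp only [hd, hk, clamp_of_mem hs]
        abel
      rw [e]
      exact enorm_add_le _ _
    have hgs : StronglyMeasurable fun ω => g s ω :=
      hg.comp_measurable (measurable_const.prodMk measurable_id)
    have hm1 : Measurable fun ω => ‖F (X s ω) - F (v s ω)‖ₑ :=
      ((hF.comp_stronglyMeasurable (hX s hs).stronglyMeasurable).sub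
        (hF.comp_stronglyMeasurable (hvm s hs))).enorm
    have hm2 : Measurable fun ω => ‖F (w s ω) - g s ω‖ₑ :=
      ((hF.comp_stronglyMeasurable (hwm s hs)).sub hgs).enorm
    exact (lpN_mono hp0.le h1).trans ((lpN_add_le hp1 hm1 hm2).trans
      (add_le_add (hB₁ s hs) (hB₂ s hs)))
  have key := lpN_le_of_norm_sq_le_integral (P := P) hdm hdd (Real.exp_pos _).le hp ht hE hdB
  have hpt : ∀ᵐ ω ∂P, ‖j.toH (X t ω) - Y ω‖ₑ ≤ ‖j.toH‖ₑ * ‖X t ω - v t ω‖ₑ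
      + ‖𝔄.conv I (fun s => k s ω) t - 𝔄.conv I (fun s => g s ω) t‖ₑ := by
    filter_upwards [hY] with ω hω
    have e : j.toH (X t ω) - Y ω = j.toH (X t ω - v t ω)
        + (𝔄.conv I (fun s => k s ω) t - 𝔄.conv I (fun s => g s ω) t) := by
      rw [hω, hv]
      simp only [map_sub, map_add, j.toH_proj, j.toH_incl, proj_conv]
      abel
    rw [e]
    exact (enorm_add_le _ _).trans (add_le_add (enorm_clm_le _ _) le_rfl)
  have hm1 : Measurable fun ω => ‖X t ω - v t ω‖ₑ :=
    ((hX t ht).stronglyMeasurable.sub (hvm t ht)).enorm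
  have hm2 : Measurable fun ω =>
      ‖𝔄.conv I (fun s => k s ω) t - 𝔄.conv I (fun s => g s ω) t‖ₑ :=
    ((stronglyMeasurable_conv hkm I ht.1).sub (stronglyMeasurable_conv hg I ht.1)).enorm
  refine (lpN_mono_ae hp0.le hpt).trans ((lpN_add_le hp1 (hm1.const_mul _) hm2).trans
    (add_le_add ?_ key))
  rw [lpN_const_mul hp0 (by simp)]
  gcongr

end DiagonalData

/-! ### Uniform bounds for the scheme and the strong error. -/

namespace DiagonalData

variable {ι H : Type*} [NormedAddCommGroup H] [InnerProductSpace ℝ H]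
  {𝔄 : DiagonalData ι H} {Ω : Type*} [MeasurableSpace Ω] {P : Measure Ω}
  {V : Type*} [NormedAddCommGroup V] [NormedSpace ℝ V] {ρ γ : ℝ} {F : V → H} {T : ℝ}

/-- Pathwise a priori bound for the scheme. -/
theorem exists_ae_norm_sq_scheme_le [CompleteSpace H] [TopologicalSpace.SeparableSpace H]
    {c φ ε χ : ℝ} (hT : 0 < T) (hc : 0 < c) (hφ : 0 < φ)
    (hε : ε ∈ Ico (0 : ℝ) 1) (hρ : ρ ∈ Ico (0 : ℝ) (1 / 2)) (hγ : γ ∈ Ioc ρ (1 / 2))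
    (hχ : 0 < χ) (hχ1 : χ * (1 + φ / 2) ≤ γ - ρ) (hχ2 : χ * (1 + φ) ≤ 1 - ρ)
    (j : 𝔄.Between ρ V) {phi Phi : C(Icc (0 : ℝ) T, 𝔄.Hsp 1) → ℝ≥0}
    (hF_coercive : ∀ (I : Finset ι) (v : 𝔄.Hsp 1), v.toH ∈ 𝔄.projRange I →
      ∀ (x : C(Icc (0 : ℝ) T, 𝔄.Hsp 1)) (t : Icc (0 : ℝ) T),
      inner ℝ (DiagonalData.Hsp.incl half_le_one_real v)
          (𝔄.projTo I (1 / 2) (F (j.incl (le_one_of_lt_half hρ.2) (v + x t))))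
        + phi x * inner ℝ v.toH (F (j.incl (le_one_of_lt_half hρ.2) (v + x t)))
      ≤ ε * ‖v‖ ^ 2
        + (c + phi x) * ‖DiagonalData.Hsp.incl half_le_one_real v‖ ^ 2
        + c * phi x * ‖v.toH‖ ^ 2 + Phi x)
    (hFc : Continuous F) {L : ℝ} (hL : 0 ≤ L) (hF : PolyLipschitz F L (φ / 2)) :
    ∃ C, 0 ≤ C ∧ ∀ h, 0 < h → h ≤ T → ∀ (I : Finset ι) (o : ℝ → Ω → 𝔄.Hsp 1)
      (hoc : ∀ ω, ContinuousOn (fun t => o t ω) (Icc 0 T)), (∀ t ∈ Icc 0 T, Measurable (o t)) →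
      (∀ t ∈ Icc 0 T, ∀ ω, (o t ω).toH ∈ 𝔄.projRange I) →
      ∀ y : ℝ → Ω → 𝔄.Hsp γ, (∀ t ∈ Icc 0 T, Measurable (y t)) →
      (∀ t ∈ Icc 0 T, ∀ᵐ ω ∂P, (y t ω).toH
        = 𝔄.conv I (fun s => schemeDriver j hγ.1.le (le_one_of_le_half hγ.2) F T h (h ^ (-χ)) y o
          s ω) t + (o t ω).toH) →
      ∀ t ∈ Icc 0 T, ∀ᵐ ω ∂P, ‖y t ω‖ ^ 2
        ≤ C * (1 + (‖Hsp.incl (le_one_of_le_half hγ.2) (o t ω)‖ ^ 2 + Phi (pathOn (hoc ω))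
          + phi (pathOn (hoc ω)))) := by
  obtain ⟨C, hC, hmain⟩ := exists_norm_projTo_half_conv_le hT hc hφ hε hρ hγ hχ hχ1 hχ2 j
    hF_coercive hL hF
  obtain ⟨K, hK, hincl⟩ := Hsp.norm_incl_le 𝔄 hγ.2
  refine ⟨2 * K ^ 2 * C + 2, by positivity, ?_⟩
  intro h hh hhT I o hoc ho hoI y hy hyeq t ht
  filter_upwards [hyeq t ht, ae_grid_eq hh hyeq] with ω hω hgrid
  have h1 := hmain h hh hhT I (fun s => o s ω) (hoc ω) (fun s hs => hoI s hs ω)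
    (fun s => y s ω) _ (isDriver_schemeDriver (j := j) (hργ := hγ.1.le)
      (hγ1 := le_one_of_le_half hγ.2) (R := h ^ (-χ)) hFc hh hy ho ω) (fun s hs => by
        rw [schemeDriver_of_mem hh hs, tamed]) hgrid t ht
  set z := 𝔄.conv I (fun s => schemeDriver j hγ.1.le (le_one_of_le_half hγ.2) F T h (h ^ (-χ)) y o
    s ω) t with hz
  -- The energy controls `H_{1/2}`, which embeds into `H_γ` because `γ ≤ 1/2`; the noise is added
  -- back in `H_γ`.
  have e : y t ω = Hsp.incl hγ.2 (𝔄.projTo I (1 / 2) z)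
      + Hsp.incl (le_one_of_le_half hγ.2) (o t ω) := by
    apply Hsp.toH_injective 𝔄
    rw [map_add, Hsp.toH_incl, Hsp.toH_incl, toH_projTo, hz, proj_conv, hω]
  have h2 := hincl (𝔄.projTo I (1 / 2) z)
  have h3 : ‖y t ω‖ ≤ K * ‖𝔄.projTo I (1 / 2) z‖
      + ‖Hsp.incl (le_one_of_le_half hγ.2) (o t ω)‖ := by
    rw [e]
    exact (norm_add_le _ _).trans (by gcongr)
  have hPhi : (0 : ℝ) ≤ Phi (pathOn (hoc ω)) := NNReal.coe_nonneg _
  have hphi : (0 : ℝ) ≤ phi (pathOn (hoc ω)) := NNReal.coe_nonneg _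
  set d := ‖Hsp.incl (le_one_of_le_half hγ.2) (o t ω)‖
  set b := ‖𝔄.projTo I (1 / 2) z‖
  calc ‖y t ω‖ ^ 2 ≤ (K * b + d) ^ 2 := pow_le_pow_left₀ (norm_nonneg _) h3 2
    _ ≤ 2 * K ^ 2 * b ^ 2 + 2 * d ^ 2 := by nlinarith [sq_nonneg (K * b - d)]
    _ ≤ 2 * K ^ 2 * (C * (1 + Phi (pathOn (hoc ω)) + phi (pathOn (hoc ω)))) + 2 * d ^ 2 := by
      gcongr
    _ ≤ _ := by
      have : 0 ≤ 2 * K ^ 2 * C * d ^ 2 := by positivity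
      linarith

end DiagonalData

/-- Passing through `1 + R ≤ 2 max(1, R)` makes the power bound valid for every `q ≥ 0`, without
convexity. -/
theorem ofReal_rpow_two_mul_le {a C R q : ℝ} (ha : 0 ≤ a) (hC : 0 ≤ C) (hR : 0 ≤ R) (hq : 0 ≤ q)
    (h : a ^ 2 ≤ C * (1 + R)) :
    ENNReal.ofReal (a ^ (2 * q)) ≤ ENNReal.ofReal ((C * 2) ^ q) * (1 + ENNReal.ofReal (R ^ q)) := by
  rw [← ENNReal.ofReal_one, ← ENNReal.ofReal_add zero_le_one (by positivity),
    ← ENNReal.ofReal_mul (by positivity)]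
  refine ENNReal.ofReal_le_ofReal ?_
  rw [Real.rpow_mul ha, Real.rpow_two]
  have h1 : a ^ 2 ≤ C * 2 * max 1 R := by
    refine h.trans ?_
    rw [mul_assoc]
    gcongr
    linarith [le_max_left 1 R, le_max_right 1 R]
  calc (a ^ 2) ^ q ≤ (C * 2 * max 1 R) ^ q := Real.rpow_le_rpow (sq_nonneg a) h1 hq
    _ = (C * 2) ^ q * max 1 R ^ q := Real.mul_rpow (by positivity) (by positivity)
    _ ≤ _ := by
      gcongr
      rcases max_cases 1 R with ⟨h, -⟩ | ⟨h, -⟩ <;> rw [h]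
      · rw [Real.one_rpow]
        linarith [Real.rpow_nonneg hR q]
      · linarith

theorem ofReal_div_natCast_rpow {T : ℝ} (hT : 0 ≤ T) (M : ℕ+) (r : ℝ) :
    ENNReal.ofReal ((T / M) ^ r) = ENNReal.ofReal (T ^ r) * ((M : ℕ) : ℝ≥0∞) ^ (-r) := by
  have hM : (0 : ℝ) < ((M : ℕ) : ℝ) := by exact_mod_cast M.pos
  rw [Real.div_rpow hT hM.le, div_eq_mul_inv, ← Real.rpow_neg hM.le,
    ENNReal.ofReal_mul (by positivity), ← ENNReal.ofReal_rpow_of_pos hM, ENNReal.ofReal_natCast]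

namespace DiagonalData

variable {ι H : Type*} [NormedAddCommGroup H] [InnerProductSpace ℝ H]
  {𝔄 : DiagonalData ι H} {Ω : Type*} [MeasurableSpace Ω] {P : Measure Ω}
  {V : Type*} [NormedAddCommGroup V] [NormedSpace ℝ V] {ρ γ : ℝ} {F : V → H} {T : ℝ}

theorem stronglyMeasurable_proj_conv_add [CompleteSpace H] [MeasurableSpace V] [BorelSpace V]
    [SecondCountableTopology V] (j : 𝔄.Between ρ V) {r : ℝ} (hρr : ρ ≤ r) {g : ℝ → Ω → H}
    {o : Ω → 𝔄.Hsp r} (hg : StronglyMeasurable (Function.uncurry g)) (ho : Measurable o)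
    (I : Finset ι) {t : ℝ} (ht : 0 ≤ t) :
    StronglyMeasurable fun ω => j.proj I (𝔄.conv I (fun s => g s ω) t) + j.incl hρr (o ω) :=
  ((j.proj I).continuous.comp_stronglyMeasurable (stronglyMeasurable_conv hg I ht)).add
    ((j.continuous_incl hρr).measurable.comp ho).stronglyMeasurable

/-- The strong error is controlled by the noise errors, uniformly in the discretization. -/
theorem exists_strong_error_le [CompleteSpace H] [TopologicalSpace.SeparableSpace H]
    [IsProbabilityMeasure P] [MeasurableSpace V] [BorelSpace V] [SecondCountableTopology V]
    {j : 𝔄.Between ρ V} {c φ χ : ℝ} (hT : 0 < T) (hc : 0 ≤ c) (hφ : 0 < φ) (hρ : 0 ≤ ρ)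
    (hρ1 : ρ ≤ 1) (hργ : ρ ≤ γ) (hγ1 : γ ≤ 1) (hF : Continuous F)
    (hF_mono : ∀ (I : Finset ι) (v w : 𝔄.Hsp 1),
      v.toH ∈ 𝔄.projRange I → w.toH ∈ 𝔄.projRange I →
      inner ℝ (v.toH - w.toH) (v.gen + F (j.incl hρ1 v) - w.gen - F (j.incl hρ1 w))
        ≤ c * ‖v.toH - w.toH‖ ^ 2)
    {L : ℝ} (hL : 0 ≤ L) (hFL : PolyLipschitz F L (φ / 2)) {X O : ℝ → Ω → V}
    (hX : ∀ t ∈ Icc 0 T, Measurable (X t)) (hXc : ∀ ω, ContinuousOn (fun t => X t ω) (Icc 0 T))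
    (hO : ∀ t ∈ Icc 0 T, Measurable (O t))
    (hX_eq : ∀ t ∈ Icc 0 T, ∀ᵐ ω ∂P, j.toH (X t ω)
      = (∫ s in (0 : ℝ)..t, 𝔄.semigroup (t - s) (F (X s ω))) + j.toH (O t ω))
    {p e ϑ ϱ : ℝ} (hp : 2 ≤ p) (hpφ : 1 ≤ p * φ) (hϑ : 0 < ϑ) (hϱ : 0 ≤ ϱ) (hρϱ : ρ + ϱ < 1)
    (he : p * max 2 φ * (1 + φ / 2) ≤ e) (heϑ : 2 * p * ϑ ≤ e) {bX bY bO cD cα : ℝ≥0∞}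
    (hbX_top : bX ≠ ∞) (hbY_top : bY ≠ ∞) (hbO_top : bO ≠ ∞) (hcD_top : cD ≠ ∞) (hcα_top : cα ≠ ∞)
    (hbX : ∀ t ∈ Icc 0 T, lpN P (p * max 2 φ * (1 + φ / 2)) (fun ω => ‖X t ω‖ₑ) ≤ bX) :
    ∃ K : ℝ≥0∞, K ≠ ∞ ∧ ∀ h, 0 < h → ∀ (I : Finset ι) (o : ℝ → Ω → 𝔄.Hsp 1),
      (∀ ω, ContinuousOn (fun t => o t ω) (Icc 0 T)) → (∀ t ∈ Icc 0 T, Measurable (o t)) →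
      (∀ t ∈ Icc 0 T, ∀ ω, (o t ω).toH ∈ 𝔄.projRange I) →
      ∀ y : ℝ → Ω → 𝔄.Hsp γ, (∀ t ∈ Icc 0 T, Measurable (y t)) →
      (∀ t ∈ Icc 0 T, ∀ᵐ ω ∂P, (y t ω).toH
        = 𝔄.conv I (fun s => schemeDriver j hργ hγ1 F T h (h ^ (-χ)) y o s ω) t + (o t ω).toH) →
      (∀ t ∈ Icc 0 T, lpN P e (fun ω => ‖y t ω‖ₑ) ≤ bY) →
      (∀ t ∈ Icc 0 T, lpN P e (fun ω => ‖Hsp.incl hγ1 (o t ω)‖ₑ) ≤ bO) →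
      ∀ β : ℝ≥0∞,
      (∀ t ∈ Icc 0 T, lpN P (2 * p) (fun ω => ‖j.incl hρ1
        (𝔄.projTo I 1 (j.toH (O t ω - O (gridFloor h t) ω)))‖ₑ) ≤ cD * β) →
      (∀ t ∈ Icc 0 T, lpN P (p * max 2 φ) (fun ω => ‖j.incl hρ1
        (𝔄.projTo I 1 (j.toH (O t ω)) - o t ω)‖ₑ) ≤ cD * β) →
      ENNReal.ofReal (h ^ ϱ) ≤ cα * β → ENNReal.ofReal (h ^ χ) ^ ϑ ≤ cα * β →
      ‖𝔄.negPow ϱ hϱ ∘L (ContinuousLinearMap.id ℝ H - 𝔄.proj I)‖ₑ ≤ β →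
      (∀ t ∈ Icc 0 T, lpN P (2 * p) (fun ω =>
        ‖O t ω - j.incl hρ1 (𝔄.projTo I 1 (j.toH (O t ω)))‖ₑ) ≤ β) →
      ∀ t ∈ Icc 0 T, lpN P p (fun ω => ‖j.toH (X t ω) - (y t ω).toH‖ₑ) ≤ K * β := by
  obtain ⟨Kγ, hKγ0, hKγ⟩ := j.norm_incl_le hργ
  -- `q` dominates the two exponents `2p` and `pφ` produced by Cauchy–Schwarz. Moments of `X` of
  -- order `q(1 + φ/2)` put `F(X)`, and hence `v`, in `L^q`.
  obtain ⟨q, hq⟩ : ∃ q, q = p * max 2 φ := ⟨_, rfl⟩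
  rw [← hq] at he hbX ⊢
  have hq2 : 2 * p ≤ q := by rw [hq]; nlinarith [le_max_left 2 φ]
  have hqφ : p * φ ≤ q := by rw [hq]; nlinarith [le_max_right 2 φ]
  have hp0 : 0 < p := by linarith
  have hq1 : 1 ≤ q := by linarith
  have hq0 : 0 < q := by linarith
  have hqe' : q ≤ q * (1 + φ / 2) := by nlinarith
  have hqe : q ≤ e := hqe'.trans he
  have ha : 0 < φ / 2 := by positivity
  have h2pφ : 2 * p * (φ / 2) = p * φ := by ring
  set G := ‖F 0‖ + 2 * L with hG
  have hG0 : 0 ≤ G := by positivity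
  have hgrow : ∀ v, ‖F v‖ ≤ G * (1 + ‖v‖ ^ (1 + φ / 2)) := hFL.growth hL ha
  -- All constants are fixed before `h`, `I` and `β`. `k0`, `k1` are masses of singular kernels,
  -- `bF`, `bG` bound the drift along `X` and along the scheme, `bv` bounds `v`, `c4` bounds `X -
  -- v`, and `c5`, `c6` bound the two parts of the defect, the last three per unit of `β`.
  obtain ⟨k1, hk1⟩ : ∃ k, k = ENNReal.ofReal (T ^ (1 - (ρ + ϱ)) / (1 - (ρ + ϱ))) := ⟨_, rfl⟩
  have hk1_top : k1 ≠ ∞ := by rw [hk1]; exact ENNReal.ofReal_ne_top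
  obtain ⟨k0, hk0⟩ : ∃ k, k = ENNReal.ofReal (T ^ (1 - ρ) / (1 - ρ)) := ⟨_, rfl⟩
  have hk0_top : k0 ≠ ∞ := by rw [hk0]; exact ENNReal.ofReal_ne_top
  obtain ⟨κ, hκ⟩ : ∃ κ, κ = ENNReal.ofReal Kγ := ⟨_, rfl⟩
  have hκ_top : κ ≠ ∞ := by rw [hκ]; exact ENNReal.ofReal_ne_top
  obtain ⟨bF, hbF⟩ : ∃ b, b = ENNReal.ofReal G * (1 + bX ^ (1 + φ / 2)) := ⟨_, rfl⟩
  have hbF_top : bF ≠ ∞ := by rw [hbF]; finiteness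
  obtain ⟨bG, hbG⟩ : ∃ b, b = ENNReal.ofReal G * (1 + (κ * bY) ^ (1 + φ / 2)) := ⟨_, rfl⟩
  have hbG_top : bG ≠ ∞ := by rw [hbG]; finiteness
  obtain ⟨bv, hbv⟩ : ∃ b, b = ‖j.ofHsp‖ₑ * (k0 * bF) + κ * bO := ⟨_, rfl⟩
  have hbv_top : bv ≠ ∞ := by rw [hbv]; finiteness
  obtain ⟨c4, hc4⟩ : ∃ b, b = ‖j.ofHsp‖ₑ * (k1 * bF) + (1 + cD) := ⟨_, rfl⟩
  have hc4_top : c4 ≠ ∞ := by rw [hc4]; finiteness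
  obtain ⟨c5, hc5⟩ : ∃ b, b = ENNReal.ofReal L * (c4 * (1 + bX ^ (φ / 2) + bv ^ (φ / 2))) :=
    ⟨_, rfl⟩
  have hc5_top : c5 ≠ ∞ := by rw [hc5]; finiteness
  obtain ⟨c6, hc6⟩ : ∃ b, b = ENNReal.ofReal L * ((‖j.ofHsp‖ₑ * (cα * (2 * (k1 * bG)))
      + (cD + (cD + cD))) * (1 + (κ * bY) ^ (φ / 2) + (κ * bY) ^ (φ / 2)))
      + bG * (cα * (bY + bO) ^ ϑ) := ⟨_, rfl⟩
  have hc6_top : c6 ≠ ∞ := by rw [hc6]; finiteness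
  refine ⟨‖j.toH‖ₑ * c4 + (ENNReal.ofReal (Real.exp ((2 * c + 1) * T))
    * ENNReal.ofReal T) ^ (1 / 2 : ℝ) * (c5 + c6), by finiteness, ?_⟩
  intro h hh I o hoc ho hoI y hy hyeq hbY hbO β hD1 hD2 hα1 hα2 hQ hPO t ht
  have hkm : StronglyMeasurable (Function.uncurry fun s ω => F (X (clamp T s) ω)) :=
    stronglyMeasurable_drift hT.le hF hX hXc
  have hkd : ∀ ω, IsDriver fun s => F (X (clamp T s) ω) := isDriver_drift hT.le hF hXc
  obtain ⟨g, hg⟩ : ∃ g, g = schemeDriver j hργ hγ1 F T h (h ^ (-χ)) y o := ⟨_, rfl⟩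
  have hgm : StronglyMeasurable (Function.uncurry g) := by
    rw [hg]; exact stronglyMeasurable_schemeDriver hF hy ho
  have hgd : ∀ ω, IsDriver fun s => g s ω := by
    rw [hg]; exact isDriver_schemeDriver hF hh hy ho
  have hgt : ∀ s ∈ Icc 0 T, ∀ ω, g s ω = tamed j hργ hγ1 F (h ^ (-χ)) y o (gridFloor h s) ω := by
    rw [hg]; exact fun s hs ω => schemeDriver_of_mem hh hs ω
  have hgc : ∀ t ∈ Ico 0 T, ∀ ω, ContinuousWithinAt (fun s => g s ω) (Ici t) t := by
    rw [hg]; exact fun t ht ω => continuousWithinAt_schemeDriver hh ht ω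
  rw [← hg] at hyeq
  clear hg
  have hFX : ∀ s ∈ Icc 0 T, lpN P q (fun ω => ‖F (X s ω)‖ₑ) ≤ bF := by
    intro s hs
    refine (lpN_growth_le hG0 ha hq1 hgrow (hX s hs)).trans ?_
    rw [hbF]
    gcongr
    exact hbX s hs
  have hFX2 : ∀ s ∈ Icc 0 T, lpN P (2 * p) (fun ω => ‖F (X s ω)‖ₑ) ≤ bF := fun s hs =>
    (lpN_le_lpN_of_le (by linarith) hq2 (hF.enorm.measurable.comp (hX s hs))).trans (hFX s hs)
  have hFY : ∀ s ∈ Icc 0 T, lpN P (2 * p) (fun ω => ‖F (j.incl hργ (y s ω))‖ₑ) ≤ bG := by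
    intro s hs
    have hm : Measurable fun ω => j.incl hργ (y s ω) :=
      (j.continuous_incl hργ).measurable.comp (hy s hs)
    refine (lpN_growth_le hG0 ha (by linarith) hgrow hm).trans ?_
    rw [hbG]
    have hq' : 0 < 2 * p * (1 + φ / 2) := by positivity
    gcongr
    refine (lpN_mono hq'.le fun ω => enorm_le_ofReal_mul_enorm hKγ0 (hKγ _)).trans ?_
    rw [lpN_const_mul hq' ENNReal.ofReal_ne_top, ← hκ]
    gcongr
    exact (lpN_le_lpN_of_le hq' (by nlinarith) (hy s hs).enorm).trans (hbY s hs)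
  have hvm : ∀ s ∈ Icc 0 T, Measurable fun ω =>
      j.proj I (𝔄.conv I (fun s => F (X (clamp T s) ω)) s) + j.incl hρ1 (o s ω) := fun s hs =>
    (stronglyMeasurable_proj_conv_add j hρ1 hkm (ho s hs) I hs.1).measurable
  have ho' : ∀ s ∈ Icc 0 T, lpN P q (fun ω => ‖j.incl hρ1 (o s ω)‖ₑ) ≤ κ * bO := by
    intro s hs
    have hmo : Measurable fun ω => ‖Hsp.incl hγ1 (o s ω)‖ₑ :=
      (Hsp.continuous_incl 𝔄 hγ1).enorm.measurable.comp (ho s hs)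
    refine (lpN_mono hq0.le fun ω => enorm_le_ofReal_mul_enorm (y := Hsp.incl hγ1 (o s ω)) hKγ0 ?_).trans ?_
    · rw [← j.incl_incl hργ hρ1 hγ1]
      exact hKγ _
    · rw [lpN_const_mul hq0 ENNReal.ofReal_ne_top, ← hκ]
      gcongr
      exact (lpN_le_lpN_of_le hq0 hqe hmo).trans (hbO s hs)
  have hv : ∀ s ∈ Icc 0 T, lpN P q (fun ω =>
      ‖j.proj I (𝔄.conv I (fun s => F (X (clamp T s) ω)) s) + j.incl hρ1 (o s ω)‖ₑ) ≤ bv := by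
    intro s hs
    refine (lpN_proj_conv_add_le hρ1 hkm hkd I hq1 hρ (by linarith) hs (ho s hs) (B := bF)
      fun s hs => ?_).trans ?_
    · simp only [clamp_of_mem hs]
      exact hFX s hs
    · rw [hbv, ← hk0]
      gcongr
      exact ho' s hs
  have hPo : ∀ s ∈ Icc 0 T, Measurable fun ω =>
      ‖j.incl hρ1 (𝔄.projTo I 1 (j.toH (O s ω)) - o s ω)‖ₑ := by
    intro s hs
    simp_rw [map_sub, j.incl_projTo]
    have h1 : Measurable fun ω => j.proj I (j.toH (O s ω)) :=
      ((j.proj I).continuous.comp j.toH.continuous).measurable.comp (hO s hs)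
    have h2 : Measurable fun ω => j.incl hρ1 (o s ω) :=
      (j.continuous_incl hρ1).measurable.comp (ho s hs)
    exact (h1.sub h2).enorm
  have hD2' : ∀ s ∈ Icc 0 T, lpN P (2 * p) (fun ω => ‖j.incl hρ1
      (𝔄.projTo I 1 (j.toH (O s ω)) - o s ω)‖ₑ) ≤ cD * β := fun s hs =>
    (lpN_le_lpN_of_le (by linarith) hq2 (hPo s hs)).trans (hD2 s hs)
  have hXv : ∀ s ∈ Icc 0 T, lpN P (2 * p) (fun ω => ‖X s ω
      - (j.proj I (𝔄.conv I (fun s => F (X (clamp T s) ω)) s) + j.incl hρ1 (o s ω))‖ₑ)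
      ≤ c4 * β := by
    intro s hs
    refine (lpN_sub_galerkin_le hT.le hF hρ1 hX hXc hs (hO s hs) (ho s hs) (hX_eq s hs) I
      (by linarith) hρ hϱ hρϱ hFX2).trans ?_
    rw [← hk1]
    calc _ ≤ ‖j.ofHsp‖ₑ * (β * (k1 * bF)) + (β + cD * β) := by
          gcongr
          · exact hPO s hs
          · exact hD2' s hs
      _ = c4 * β := by rw [hc4]; ring
  have hB1 : ∀ s ∈ Icc 0 T, lpN P p (fun ω => ‖F (X s ω)
      - F (j.proj I (𝔄.conv I (fun s => F (X (clamp T s) ω)) s) + j.incl hρ1 (o s ω))‖ₑ)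
      ≤ c5 * β := by
    intro s hs
    refine (lpN_polyLipschitz_le hL ha (by linarith) hFL (hX s hs) (hvm s hs)).trans ?_
    rw [h2pφ]
    calc _ ≤ ENNReal.ofReal L * (c4 * β * (1 + bX ^ (φ / 2) + bv ^ (φ / 2))) := by
          gcongr
          · exact hXv s hs
          · exact (lpN_le_lpN_of_le (by linarith) (hqφ.trans hqe') (hX s hs).enorm).trans
              (hbX s hs)
          · exact (lpN_le_lpN_of_le (by linarith) hqφ (hvm s hs).enorm).trans (hv s hs)
      _ = c5 * β := by rw [hc5]; ring
  have hB2 : ∀ s ∈ Icc 0 T, lpN P p (fun ω =>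
      ‖F (j.proj I (𝔄.conv I (fun s => g s ω) s) + j.incl hρ1 (o s ω)) - g s ω‖ₑ) ≤ c6 * β := by
    intro s hs
    refine (lpN_scheme_defect_le (e := e) (r := ϱ) (ϑ := ϑ) hρ1 hgm hgd hF hL hφ hFL hh
      (by linarith) hϑ hρ hϱ hρϱ (by linarith) (hqφ.trans hqe) heϑ hy ho hO I hgt hyeq hKγ0 hKγ
      hbY hbO hFY hD1 hD2' hs).trans ?_
    rw [← hk1, ← hκ, ENNReal.mul_rpow_of_nonneg _ _ hϑ.le]
    calc _ ≤ ENNReal.ofReal L * ((‖j.ofHsp‖ₑ * (cα * β * (2 * (k1 * bG)))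
            + (cD * β + (cD * β + cD * β))) * (1 + (κ * bY) ^ (φ / 2) + (κ * bY) ^ (φ / 2)))
            + bG * (cα * β * (bY + bO) ^ ϑ) := by
          gcongr
      _ = c6 * β := by rw [hc6]; ring
  have hXvm : Measurable fun ω => ‖X t ω
      - (j.proj I (𝔄.conv I (fun s => F (X (clamp T s) ω)) t) + j.incl hρ1 (o t ω))‖ₑ :=
    ((hX t ht).sub (hvm t ht)).enorm
  refine (lpN_error_le hT.le hc hρ1 hF hF_mono I hX hXc ho hoc hoI hgm hgd hgc hp ht (hyeq t ht)
    ((lpN_le_lpN_of_le hp0 (by linarith) hXvm).trans (hXv t ht)) hB1 hB2).trans_eq ?_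
  ring

end DiagonalData

/-! ### Assembly of the two conclusions. -/

theorem mainTheorem3
    -- the Hilbert space, the orthonormal basis and the diagonal operator `A`
    {ι H : Type*} [Nonempty ι] [NormedAddCommGroup H] [InnerProductSpace ℝ H] [CompleteSpace H]
    [TopologicalSpace.SeparableSpace H] (𝔄 : DiagonalData ι H)
    -- the parameters
    (T c φ ε ρ γ χ : ℝ) (hT : 0 < T) (hc : 0 < c) (hφ : 0 < φ) (hε : ε ∈ Ico (0 : ℝ) 1)
    (hρ : ρ ∈ Ico (0 : ℝ) (1 / 2)) (hγ : γ ∈ Ioc ρ (1 / 2))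
    (hχ : χ ∈ Ioc 0 ((γ - ρ) / (1 + φ / 2)) ∩ Ioc 0 ((1 - ρ) / (1 + φ)))
    -- the family of finite nonempty subsets of the basis
    (𝓓 : Set (Finset ι)) (h𝓓 : ∀ I ∈ 𝓓, I.Nonempty)
    -- the Banach space `V` between `H_ρ` and `H`
    {V : Type*} [NormedAddCommGroup V] [NormedSpace ℝ V] [CompleteSpace V]
    [MeasurableSpace V] [BorelSpace V] (j : 𝔄.Between ρ V)
    -- the functionals in the coercivity condition
    (phi Phi : C(Icc (0 : ℝ) T, 𝔄.Hsp 1) → ℝ≥0)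
    (hphi : Measurable[borel _] phi) (hPhi : Measurable[borel _] Phi)
    -- the nonlinearity: monotonicity, coercivity and local Lipschitz continuity
    (F : V → H) (hF : Continuous F)
    (hF_mono : ∀ (I : Finset ι) (v w : 𝔄.Hsp 1),
      v.toH ∈ 𝔄.projRange I → w.toH ∈ 𝔄.projRange I →
      inner ℝ (v.toH - w.toH)
          (v.gen + F (j.incl (le_one_of_lt_half hρ.2) v)
            - w.gen - F (j.incl (le_one_of_lt_half hρ.2) w))
        ≤ c * ‖v.toH - w.toH‖ ^ 2)
    (hF_coercive : ∀ (I : Finset ι) (v : 𝔄.Hsp 1), v.toH ∈ 𝔄.projRange I →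
      ∀ (x : C(Icc (0 : ℝ) T, 𝔄.Hsp 1)) (t : Icc (0 : ℝ) T),
      inner ℝ (DiagonalData.Hsp.incl half_le_one_real v)
          (𝔄.projTo I (1 / 2) (F (j.incl (le_one_of_lt_half hρ.2) (v + x t))))
        + phi x * inner ℝ v.toH (F (j.incl (le_one_of_lt_half hρ.2) (v + x t)))
      ≤ ε * ‖v‖ ^ 2
        + (c + phi x) * ‖DiagonalData.Hsp.incl half_le_one_real v‖ ^ 2
        + c * phi x * ‖v.toH‖ ^ 2 + Phi x)
    (hF_lip : ∀ (I : Finset ι) (v w : V),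
      j.toH v ∈ 𝔄.projRange I → j.toH w ∈ 𝔄.projRange I →
      ‖F v - F w‖ ^ 2 ≤ c * ‖v - w‖ ^ 2 * (1 + ‖v‖ ^ φ + ‖w‖ ^ φ))
    -- the stochastic processes
    {Ω : Type*} [MeasurableSpace Ω] (P : Measure Ω) [IsProbabilityMeasure P]
    (X O : ℝ → Ω → V) (OO : ℕ+ → 𝓓 → ℝ → Ω → 𝔄.Hsp 1) (Y : ℕ+ → 𝓓 → ℝ → Ω → 𝔄.Hsp γ)
    (hX_meas : ∀ t ∈ Icc 0 T, Measurable (X t))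
    (hX_cont : ∀ ω, ContinuousOn (fun t => X t ω) (Icc 0 T))
    (hO_meas : ∀ t ∈ Icc 0 T, Measurable (O t))
    (hO_cont : ∀ ω, ContinuousOn (fun t => O t ω) (Icc 0 T))
    (hOO_meas : ∀ M I, ∀ t ∈ Icc 0 T, Measurable (OO M I t))
    (hOO_cont : ∀ M I ω, ContinuousOn (fun t => OO M I t ω) (Icc 0 T))
    (hOO_range : ∀ (M : ℕ+) (I : 𝓓), ∀ t ∈ Icc 0 T, ∀ ω, (OO M I t ω).toH ∈ 𝔄.projRange (I : Finset ι))
    (hY_meas : ∀ M I, ∀ t ∈ Icc 0 T, Measurable (Y M I t))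
    -- the mild equation for `X` and the numerical scheme for `Y`
    (hX_eq : ∀ t ∈ Icc 0 T, ∀ᵐ ω ∂P,
      j.toH (X t ω) = (∫ s in (0 : ℝ)..t, 𝔄.semigroup (t - s) (F (X s ω))) + j.toH (O t ω))
    (hY_eq : ∀ (M : ℕ+) (I : 𝓓), ∀ t ∈ Icc 0 T, ∀ᵐ ω ∂P,
      (Y M I t ω).toH
        = (∫ s in (0 : ℝ)..t, 𝔄.proj I (𝔄.semigroup (t - s)
            (if ‖Y M I (gridFloor (T / M) s) ω‖
                + ‖DiagonalData.Hsp.incl (le_one_of_le_half hγ.2)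
                    (OO M I (gridFloor (T / M) s) ω)‖ ≤ (M / T) ^ χ
              then F (j.incl hγ.1.le (Y M I (gridFloor (T / M) s) ω)) else 0)))
          + (OO M I t ω).toH)
    -- the additional parameters and the moment assumptions
    (θ ϑ p ϱ : ℝ) (hθ : 0 ≤ θ) (hϑ : 0 < ϑ) (hp : max 2 (1 / φ) ≤ p)
    (hϱ : ϱ ∈ Ico 0 (1 - ρ))
    (hX_moment : (⨆ t ∈ Icc 0 T,
      ∫⁻ ω, ENNReal.ofReal (‖X t ω‖ ^ (p * (1 + φ / 2) * max 2 φ)) ∂P) < ∞)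
    (hO_approx : (⨆ (M : ℕ+) (I : 𝓓), ⨆ t ∈ Icc 0 T,
      ((M : ℕ) : ℝ≥0∞) ^ θ *
        (eLpNorm (fun ω => j.incl (le_one_of_lt_half hρ.2)
            (𝔄.projTo I 1 (j.toH (O t ω - O (gridFloor (T / M) t) ω))))
            (ENNReal.ofReal (2 * p)) P
          + eLpNorm (fun ω => j.incl (le_one_of_lt_half hρ.2)
              (𝔄.projTo I 1 (j.toH (O t ω)) - OO M I t ω))
              (ENNReal.ofReal (p * max 2 φ)) P)) < ∞)
    (hOO_moment : (⨆ (M : ℕ+) (I : 𝓓), ⨆ t ∈ Icc 0 T,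
      ∫⁻ ω, ENNReal.ofReal
        ((‖DiagonalData.Hsp.incl (le_one_of_le_half hγ.2) (OO M I t ω)‖ ^ 2
            + Phi (pathOn (hOO_cont M I ω)) + phi (pathOn (hOO_cont M I ω)))
          ^ (p * max (2 * ϑ) (max (2 + φ) ((1 + φ / 2) * (φ / 2))))) ∂P) < ∞) :
    ((⨆ (M : ℕ+) (I : 𝓓), ⨆ t ∈ Icc 0 T,
      ∫⁻ ω, ENNReal.ofReal
        (‖Y M I t ω‖ ^ (p * max (4 * ϑ) (max (4 + 2 * φ) (φ * (1 + φ / 2))))) ∂P) < ∞) ∧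
    ∃ C : ℝ, 0 < C ∧ ∀ (M : ℕ+) (I : 𝓓),
      (⨆ t ∈ Icc 0 T, eLpNorm (fun ω => j.toH (X t ω) - (Y M I t ω).toH) (ENNReal.ofReal p) P)
        ≤ ENNReal.ofReal C *
          (((M : ℕ) : ℝ≥0∞) ^ (-min (ϑ * χ) (min ϱ θ))
            + ‖𝔄.negPow ϱ hϱ.1 ∘L (ContinuousLinearMap.id ℝ H - 𝔄.proj I)‖ₑ
            + ⨆ t ∈ Icc 0 T,
                eLpNorm (fun ω => O t ω
                    - j.incl (le_one_of_lt_half hρ.2) (𝔄.projTo I 1 (j.toH (O t ω))))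
                  (ENNReal.ofReal (2 * p)) P) := by
  have := j.secondCountable
  have hL := Real.sqrt_nonneg c
  have hFL := PolyLipschitz.of_sq hc.le (j.lipschitz_of_projRange hF hφ hF_lip)
  have hp2 : 2 ≤ p := (le_max_left _ _).trans hp
  have hp0 : 0 < p := by linarith
  have hpφ : 1 ≤ p * φ := (div_le_iff₀ hφ).1 ((le_max_right _ _).trans hp)
  have hχ1 : χ * (1 + φ / 2) ≤ γ - ρ := (le_div_iff₀ (by positivity)).1 hχ.1.2
  have hχ2 : χ * (1 + φ) ≤ 1 - ρ := (le_div_iff₀ (by positivity)).1 hχ.2.2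
  have hM : ∀ M : ℕ+, (1 : ℝ) ≤ ((M : ℕ) : ℝ) := fun M => by exact_mod_cast M.pos
  have hh : ∀ M : ℕ+, 0 < T / ((M : ℕ) : ℝ) := fun M => by have := hM M; positivity
  have hhT : ∀ M : ℕ+, T / ((M : ℕ) : ℝ) ≤ T := fun M => div_le_self hT.le (hM M)
  -- With step size `h = T/M` the truncation level `(M/T)^χ` is `h^{-χ}`.
  have hhχ : ∀ M : ℕ+, (((M : ℕ) : ℝ) / T) ^ χ = (T / ((M : ℕ) : ℝ)) ^ (-χ) := fun M => by
    rw [Real.rpow_neg (hh M).le, ← Real.inv_rpow (hh M).le, inv_div]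
  have hscheme : ∀ (M : ℕ+) (I : 𝓓), ∀ t ∈ Icc 0 T, ∀ᵐ ω ∂P, (Y M I t ω).toH
      = 𝔄.conv I (fun s => DiagonalData.schemeDriver j hγ.1.le (le_one_of_le_half hγ.2) F T
        (T / ((M : ℕ) : ℝ)) ((T / ((M : ℕ) : ℝ)) ^ (-χ)) (Y M I) (OO M I) s ω) t
        + (OO M I t ω).toH := by
    intro M I t ht
    filter_upwards [hY_eq M I t ht] with ω hω
    rw [hω, ← DiagonalData.integral_tamed_eq_conv hF (hh M) (hY_meas M I) (hOO_meas M I) I ht ω,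
      ← hhχ M]
    simp only [DiagonalData.tamed]
  obtain ⟨C, hC, hbound⟩ := DiagonalData.exists_ae_norm_sq_scheme_le (P := P) hT hc hφ hε hρ hγ
    hχ.1.1 hχ1 hχ2 j hF_coercive hF hL hFL
  -- `m` is the moment order of the noise functional. The pathwise bound concerns `‖Y‖²`, so `Y` has
  -- moments of order `2m`, which is the exponent in (i).
  obtain ⟨m, hm⟩ : ∃ m, m = p * max (2 * ϑ) (max (2 + φ) ((1 + φ / 2) * (φ / 2))) := ⟨_, rfl⟩
  have hm2 : p * max (4 * ϑ) (max (4 + 2 * φ) (φ * (1 + φ / 2))) = 2 * m := by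
    rw [hm, mul_left_comm 2, mul_max_of_nonneg (2 * ϑ) _ zero_le_two,
      mul_max_of_nonneg (2 + φ) _ zero_le_two]
    rw [show 4 * ϑ = 2 * (2 * ϑ) by ring, show 4 + 2 * φ = 2 * (2 + φ) by ring,
      show φ * (1 + φ / 2) = 2 * ((1 + φ / 2) * (φ / 2)) by ring]
  have hm_ϑ : p * (2 * ϑ) ≤ m := by
    rw [hm]; gcongr; exact le_max_left _ _
  have hm_φ : p * (2 + φ) ≤ m := by
    rw [hm]; gcongr; exact (le_max_left _ _).trans (le_max_right _ _)
  have hm_φφ : p * ((1 + φ / 2) * (φ / 2)) ≤ m := by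
    rw [hm]; gcongr; exact (le_max_right _ _).trans (le_max_right _ _)
  have hm0 : 0 < m := lt_of_lt_of_le (by positivity) hm_φ
  rw [← hm] at hOO_moment
  rw [hm2]
  set S := ⨆ (M : ℕ+) (I : 𝓓), ⨆ t ∈ Icc 0 T, ∫⁻ ω, ENNReal.ofReal
    ((‖DiagonalData.Hsp.incl (le_one_of_le_half hγ.2) (OO M I t ω)‖ ^ 2
      + Phi (pathOn (hOO_cont M I ω)) + phi (pathOn (hOO_cont M I ω))) ^ m) ∂P with hS
  have hS_le : ∀ (M : ℕ+) (I : 𝓓), ∀ t ∈ Icc 0 T, ∫⁻ ω, ENNReal.ofReal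
      ((‖DiagonalData.Hsp.incl (le_one_of_le_half hγ.2) (OO M I t ω)‖ ^ 2
        + Phi (pathOn (hOO_cont M I ω)) + phi (pathOn (hOO_cont M I ω))) ^ m) ∂P ≤ S :=
    fun M I t ht => le_iSup_of_le M (le_iSup_of_le I (le_iSup₂_of_le t ht le_rfl))
  have hY_moment : ∀ (M : ℕ+) (I : 𝓓), ∀ t ∈ Icc 0 T,
      ∫⁻ ω, ENNReal.ofReal (‖Y M I t ω‖ ^ (2 * m)) ∂P
        ≤ ENNReal.ofReal ((C * 2) ^ m) * (1 + S) := by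
    intro M I t ht
    have hae := hbound _ (hh M) (hhT M) I (OO M I) (hOO_cont M I) (hOO_meas M I) (hOO_range M I)
      (Y M I) (hY_meas M I) (hscheme M I) t ht
    calc ∫⁻ ω, ENNReal.ofReal (‖Y M I t ω‖ ^ (2 * m)) ∂P
        ≤ ∫⁻ ω, ENNReal.ofReal ((C * 2) ^ m) * (1 + ENNReal.ofReal
          ((‖DiagonalData.Hsp.incl (le_one_of_le_half hγ.2) (OO M I t ω)‖ ^ 2
            + Phi (pathOn (hOO_cont M I ω)) + phi (pathOn (hOO_cont M I ω))) ^ m)) ∂P := by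
          refine lintegral_mono_ae ?_
          filter_upwards [hae] with ω hω
          exact ofReal_rpow_two_mul_le (norm_nonneg _) hC (by positivity) hm0.le hω
      _ ≤ _ := by
          rw [lintegral_const_mul' _ _ ENNReal.ofReal_ne_top,
            lintegral_add_left measurable_const, lintegral_one, measure_univ]
          gcongr
          exact hS_le M I t ht
  have hSY_top : ENNReal.ofReal ((C * 2) ^ m) * (1 + S) ≠ ∞ :=
    ENNReal.mul_ne_top ENNReal.ofReal_ne_top
      (ENNReal.add_ne_top.2 ⟨ENNReal.one_ne_top, hOO_moment.ne⟩)
  refine ⟨lt_of_le_of_lt (iSup_le fun M => iSup_le fun I => iSup₂_le fun t ht =>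
    hY_moment M I t ht) hSY_top.lt_top, ?_⟩
  set SX := ⨆ t ∈ Icc 0 T,
    ∫⁻ ω, ENNReal.ofReal (‖X t ω‖ ^ (p * (1 + φ / 2) * max 2 φ)) ∂P with hSX
  have hqX : 0 < p * max 2 φ * (1 + φ / 2) := by positivity
  have hbX : ∀ t ∈ Icc 0 T, lpN P (p * max 2 φ * (1 + φ / 2)) (fun ω => ‖X t ω‖ₑ)
      ≤ SX ^ (1 / (p * max 2 φ * (1 + φ / 2))) := by
    intro t ht
    refine lpN_le_of_lintegral_le hqX ?_
    simp_rw [enorm_rpow_eq _ hqX.le, mul_right_comm p]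
    exact le_iSup₂_of_le t ht le_rfl
  have hbY : ∀ (M : ℕ+) (I : 𝓓), ∀ t ∈ Icc 0 T, lpN P (2 * m) (fun ω => ‖Y M I t ω‖ₑ)
      ≤ (ENNReal.ofReal ((C * 2) ^ m) * (1 + S)) ^ (1 / (2 * m)) := by
    intro M I t ht
    refine lpN_le_of_lintegral_le (by positivity) ?_
    simp_rw [enorm_rpow_eq (r := 2 * m) _ (by positivity)]
    exact hY_moment M I t ht
  have hbO : ∀ (M : ℕ+) (I : 𝓓), ∀ t ∈ Icc 0 T, lpN P (2 * m) (fun ω =>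
      ‖DiagonalData.Hsp.incl (le_one_of_le_half hγ.2) (OO M I t ω)‖ₑ) ≤ S ^ (1 / (2 * m)) := by
    intro M I t ht
    refine lpN_le_of_lintegral_le (by positivity) ?_
    simp_rw [enorm_rpow_eq (r := 2 * m) _ (by positivity)]
    refine (lintegral_mono fun ω => ENNReal.ofReal_le_ofReal ?_).trans (hS_le M I t ht)
    rw [Real.rpow_mul (norm_nonneg _), Real.rpow_two]
    gcongr
    rw [add_assoc]
    exact le_add_of_nonneg_right (by positivity)
  set SO := ⨆ (M : ℕ+) (I : 𝓓), ⨆ t ∈ Icc 0 T, ((M : ℕ) : ℝ≥0∞) ^ θ *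
        (eLpNorm (fun ω => j.incl (le_one_of_lt_half hρ.2)
            (𝔄.projTo I 1 (j.toH (O t ω - O (gridFloor (T / M) t) ω))))
            (ENNReal.ofReal (2 * p)) P
          + eLpNorm (fun ω => j.incl (le_one_of_lt_half hρ.2)
              (𝔄.projTo I 1 (j.toH (O t ω)) - OO M I t ω))
              (ENNReal.ofReal (p * max 2 φ)) P) with hSO
  have hM0 : ∀ M : ℕ+, ((M : ℕ) : ℝ≥0∞) ≠ 0 := fun M => by exact_mod_cast M.ne_zero
  have hMr : ∀ (M : ℕ+) {x : ℝ}, min (ϑ * χ) (min ϱ θ) ≤ x →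
      ((M : ℕ) : ℝ≥0∞) ^ (-x) ≤ ((M : ℕ) : ℝ≥0∞) ^ (-min (ϑ * χ) (min ϱ θ)) := fun M x hx =>
    ENNReal.rpow_le_rpow_of_exponent_le (by exact_mod_cast M.pos) (neg_le_neg hx)
  have hO_le : ∀ (M : ℕ+) (I : 𝓓), ∀ t ∈ Icc 0 T,
      eLpNorm (fun ω => j.incl (le_one_of_lt_half hρ.2)
            (𝔄.projTo I 1 (j.toH (O t ω - O (gridFloor (T / M) t) ω))))
            (ENNReal.ofReal (2 * p)) P
          + eLpNorm (fun ω => j.incl (le_one_of_lt_half hρ.2)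
              (𝔄.projTo I 1 (j.toH (O t ω)) - OO M I t ω))
              (ENNReal.ofReal (p * max 2 φ)) P
        ≤ SO * ((M : ℕ) : ℝ≥0∞) ^ (-min (ϑ * χ) (min ϱ θ)) := by
    intro M I t ht
    have h1 : ((M : ℕ) : ℝ≥0∞) ^ θ * _ ≤ SO :=
      le_iSup_of_le M (le_iSup_of_le I (le_iSup₂_of_le t ht le_rfl))
    refine le_trans ?_ (mul_le_mul_right (hMr M ((min_le_right _ _).trans (min_le_right _ _))) SO)
    rw [ENNReal.rpow_neg, ← div_eq_mul_inv, ENNReal.le_div_iff_mul_le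
      (Or.inl (by simp [ENNReal.rpow_eq_zero_iff, hM0 M]))
      (Or.inl (ENNReal.rpow_ne_top_of_nonneg hθ (ENNReal.natCast_ne_top _))), mul_comm]
    exact h1
  -- `cα` is a sum so that it dominates both `T^ϱ` and `T^{χϑ}`, the constants left when `h^ϱ` and
  -- `h^{χϑ}` are written as powers of `M`.
  obtain ⟨K, hK, hmain⟩ := DiagonalData.exists_strong_error_le (P := P) (j := j) (χ := χ) (O := O)
    (ϑ := ϑ) (ϱ := ϱ) (e := 2 * m) (cD := SO)
    (cα := ENNReal.ofReal (T ^ ϱ) + ENNReal.ofReal (T ^ χ) ^ ϑ)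
    (bY := (ENNReal.ofReal ((C * 2) ^ m) * (1 + S)) ^ (1 / (2 * m)))
    (bO := S ^ (1 / (2 * m))) hT hc.le hφ hρ.1
    (le_one_of_lt_half hρ.2) hγ.1.le (le_one_of_le_half hγ.2) hF hF_mono hL hFL hX_meas hX_cont
    hO_meas hX_eq hp2 hpφ hϑ hϱ.1 (by linarith [hϱ.2])
    (by
      -- The moment order needed for `F` is `p(2 + φ)` or `pφ(1 + φ/2)`; both are at most `2m`.
      rcases max_cases 2 φ with ⟨h, -⟩ | ⟨h, -⟩ <;> rw [h] <;> linarith)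
    (by linarith) (ENNReal.rpow_ne_top_of_nonneg (by positivity) hX_moment.ne)
    (ENNReal.rpow_ne_top_of_nonneg (by positivity) hSY_top)
    (ENNReal.rpow_ne_top_of_nonneg (by positivity) hOO_moment.ne) hO_approx.ne
    (ENNReal.add_ne_top.2 ⟨ENNReal.ofReal_ne_top,
      ENNReal.rpow_ne_top_of_nonneg hϑ.le ENNReal.ofReal_ne_top⟩) hbX
  refine ⟨K.toReal + 1, by positivity, fun M I => iSup₂_le fun t ht => ?_⟩
  -- `β` is the whole right-hand side without its constant. Each error term is at most a fixed
  -- multiple of `β`, possibly with `β = ∞`.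
  obtain ⟨β, hβ⟩ : ∃ β, β = ((M : ℕ) : ℝ≥0∞) ^ (-min (ϑ * χ) (min ϱ θ))
      + ‖𝔄.negPow ϱ hϱ.1 ∘L (ContinuousLinearMap.id ℝ H - 𝔄.proj I)‖ₑ
      + ⨆ t ∈ Icc 0 T, eLpNorm (fun ω => O t ω
        - j.incl (le_one_of_lt_half hρ.2) (𝔄.projTo I 1 (j.toH (O t ω))))
          (ENNReal.ofReal (2 * p)) P := ⟨_, rfl⟩
  rw [← hβ]
  have hβ1 : ((M : ℕ) : ℝ≥0∞) ^ (-min (ϑ * χ) (min ϱ θ)) ≤ β := by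
    rw [hβ, add_assoc]; exact le_self_add
  have hβ2 : ‖𝔄.negPow ϱ hϱ.1 ∘L (ContinuousLinearMap.id ℝ H - 𝔄.proj I)‖ₑ ≤ β := by
    rw [hβ]; exact le_add_self.trans le_self_add
  have hβ3 : (⨆ t ∈ Icc 0 T, eLpNorm (fun ω => O t ω
        - j.incl (le_one_of_lt_half hρ.2) (𝔄.projTo I 1 (j.toH (O t ω))))
          (ENNReal.ofReal (2 * p)) P) ≤ β := by
    rw [hβ]; exact le_add_self
  have h2p : 0 < 2 * p := by positivity
  have hq0 : 0 < p * max 2 φ := by positivity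
  rw [eLpNorm_eq_lpN hp0]
  refine (hmain _ (hh M) I (OO M I) (hOO_cont M I) (hOO_meas M I) (hOO_range M I) (Y M I)
    (hY_meas M I) (hscheme M I) (hbY M I) (hbO M I) β (fun s hs => ?_) (fun s hs => ?_) ?_ ?_ hβ2
    (fun s hs => ?_) t ht).trans ?_
  · rw [← eLpNorm_eq_lpN h2p]
    exact (le_self_add.trans (hO_le M I s hs)).trans (by gcongr)
  · rw [← eLpNorm_eq_lpN hq0]
    exact (le_add_self.trans (hO_le M I s hs)).trans (by gcongr)
  · rw [ofReal_div_natCast_rpow hT.le]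
    exact mul_le_mul' le_self_add
      ((hMr M ((min_le_right _ _).trans (min_le_left _ _))).trans hβ1)
  · rw [ofReal_div_natCast_rpow hT.le, ENNReal.mul_rpow_of_nonneg _ _ hϑ.le, ← ENNReal.rpow_mul]
    rw [neg_mul, mul_comm χ]
    exact mul_le_mul' le_add_self ((hMr M (min_le_left _ _)).trans hβ1)
  · rw [← eLpNorm_eq_lpN h2p]
    exact (le_iSup₂_of_le s hs le_rfl).trans hβ3
  · gcongr
    rw [← ENNReal.ofReal_toReal hK]
    exact ENNReal.ofReal_le_ofReal (by rw [ENNReal.toReal_ofReal ENNReal.toReal_nonneg]; linarith)
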